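/- **Setting.** A finite episodic two-player Markov game with $H\ge 1$ steps has state sets $S_1,\dots,S_{H+1}$ ($S_{H+1}$ consists of a single terminal state), learner action sets $A_1,\dots,A_H$, opponent action sets $B_1,\dots,B_H$, transitions $P_h:S_h\times A_h\times B_h\to\Delta(S_{h+1})$ and rewards $r_h:S_h\times A_h\times B_h\to[0,1]$. Put $S=\bigcup_{h\le H+1}S_h$, $A=\bigcup_{h\le H}A_h$. There are $K\ge 2$ episodes. The opponent is oblivious: its policies $\nu^1,\dots,\nu^K$, $\nu^k_h:S_h\to\Delta(B_h)$, are fixed in advance. In episode $k$ an initial state $s^k_1\in S_1$ is chosen as an arbitrary function of the history of the previous episodes, the learner commits to a policy $\mu^k$, and at each step $h$ actions $a^k_h\sim\mu^k_h(s^k_h)$, $b^k_h\sim\nu^k_h(s^k_h)$ are drawn independently, $r^k_h=r_h(s^k_h,a^k_h,b^k_h)$ is received and $s^k_{h+1}\sim P_h(\cdot\mid s^k_h,a^k_h,b^k_h)$. Write $V^{\mu,\nu}_h(s)$ for the expected sum of the rewards of steps $h,\dots,H$ from $s$ under $(\mu,\nu)$, and $\mathbb D_{\mu,\nu}[Q](s)=\mathbb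 E_{a\sim\mu,\,b\sim\nu}[Q(s,a,b)]$. The empirical Nash values are $V^*_{H+1}=0$ and $V^*_h(s)=\max_{\mu\in\Delta(A_h)}\min_{k\le K}\mathbb D_{\mu,\nu^k_h(s)}[r_h+P_hV^*_{h+1}](s)$, and $\mathrm{ENR}_K=\sum_{k=1}^K\big(V^*_1(s^k_1)-V^{\mu^k,\nu^k}_1(s^k_1)\big)$. Let $\nu^*_h(s)$ be any minimizer, over $\nu$ in the convex hull of $\nu^1_h(s),\dots,\nu^K_h(s)$, of $\max_{\mu\in\Delta(A_h)}\mathbb D_{\mu,\nu}[r_h+P_hV^*_{h+1}](s)$, and let $C=\sum_{h=1}^H\sum_{k=1}^K\mathrm{TV}\big(\nu^k_h(s^k_h),\nu^*_h(s^k_h)\big)$. **Algorithm (epoch V-learning with parameters $\eta,\iota$).** For each pair $(h,s)$ the learner keeps an estimate $V_h(s)$, initially $H-h+1$ (and $V_{H+1}=0$), and a policy $\mu_h(\cdot|s)$, initially uniform; $V^k_h$ and $\mu^k_h$ denote their values at the start of episode $k$. The visits to $(h,s)$ are divided into epochs: with $N_0=1$, epoch $\tau$ ends when its number of visits $N_\tau$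 reaches $\lceil(1+\eta)N_{\tau-1}\rceil$. When it ends, $V_h(s)$ is set to $\min\{H-h+1,\ \frac1{N_\tau}\sum_j(r^j_h+V^j_{h+1}(s^j_{h+1}))+\sqrt{\iota/N_\tau}\}$, the sum being over the episodes $j$ of the visits in the epoch, and the policy is reset to uniform and a new bandit instance is started. At any other visit, in episode $k$, the bandit instance of $(h,s)$ receives the action $a^k_h$ and the value $x=\frac1H(r^k_h+V^k_{h+1}(s^k_{h+1}))\in[0,1]$ and outputs the next policy. The bandit subroutine is FTRL with $\frac12$-Tsallis entropy, implicit exploration and the doubling trick: with $n=|A_h|$, its rounds are divided into blocks $i=0,1,2,\dots$ of length $2^i$, each started from scratch. In block $i$, a round with distribution $p$, drawn action $a$ and value $x$ yields the estimated losses $\hat\ell(a')=\mathbf 1[a'=a]\,(1-x)/(p(a)+\gamma_i)$, and the next distribution minimizes $\langle p,\hat L\rangle-\frac{2}{\lambda_i}\big(\sum_{a'}\sqrt{p(a')}-1\big)$ over $\Delta(A_h)$, where $\hat L$ is the sum of the estimated losses in the block, $\lambda_i=c_\lambda 2^{-i/2}$ and $\gamma_i=c_\gamma\sqrt{\log(n/\delta')/(n2^i)}$.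 The confidence parameter is $\delta'=\delta/(4H|S|M)$ with $M=\lceil(1+\eta)\log K/\eta\rceil$. **Theorem.** For all constants $c_\lambda,c_\gamma>0$ there are constants $c_0,C_0>0$, depending only on $c_\lambda,c_\gamma$, such that for every game and opponent as above, every rule for the initial states, every choice of $\nu^*$, every $\delta\in(0,1)$, every $K\ge 2$ with $K\ge H|S|$, every $\eta\in[|S|/K,\,1/H]$ and every $\iota\ge c_0H^2|A|\log(HK|A||S|/\delta)$ (in particular for $\iota$ of exactly this order), with probability at least $1-\delta$, $$\mathrm{ENR}_K\ \le\ \sum_{k=1}^K\big(V^k_1(s^k_1)-V^{\mu^k,\nu^k}_1(s^k_1)\big)\ \le\ C_0\Big(\eta H^3C+H\sqrt{\frac{\iota|S|K\log K}{\eta}}\Big).$$ -/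

import Mathlib

open scoped BigOperators

noncomputable section

namespace EpochV

/-! Indices are shifted by one with respect to the usual convention: the steps of an episode are
`0, …, H - 1` (step `H` is the terminal one) and the episodes are `0, …, K - 1`. -/

/-! ### Probability vectors on finite sets -/

/-- Probability vectors supported on the finite set `X`. -/
def simplexOn {α : Type*} (X : Finset α) : Set (α → ℝ) :=
  {p | (∀ a, 0 ≤ p a) ∧ (∀ a, a ∉ X → p a = 0) ∧ ∑ a ∈ X, p a = 1}

/-- The set of probability distributions on the finite set `X`. -/
abbrev Dist {α : Type*} (X : Finset α) : Type _ := {p : α → ℝ // p ∈ simplexOn X}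

/-- A probability vector, as a law to sample from. -/
def Dist.toPMF {α : Type*} {X : Finset α} (p : Dist X) : PMF α :=
  PMF.ofFinset (fun a => ENNReal.ofReal (p.1 a)) X
    (by rw [← ENNReal.ofReal_sum_of_nonneg (fun a _ => p.2.1 a), p.2.2.2, ENNReal.ofReal_one])
    (fun a ha => by rw [p.2.2.1 a ha, ENNReal.ofReal_zero])

open Classical in
/-- The uniform distribution on a nonempty finite set. -/
def uniformOn {α : Type*} (X : Finset α) (hX : X.Nonempty) : Dist X :=
  ⟨fun a => if a ∈ X then 1 / (X.card : ℝ) else 0, by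
    have h0 : (X.card : ℝ) ≠ 0 := by exact_mod_cast hX.card_pos.ne'
    refine ⟨fun a => ?_, fun a ha => if_neg ha, ?_⟩
    · dsimp only
      split_ifs <;> positivity
    · rw [Finset.sum_congr rfl (fun a ha => if_pos ha), Finset.sum_const, nsmul_eq_mul]
      field_simp⟩

/-- Total variation distance: supremum over events of the difference of probabilities. -/
def tvDist {β : Type*} (p q : β → ℝ) : ℝ :=
  ⨆ E : Finset β, |∑ b ∈ E, p b - ∑ b ∈ E, q b|

/-! ### Follow the regularized leader with the 1/2-Tsallis entropy -/

/-- Cumulative estimated loss plus `1 / lr` times the negative 1/2-Tsallis entropy. -/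
def ftrlObjective {α : Type*} (X : Finset α) (lr : ℝ) (L : α → ℝ) (p : α → ℝ) : ℝ :=
  ∑ a ∈ X, p a * L a + (1 / lr) * (-((∑ a ∈ X, Real.sqrt (p a) - 1) / (1 - 1 / 2)))

theorem exists_ftrl {α : Type*} (X : Finset α) (hX : X.Nonempty) (lr : ℝ) (L : α → ℝ) :
    ∃ p : Dist X, ∀ q : Dist X, ftrlObjective X lr L p.1 ≤ ftrlObjective X lr L q.1 := by
  have hcomp : IsCompact (simplexOn X) := by
    have hsub : simplexOn X ⊆ Set.pi Set.univ (fun _ : α => Set.Icc (0 : ℝ) 1) := by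
      intro p hp a _
      refine ⟨hp.1 a, ?_⟩
      by_cases ha : a ∈ X
      · rw [← hp.2.2]
        exact Finset.single_le_sum (fun i _ => hp.1 i) ha
      · rw [hp.2.1 a ha]
        exact zero_le_one
    refine IsCompact.of_isClosed_subset (isCompact_univ_pi fun _ => isCompact_Icc) ?_ hsub
    have h1 : IsClosed {p : α → ℝ | ∀ a, 0 ≤ p a} := by
      simp only [Set.ofPred_forall]
      exact isClosed_iInter fun a => isClosed_le continuous_const (continuous_apply a)
    have h2 : IsClosed {p : α → ℝ | ∀ a, a ∉ X → p a = 0} := by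
      simp only [Set.ofPred_forall]
      exact isClosed_iInter fun a => isClosed_iInter fun _ =>
        isClosed_eq (continuous_apply a) continuous_const
    have h3 : IsClosed {p : α → ℝ | ∑ a ∈ X, p a = 1} :=
      isClosed_eq (continuous_finsetSum _ fun a _ => continuous_apply a) continuous_const
    exact h1.inter (h2.inter h3)
  have hcont : Continuous (ftrlObjective X lr L) := by
    unfold ftrlObjective
    fun_prop
  obtain ⟨p, hp, hmin⟩ := hcomp.exists_isMinOn ⟨_, (uniformOn X hX).2⟩ hcont.continuousOn
  exact ⟨⟨p, hp⟩, fun q => hmin q.2⟩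

/-- The FTRL distribution for the cumulative estimated losses `L` (for `lr > 0` the minimizer is
unique). -/
def ftrl {α : Type*} (X : Finset α) (hX : X.Nonempty) (lr : ℝ) (L : α → ℝ) : Dist X :=
  Classical.choose (exists_ftrl X hX lr L)

/-! ### The adversarial bandit subroutine -/

/-- Tuning of the algorithm: epoch incremental factor `eta`, confidence width factor `iota`, and,
for the bandit subroutine, the constants in front of its learning rate and of its implicit
exploration parameter, and its confidence parameter. -/
structure Tuning where
  eta : ℝ
  iota : ℝ
  lrConst : ℝ
  ixConst : ℝ
  conf : ℝ

/-- Doubling trick: block `i` lasts `2 ^ i` rounds. The state records the current block, the number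
of rounds already played in it, and the cumulative estimated losses in it. -/
structure BanditState (α : Type*) where
  block : ℕ
  used : ℕ
  loss : α → ℝ

/-- The state of a freshly started bandit instance. -/
def BanditState.start (α : Type*) : BanditState α := ⟨0, 0, fun _ => 0⟩

/-- Learning rate in block `i`. -/
def learningRate (T : Tuning) (i : ℕ) : ℝ := T.lrConst / Real.sqrt (2 ^ i)

/-- Implicit exploration parameter in block `i`, with `n` actions. -/
def ixParam (T : Tuning) (n : ℕ) (i : ℕ) : ℝ :=
  T.ixConst * Real.sqrt (Real.log (n / T.conf) / (n * 2 ^ i))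

open Classical in
/-- One update of the bandit instance: action `a` was drawn from `p`, and value `x ∈ [0, 1]` (loss
`1 - x`) was received. The loss is estimated with implicit exploration; when the current block is
full, the next one, of twice the length, is started from scratch. -/
def BanditState.update {α : Type*} (T : Tuning) (X : Finset α) (st : BanditState α)
    (p : α → ℝ) (a : α) (x : ℝ) : BanditState α :=
  if st.used + 1 = 2 ^ st.block then
    ⟨st.block + 1, 0, fun _ => 0⟩
  else
    ⟨st.block, st.used + 1, fun a' =>
      st.loss a' + if a' = a then (1 - x) / (p a + ixParam T X.card st.block) else 0⟩

/-- The distribution that the bandit instance outputs. -/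
def BanditState.output {α : Type*} (T : Tuning) (X : Finset α) (hX : X.Nonempty)
    (st : BanditState α) : Dist X :=
  ftrl X hX (learningRate T st.block) st.loss

/-! ### Markov games -/

/-- A finite episodic two-player Markov game with `H` steps. At step `h` the states are
`states h ⊆ S` and the actions are `acts h ⊆ A` (learner) and `oppActs h ⊆ B` (opponent). Only
`states 0, …, states H` and the data of the steps `h < H` at states in `states h` play a role; the
values elsewhere are arbitrary. -/
structure MarkovGame (S A B : Type*) (H : ℕ) where
  states : ℕ → Finset S
  acts : ℕ → Finset A
  oppActs : ℕ → Finset B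
  acts_nonempty : ∀ h, (acts h).Nonempty
  card_terminal : (states H).card = 1
  trans : ∀ h : ℕ, S → A → B → Dist (states (h + 1))
  reward : ℕ → S → A → B → ℝ
  reward_mem : ∀ h s a b, reward h s a b ∈ Set.Icc (0 : ℝ) 1

/-- What happens in one step: state, learner's action, opponent's action, next state. -/
abbrev Step (S A B : Type*) : Type _ := S × A × B × S

/-- The sequence of steps of one episode. -/
abbrev Episode (S A B : Type*) (H : ℕ) : Type _ := Fin H → Step S A B

variable {S A B : Type*} {H : ℕ}

/-- Learner's policies. -/
abbrev MarkovGame.Policy (M : MarkovGame S A B H) : Type _ := ∀ h : ℕ, S → Dist (M.acts h)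

/-- Opponent's policies. -/
abbrev MarkovGame.OppPolicy (M : MarkovGame S A B H) : Type _ := ∀ h : ℕ, S → Dist (M.oppActs h)

open Classical in
/-- Number of states: the cardinality of the union of all layers, the terminal one included. -/
def MarkovGame.numStates (M : MarkovGame S A B H) : ℕ :=
  ((Finset.range (H + 1)).biUnion M.states).card

open Classical in
/-- Number of actions of the learner: the cardinality of the union of the action sets. -/
def MarkovGame.numActs (M : MarkovGame S A B H) : ℕ :=
  ((Finset.range H).biUnion M.acts).card

/-- The law of `n` consecutive steps, from state `s` at step `h`, when the players follow `μ` and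
`ν`: they draw their actions independently, then the next state is drawn. -/
def MarkovGame.rollout (M : MarkovGame S A B H) (μ : M.Policy) (ν : M.OppPolicy) :
    (n : ℕ) → ℕ → S → PMF (Fin n → Step S A B)
  | 0, _, _ => PMF.pure Fin.elim0
  | n + 1, h, s =>
    (μ h s).toPMF.bind fun a =>
    (ν h s).toPMF.bind fun b =>
    (M.trans h s a b).toPMF.bind fun s' =>
    (M.rollout μ ν n (h + 1) s').map fun t =>
      (Fin.cons (s, a, b, s') t : Fin (n + 1) → Step S A B)

section Values

variable [Fintype S] [Fintype A] [Fintype B]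

/-- The state value function of the policy pair `(μ, ν)`: expected sum of the rewards of the steps
`h, …, H - 1`, starting from state `s` at step `h`. -/
def MarkovGame.value (M : MarkovGame S A B H) (μ : M.Policy) (ν : M.OppPolicy) (h : ℕ) (s : S) :
    ℝ :=
  ∑ t : Fin (H - h) → Step S A B, (M.rollout μ ν (H - h) h s t).toReal *
    ∑ i : Fin (H - h), M.reward (h + i) (t i).1 (t i).2.1 (t i).2.2.1

/-- Expectation of `r_h + P_h V` at state `s` when the actions are drawn from `p` and `q`. -/
def MarkovGame.oneStep (M : MarkovGame S A B H) (h : ℕ) (V : S → ℝ) (s : S)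
    (p : A → ℝ) (q : B → ℝ) : ℝ :=
  ∑ a, ∑ b, p a * q b * (M.reward h s a b + ∑ s', (M.trans h s a b).1 s' * V s')

/-- Empirical Nash values with `n` steps to go. -/
def MarkovGame.empNashAux (M : MarkovGame S A B H) (K : ℕ) (ν : ℕ → M.OppPolicy) :
    (n : ℕ) → ℕ → S → ℝ
  | 0, _, _ => 0
  | n + 1, h, s =>
    ⨆ p : Dist (M.acts h), ⨅ k : Fin K,
      M.oneStep h (M.empNashAux K ν n (h + 1)) s p.1 (ν k h s).1

/-- Empirical state Nash values: max over the learner's mixed actions, min over the opponent's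
mixed actions `ν k h s`, `k < K`, recursively from the terminal step. -/
def MarkovGame.empNash (M : MarkovGame S A B H) (K : ℕ) (ν : ℕ → M.OppPolicy) (h : ℕ) (s : S) :
    ℝ :=
  M.empNashAux K ν (H - h) h s

/-- Mixtures of the mixed actions used by the opponent at `(h, s)` over the `K` episodes. -/
def MarkovGame.oppHull (M : MarkovGame S A B H) (K : ℕ) (ν : ℕ → M.OppPolicy) (h : ℕ) (s : S) :
    Set (B → ℝ) :=
  convexHull ℝ (Set.range fun k : Fin K => (ν k h s).1)

/-- The learner's best response value to the mixed action `q` at `(h, s)`, continuing with the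
empirical Nash values. -/
def MarkovGame.bestResponse (M : MarkovGame S A B H) (K : ℕ) (ν : ℕ → M.OppPolicy) (h : ℕ) (s : S)
    (q : B → ℝ) : ℝ :=
  ⨆ p : Dist (M.acts h), M.oneStep h (M.empNash K ν (h + 1)) s p.1 q

/-- `νs` is a minimax policy of the opponent restricted to mixtures of its `K` policies. -/
def MarkovGame.IsMinimax (M : MarkovGame S A B H) (K : ℕ) (ν : ℕ → M.OppPolicy)
    (νs : ℕ → S → B → ℝ) : Prop :=
  ∀ h, h < H → ∀ s ∈ M.states h,
    νs h s ∈ M.oppHull K ν h s ∧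
      ∀ q ∈ M.oppHull K ν h s, M.bestResponse K ν h s (νs h s) ≤ M.bestResponse K ν h s q

end Values

/-! ### Epoch V-learning -/

/-- What the learner stores for a pair `(h, s)`: the estimate `V`, the current policy, the length
`prevN` of the previous epoch, the number `N` of visits in the current epoch and the sum `total` of
the observed targets `r + V` at these visits, and the bandit instance of the current epoch. -/
structure Cell {A : Type*} (X : Finset A) where
  V : ℝ
  pol : Dist X
  prevN : ℕ
  N : ℕ
  total : ℝ
  bandit : BanditState A

/-- The learner's memory: one cell for each pair of a step and a state. -/
abbrev MarkovGame.Memory (M : MarkovGame S A B H) : Type _ := ∀ h : ℕ, S → Cell (M.acts h)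

/-- Initialization; in particular the estimate at the terminal step `H` is `0`, and stays so. -/
def MarkovGame.initMemory (M : MarkovGame S A B H) : M.Memory := fun h _ =>
  { V := (H : ℝ) - h
    pol := uniformOn (M.acts h) (M.acts_nonempty h)
    prevN := 1
    N := 0
    total := 0
    bandit := BanditState.start A }

/-- Update of the cell of a pair at step `h` (horizon `H`) after a visit with action `a` and target
`y = r + V`. If the epoch ends, the estimate is recomputed and the policy and the bandit instance
are reset; otherwise the bandit instance is fed with `y / H` and outputs the next policy. -/
def Cell.visit {A : Type*} {X : Finset A} (T : Tuning) (hX : X.Nonempty) (H h : ℕ) (c : Cell X)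
    (a : A) (y : ℝ) : Cell X :=
  if c.N + 1 = ⌈(1 + T.eta) * (c.prevN : ℝ)⌉₊ then
    { V := min ((H : ℝ) - h)
        ((c.total + y) / ((c.N + 1 : ℕ) : ℝ) + Real.sqrt (T.iota / ((c.N + 1 : ℕ) : ℝ)))
      pol := uniformOn X hX
      prevN := c.N + 1
      N := 0
      total := 0
      bandit := BanditState.start A }
  else
    { V := c.V
      pol := (c.bandit.update T X c.pol.1 a (y / H)).output T X hX
      prevN := c.prevN
      N := c.N + 1
      total := c.total + y
      bandit := c.bandit.update T X c.pol.1 a (y / H) }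

open Classical in
/-- The memory after an episode `e`. At each step only the cell of the visited state changes; the
target uses the estimates from before the episode. The opponent's action enters only through the
observed reward. -/
def MarkovGame.update (M : MarkovGame S A B H) (T : Tuning) (m : M.Memory) (e : Episode S A B H) :
    M.Memory := fun h s =>
  if hh : h < H then
    if (e ⟨h, hh⟩).1 = s then
      (m h s).visit T (M.acts_nonempty h) H h (e ⟨h, hh⟩).2.1
        (M.reward h s (e ⟨h, hh⟩).2.1 (e ⟨h, hh⟩).2.2.1 + (m (h + 1) (e ⟨h, hh⟩).2.2.2).V)
    else m h s
  else m h s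

/-- The learner's memory after the first `k` episodes. -/
def MarkovGame.memory (M : MarkovGame S A B H) (T : Tuning) :
    (k : ℕ) → (Fin k → Episode S A B H) → M.Memory
  | 0, _ => M.initMemory
  | k + 1, ω => M.update T (M.memory T k (Fin.init ω)) (ω (Fin.last k))

/-- The policy prescribed by the learner's memory. -/
def MarkovGame.policyOf (M : MarkovGame S A B H) (m : M.Memory) : M.Policy := fun h s => (m h s).pol

/-- The law of the first `k` episodes, when the learner runs epoch V-learning, the opponent follows
the predetermined policies `ν 0, ν 1, …`, and the initial state of each episode is an arbitrary
function `init` of the history of the previous episodes. -/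
def MarkovGame.runLaw (M : MarkovGame S A B H) (T : Tuning) (ν : ℕ → M.OppPolicy)
    (init : ∀ k : ℕ, (Fin k → Episode S A B H) → S) : (k : ℕ) → PMF (Fin k → Episode S A B H)
  | 0 => PMF.pure Fin.elim0
  | k + 1 =>
    (M.runLaw T ν init k).bind fun ω =>
      (M.rollout (M.policyOf (M.memory T k ω)) (ν k) H 0 (init k ω)).map fun e =>
        (Fin.snoc ω e : Fin (k + 1) → Episode S A B H)

/-! ### Quantities of a run of `K` episodes -/

/-- The episodes before episode `k`. -/
def before {K : ℕ} (ω : Fin K → Episode S A B H) (k : Fin K) : Fin k → Episode S A B H :=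
  fun i => ω (Fin.castLE k.isLt.le i)

section Regret

variable [Fintype S] [Fintype A] [Fintype B]

/-- Empirical Nash-value regret of the run `ω`. -/
def MarkovGame.regret (M : MarkovGame S A B H) (T : Tuning) (ν : ℕ → M.OppPolicy)
    (init : ∀ k : ℕ, (Fin k → Episode S A B H) → S) {K : ℕ} (ω : Fin K → Episode S A B H) : ℝ :=
  ∑ k : Fin K, (M.empNash K ν 0 (init k (before ω k)) -
    M.value (M.policyOf (M.memory T k (before ω k))) (ν k) 0 (init k (before ω k)))

/-- The sum over the episodes of the learner's estimate at the initial state minus the value of the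
policies played in the episode. -/
def MarkovGame.estRegret (M : MarkovGame S A B H) (T : Tuning) (ν : ℕ → M.OppPolicy)
    (init : ∀ k : ℕ, (Fin k → Episode S A B H) → S) {K : ℕ} (ω : Fin K → Episode S A B H) : ℝ :=
  ∑ k : Fin K, ((M.memory T k (before ω k) 0 (init k (before ω k))).V -
    M.value (M.policyOf (M.memory T k (before ω k))) (ν k) 0 (init k (before ω k)))

/-- Non-stationarity of the opponent along the run `ω`, relative to the policy `νs`. -/
def MarkovGame.nonstationarity (M : MarkovGame S A B H) (ν : ℕ → M.OppPolicy)
    (νs : ℕ → S → B → ℝ) {K : ℕ} (ω : Fin K → Episode S A B H) : ℝ :=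
  ∑ h : Fin H, ∑ k : Fin K, tvDist (ν k h (ω k h).1).1 (νs h (ω k h).1)

end Regret

/-- The upper bound `⌈(1 + η) log K / η⌉` on the number of epochs of a pair. -/
def epochBound (K : ℕ) (η : ℝ) : ℕ := ⌈(1 + η) * Real.log K / η⌉₊

/-- The tuning of a run with confidence `δ`: each bandit instance has confidence parameter
`δ / (4 H |S| M)`, where `M` is the bound on the number of epochs of a pair. -/
def MarkovGame.tuning (M : MarkovGame S A B H) (K : ℕ) (δ η ι cη cγ : ℝ) : Tuning where
  eta := η
  iota := ι
  lrConst := cη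
  ixConst := cγ
  conf := δ / (4 * H * M.numStates * epochBound K η)

end EpochV


end

/-!
The proof is a union bound over exponential supermartingales (the "tests"), followed by a
deterministic analysis of the runs that pass them all.

*Bandit regret.* At each stage the empirical Nash value is, by Sion's theorem, the value of a matrix
game: some mixed action of the learner guarantees it against all `K` mixed actions of the opponent
(`exists_minimax`), and against the minimax mixed action nobody gains more, so that against `ν k`
the gain exceeds the value by at most `H * TV` (`oneStep_le_empNash_add`). In a block of a bandit
instance the FTRL potential with the 1/2-Tsallis entropy telescopes (`IsLeader.stability`), which
bounds the regret by terms linear in the estimated losses. Implicit exploration makes weighted sums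
of these estimates with weights at most `γ` supermartingales on the exponential scale
(`expect_exp_ix_le_one`), and two such tests in each block suffice (`sum_block_regret_le`): one
with weights proportional to the comparator, one with weights proportional to `γ + lr * √p`. Blocks
add up geometrically, so the regret in epoch `τ` against the maximin action is at most
`√ι * √(epochLen (τ + 1))`, also when the epoch is not completed.

*Optimism.* The bonus `√(ι / N)` covers exactly this regret, so by induction the estimates never
fall below the empirical Nash values (`IsGoodRun.optimism`). This is the first inequality.

*Regret.* Write the target of a visit as `V* - G + D`, with `D ≥ 0` the error of the next estimate
and `G` the loss of the step relative to the Nash value. The estimate used in an epoch is the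
average of the targets of the previous one, which is shorter by a factor of about `1 + η`. Summing
over the epochs of a cell, `sum (V - V* + G)` is at most `(1 + η) * sum D + η * H * sum TV` plus
`√ι` times the sum of the square roots of the epoch lengths (`IsCellRun.sum_error_le`): only the
excess `w - 1 ≤ η + 1 / N` of the ratio `w` of two consecutive lengths multiplies `-G`, and `-G` is
at most `H * TV` up to fluctuations, which a further test in each epoch controls. Keeping `G` on
the left lets the last, incomplete epoch be paid for by its bandit regret. The recursion over the
steps (`backward_recursion`) costs only `(1 + η) ^ H ≤ 3`; in the sum over the steps `G` telescopes
to the Nash value minus the total reward, and a last test compares the total reward with the value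
of the policies. There are at most `epochBound` complete epochs for each cell, so Cauchy–Schwarz
over cells and epochs gives the second term of the bound.

The tests for all blocks, epochs and pairs number at most `conf⁻¹ ^ 2` up to a constant, and each
fails with probability at most `conf ^ 3`.
-/

noncomputable section

namespace EpochV

/-! ### Follow the regularized leader with the 1/2-Tsallis entropy -/

section FTRL

variable {α : Type*} {X : Finset α} {lr : ℝ} {L : α → ℝ}

theorem ftrlObjective_eq (X : Finset α) (lr : ℝ) (L p : α → ℝ) :
    ftrlObjective X lr L p = ∑ a ∈ X, p a * L a - 2 / lr * (∑ a ∈ X, √(p a) - 1) := by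
  unfold ftrlObjective
  ring

theorem ftrlObjective_sub (X : Finset α) (lr : ℝ) (L p q : α → ℝ) :
    ftrlObjective X lr L q - ftrlObjective X lr L p =
      ∑ a ∈ X, (q a - p a) * L a - 2 / lr * ∑ a ∈ X, (√(q a) - √(p a)) := by
  rw [ftrlObjective_eq, ftrlObjective_eq]
  simp only [sub_mul, Finset.sum_sub_distrib]
  ring

theorem Dist.le_one (p : Dist X) (a : α) : p.1 a ≤ 1 := by
  by_cases ha : a ∈ X
  · rw [← p.2.2.2]
    exact Finset.single_le_sum (fun i _ => p.2.1 i) ha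
  · rw [p.2.2.1 a ha]
    exact zero_le_one

/-- The segment from `p` to `q` stays in the simplex. -/
def Dist.mix (p q : Dist X) (t : ℝ) (h0 : 0 ≤ t) (h1 : t ≤ 1) : Dist X :=
  ⟨fun a => (1 - t) * p.1 a + t * q.1 a, by
    refine ⟨fun a => ?_, fun a ha => ?_, ?_⟩
    · have := p.2.1 a
      have := q.2.1 a
      have : 0 ≤ 1 - t := by linarith
      positivity
    · simp only [p.2.2.1 a ha, q.2.2.1 a ha, mul_zero, add_zero]
    · rw [Finset.sum_add_distrib, ← Finset.mul_sum, ← Finset.mul_sum, p.2.2.2, q.2.2.2]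
      ring⟩

/-- `p` minimizes the FTRL objective over the simplex. -/
def IsLeader (X : Finset α) (lr : ℝ) (L : α → ℝ) (p : Dist X) : Prop :=
  ∀ q : Dist X, ftrlObjective X lr L p.1 ≤ ftrlObjective X lr L q.1

theorem ftrl_isLeader (hX : X.Nonempty) (lr : ℝ) (L : α → ℝ) :
    IsLeader X lr L (ftrl X hX lr L) :=
  Classical.choose_spec (exists_ftrl X hX lr L)

/-- The entropy has infinite slope at the boundary, so leaders are interior points. -/
theorem IsLeader.pos {p : Dist X} (hp : IsLeader X lr L p) (hlr : 0 < lr) {a : α} (ha : a ∈ X) :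
    0 < p.1 a := by
  classical
  by_contra hneg
  have hpa : p.1 a = 0 := le_antisymm (not_lt.1 hneg) (p.2.1 a)
  have hX : X.Nonempty := ⟨a, ha⟩
  set u := uniformOn X hX
  have hu : 0 < u.1 a := by
    have : (0 : ℝ) < X.card := by exact_mod_cast hX.card_pos
    simp only [u, uniformOn, if_pos ha]
    positivity
  set D := ∑ c ∈ X, (u.1 c - p.1 c) * L c
  set R := ∑ c ∈ X, √(p.1 c)
  -- Moving from `p` towards `u` by `t` costs `O(t)` and gains a multiple of `√t`.
  have key : ∀ t : ℝ, 0 < t → t ≤ 1 → √t * √(u.1 a) ≤ t * (lr / 2 * D + R) := by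
    intro t ht ht1
    have h := hp (p.mix u t ht.le ht1)
    rw [← sub_nonneg, ftrlObjective_sub] at h
    have h1 : ∑ c ∈ X, ((p.mix u t ht.le ht1).1 c - p.1 c) * L c = t * D := by
      rw [Finset.mul_sum]
      refine Finset.sum_congr rfl fun c _ => ?_
      simp only [Dist.mix]
      ring
    have h2 : √t * √(u.1 a) - t * R ≤
        ∑ c ∈ X, (√((p.mix u t ht.le ht1).1 c) - √(p.1 c)) := by
      rw [Finset.mul_sum, ← Finset.add_sum_erase X _ ha,
        ← Finset.add_sum_erase X (fun c => √((p.mix u t ht.le ht1).1 c) - √(p.1 c)) ha]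
      have e1 : √((p.mix u t ht.le ht1).1 a) - √(p.1 a) = √t * √(u.1 a) := by
        simp only [Dist.mix, hpa, mul_zero, zero_add, Real.sqrt_zero, sub_zero]
        exact Real.sqrt_mul ht.le _
      have e2 : -∑ c ∈ X.erase a, t * √(p.1 c) ≤
          ∑ c ∈ X.erase a, (√((p.mix u t ht.le ht1).1 c) - √(p.1 c)) := by
        rw [← Finset.sum_neg_distrib]
        refine Finset.sum_le_sum fun c _ => ?_
        have hc : (1 - t) * √(p.1 c) ≤ √((p.mix u t ht.le ht1).1 c) := by
          apply Real.le_sqrt_of_sq_le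
          have h3 := Real.sq_sqrt (p.2.1 c)
          have h4 := u.2.1 c
          have h5 := p.2.1 c
          rw [mul_pow, h3]
          simp only [Dist.mix]
          nlinarith [mul_nonneg ht.le h4, mul_nonneg (mul_nonneg ht.le (sub_nonneg.2 ht1)) h5]
        linarith
      rw [e1, hpa]
      simp only [Real.sqrt_zero, mul_zero, zero_add]
      linarith
    rw [h1] at h
    have h3 : 2 / lr * (√t * √(u.1 a) - t * R) ≤ t * D :=
      (mul_le_mul_of_nonneg_left h2 (by positivity)).trans (by linarith)
    have h4 : lr / 2 * (2 / lr * (√t * √(u.1 a) - t * R)) = √t * √(u.1 a) - t * R := by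
      field_simp
    have h5 := mul_le_mul_of_nonneg_left h3 (by positivity : 0 ≤ lr / 2)
    rw [h4] at h5
    linarith
  set Z := lr / 2 * D + R
  have hsu : 0 < √(u.1 a) := Real.sqrt_pos.2 hu
  have hz : 0 < |Z| + √(u.1 a) := by positivity
  set w := √(u.1 a) / (2 * (|Z| + √(u.1 a))) with hw
  have hw0 : 0 < w := by positivity
  have hw1 : w ≤ 1 := by
    rw [hw, div_le_one (by positivity)]
    linarith [abs_nonneg Z]
  have h := key (w ^ 2) (by positivity) (by nlinarith)
  rw [Real.sqrt_sq hw0.le] at h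
  have h1 : √(u.1 a) ≤ w * Z := by
    have : w * √(u.1 a) ≤ w * (w * Z) := by linarith
    exact le_of_mul_le_mul_left this hw0
  have h2 : w * Z ≤ w * (|Z| + √(u.1 a)) :=
    mul_le_mul_of_nonneg_left (by linarith [le_abs_self Z]) hw0.le
  have h3 : w * (|Z| + √(u.1 a)) = √(u.1 a) / 2 := by
    rw [hw]
    field_simp
  linarith

/-- Second-order lower bound for the square root around `p`, valid up to the boundary. -/
theorem sqrt_add_ge {p d : ℝ} (hp : 0 < p) (hd : 0 ≤ p + d) :
    d / (2 * √p) - d ^ 2 / (2 * (p * √p)) ≤ √(p + d) - √p := by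
  have hy : 0 < √p := Real.sqrt_pos.2 hp
  obtain ⟨y, hyd⟩ : ∃ y, y = √p := ⟨_, rfl⟩
  obtain ⟨z, hzd⟩ : ∃ z, z = √(p + d) := ⟨_, rfl⟩
  have hy2 : y ^ 2 = p := by rw [hyd, Real.sq_sqrt hp.le]
  have hz2 : z ^ 2 = p + d := by rw [hzd, Real.sq_sqrt hd]
  have hz0 : 0 ≤ z := hzd ▸ Real.sqrt_nonneg _
  have hd' : d = z ^ 2 - y ^ 2 := by linarith
  rw [← hyd] at hy ⊢
  rw [← hzd, hd', ← hy2, ← sub_nonneg]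
  have : z - y - ((z ^ 2 - y ^ 2) / (2 * y) - (z ^ 2 - y ^ 2) ^ 2 / (2 * (y ^ 2 * y))) =
      (z - y) ^ 2 * ((z + y) ^ 2 - y ^ 2) / (2 * y ^ 3) := by
    field_simp
    ring
  rw [this]
  have : 0 ≤ (z + y) ^ 2 - y ^ 2 := by nlinarith
  positivity

/-- First-order optimality of a leader. -/
theorem IsLeader.first_order {p : Dist X} (hp : IsLeader X lr L p) (hlr : 0 < lr) (q : Dist X) :
    0 ≤ ∑ a ∈ X, (q.1 a - p.1 a) * (L a - 1 / (lr * √(p.1 a))) := by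
  set A := ∑ a ∈ X, (q.1 a - p.1 a) * (L a - 1 / (lr * √(p.1 a))) with hA
  set B := 1 / lr * ∑ a ∈ X, (q.1 a - p.1 a) ^ 2 / (p.1 a * √(p.1 a)) with hB
  have hB0 : 0 ≤ B := by
    have := fun a => p.2.1 a
    have : 0 ≤ ∑ a ∈ X, (q.1 a - p.1 a) ^ 2 / (p.1 a * √(p.1 a)) :=
      Finset.sum_nonneg fun a _ => by have := p.2.1 a; positivity
    positivity
  have key : ∀ t : ℝ, 0 < t → t ≤ 1 → 0 ≤ A + t * B := by
    intro t ht ht1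
    have h := hp (p.mix q t ht.le ht1)
    rw [← sub_nonneg, ftrlObjective_sub] at h
    have h2 : ∑ a ∈ X, (t * ((q.1 a - p.1 a) / (2 * √(p.1 a))) -
        t ^ 2 * ((q.1 a - p.1 a) ^ 2 / (2 * (p.1 a * √(p.1 a))))) ≤
        ∑ a ∈ X, (√((p.mix q t ht.le ht1).1 a) - √(p.1 a)) := by
      refine Finset.sum_le_sum fun a ha => ?_
      have e : (p.mix q t ht.le ht1).1 a = p.1 a + t * (q.1 a - p.1 a) := by
        simp only [Dist.mix]
        ring
      have h0 := (p.mix q t ht.le ht1).2.1 a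
      rw [e] at h0 ⊢
      refine le_trans (le_of_eq ?_) (sqrt_add_ge (hp.pos hlr ha) h0)
      ring
    have h1 : ∑ a ∈ X, ((p.mix q t ht.le ht1).1 a - p.1 a) * L a =
        t * ∑ a ∈ X, (q.1 a - p.1 a) * L a := by
      rw [Finset.mul_sum]
      refine Finset.sum_congr rfl fun a _ => ?_
      simp only [Dist.mix]
      ring
    rw [h1] at h
    have h3 := mul_le_mul_of_nonneg_left h2 (by positivity : 0 ≤ 2 / lr)
    have h4 : t * ∑ a ∈ X, (q.1 a - p.1 a) * L a - 2 / lr *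
        ∑ a ∈ X, (t * ((q.1 a - p.1 a) / (2 * √(p.1 a))) -
        t ^ 2 * ((q.1 a - p.1 a) ^ 2 / (2 * (p.1 a * √(p.1 a))))) = t * (A + t * B) := by
      rw [hA, hB, mul_add, Finset.mul_sum, Finset.mul_sum, Finset.mul_sum, Finset.mul_sum,
        Finset.mul_sum, Finset.mul_sum, ← Finset.sum_sub_distrib, ← Finset.sum_add_distrib]
      refine Finset.sum_congr rfl fun a ha => ?_
      have := hp.pos hlr ha
      have : 0 < √(p.1 a) := Real.sqrt_pos.2 this
      field_simp
      ring
    have h5 : 0 ≤ t * (A + t * B) := by linarith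
    exact nonneg_of_mul_nonneg_right h5 ht
  by_contra hneg
  push Not at hneg
  have h := key (min 1 (-A / (2 * (B + 1)))) (by
    apply lt_min one_pos
    apply div_pos <;> linarith) (min_le_left _ _)
  have h1 : min 1 (-A / (2 * (B + 1))) * B ≤ -A / (2 * (B + 1)) * (B + 1) :=
    mul_le_mul (min_le_right _ _) (by linarith) hB0 (by
      apply div_nonneg <;> linarith)
  have h2 : -A / (2 * (B + 1)) * (B + 1) = -A / 2 := by
    field_simp
  linarith

/-- Stability of FTRL: the minimum of the objective increases by at least the loss of the leader
minus a local-norm term. The square `(√q - √p)² / √p` is the Bregman divergence of the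
entropy. -/
theorem IsLeader.stability {p : Dist X} (hp : IsLeader X lr L p) (hlr : 0 < lr) {l : α → ℝ}
    (hl : ∀ a, 0 ≤ l a) (q : Dist X) :
    ftrlObjective X lr L p.1 + ∑ a ∈ X, (p.1 a * l a - lr * (p.1 a * √(p.1 a)) * l a ^ 2) ≤
      ftrlObjective X lr (fun a => L a + l a) q.1 := by
  have h1 : ftrlObjective X lr (fun a => L a + l a) q.1 =
      ftrlObjective X lr L q.1 + ∑ a ∈ X, q.1 a * l a := by
    rw [ftrlObjective_eq, ftrlObjective_eq]
    simp only [mul_add, Finset.sum_add_distrib]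
    ring
  have h2 := ftrlObjective_sub X lr L p.1 q.1
  have h3 := hp.first_order hlr q
  have h4 : 0 ≤ ∑ a ∈ X, ((q.1 a - p.1 a) * (1 / (lr * √(p.1 a))) -
      2 / lr * (√(q.1 a) - √(p.1 a)) + q.1 a * l a -
      (p.1 a * l a - lr * (p.1 a * √(p.1 a)) * l a ^ 2)) := by
    refine Finset.sum_nonneg fun a ha => ?_
    have hpa := hp.pos hlr ha
    have hy : 0 < √(p.1 a) := Real.sqrt_pos.2 hpa
    obtain ⟨y, hyd⟩ : ∃ y, y = √(p.1 a) := ⟨_, rfl⟩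
    obtain ⟨x, hxd⟩ : ∃ x, x = √(q.1 a) := ⟨_, rfl⟩
    have hy2 : p.1 a = y ^ 2 := by rw [hyd, Real.sq_sqrt hpa.le]
    have hx2 : q.1 a = x ^ 2 := by rw [hxd, Real.sq_sqrt (q.2.1 a)]
    rw [← hyd] at hy ⊢
    rw [← hxd, hy2, hx2]
    have e : (x ^ 2 - y ^ 2) * (1 / (lr * y)) - 2 / lr * (x - y) + x ^ 2 * l a -
        (y ^ 2 * l a - lr * (y ^ 2 * y) * l a ^ 2) =
        (x - y + lr * y ^ 2 * l a) ^ 2 / (lr * y) + (x - y) ^ 2 * l a := by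
      field_simp
      ring
    rw [e]
    have := hl a
    positivity
  simp only [mul_sub, Finset.sum_add_distrib, Finset.sum_sub_distrib, ← Finset.mul_sum]
    at h2 h3 h4 ⊢
  linarith

theorem sum_sqrt_le (p : Dist X) : ∑ a ∈ X, √(p.1 a) ≤ √X.card := by
  apply Real.le_sqrt_of_sq_le
  have h := sq_sum_le_card_mul_sum_sq (s := X) (f := fun a => √(p.1 a))
  refine h.trans (le_of_eq ?_)
  rw [Finset.sum_congr rfl fun a _ => Real.sq_sqrt (p.2.1 a), p.2.2.2, mul_one]

theorem one_le_sum_sqrt (p : Dist X) : 1 ≤ ∑ a ∈ X, √(p.1 a) := by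
  rw [← p.2.2.2]
  refine Finset.sum_le_sum fun a _ => Real.le_sqrt_of_sq_le ?_
  have h0 := p.2.1 a
  have h1 := p.le_one a
  nlinarith

theorem uniformOn_isLeader (hX : X.Nonempty) (hlr : 0 < lr) :
    IsLeader X lr (fun _ => 0) (uniformOn X hX) := by
  classical
  intro q
  rw [ftrlObjective_eq, ftrlObjective_eq]
  have hc : (0 : ℝ) < X.card := by exact_mod_cast hX.card_pos
  have h1 : ∑ a ∈ X, √((uniformOn X hX).1 a) = √X.card := by
    have : ∀ a ∈ X, √((uniformOn X hX).1 a) = 1 / √X.card := by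
      intro a ha
      simp only [uniformOn, if_pos ha]
      rw [Real.sqrt_div zero_le_one, Real.sqrt_one]
    rw [Finset.sum_congr rfl this, Finset.sum_const, nsmul_eq_mul, mul_one_div, Real.div_sqrt]
  rw [h1]
  have h2 := mul_le_mul_of_nonneg_left (sum_sqrt_le q) (by positivity : 0 ≤ 2 / lr)
  simp only [mul_zero, Finset.sum_const_zero]
  linarith

/-- The minimum of the FTRL objective, as a function of the cumulative losses. -/
def ftrlPotential (X : Finset α) (hX : X.Nonempty) (lr : ℝ) (L : α → ℝ) : ℝ :=
  ftrlObjective X lr L (ftrl X hX lr L).1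

theorem IsLeader.potential_add_ge {p : Dist X} (hp : IsLeader X lr L p) (hX : X.Nonempty)
    (hlr : 0 < lr) {l : α → ℝ} (hl : ∀ a, 0 ≤ l a) :
    ftrlPotential X hX lr L + ∑ a ∈ X, (p.1 a * l a - lr * (p.1 a * √(p.1 a)) * l a ^ 2) ≤
      ftrlPotential X hX lr (fun a => L a + l a) := by
  have h := hp.stability hlr hl (ftrl X hX lr fun a => L a + l a)
  have h1 := ftrl_isLeader hX lr L p
  unfold ftrlPotential
  linarith

theorem ftrlPotential_le (hX : X.Nonempty) (hlr : 0 < lr) (L : α → ℝ) (q : Dist X) :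
    ftrlPotential X hX lr L ≤ ∑ a ∈ X, q.1 a * L a := by
  refine (ftrl_isLeader hX lr L q).trans ?_
  rw [ftrlObjective_eq]
  have := mul_nonneg (by positivity : 0 ≤ 2 / lr) (sub_nonneg.2 (one_le_sum_sqrt q))
  linarith

theorem ftrlPotential_zero_ge (hX : X.Nonempty) (hlr : 0 < lr) :
    -(2 / lr * √X.card) ≤ ftrlPotential X hX lr (fun _ => 0) := by
  unfold ftrlPotential
  rw [ftrlObjective_eq]
  have h := mul_le_mul_of_nonneg_left (sum_sqrt_le (ftrl X hX lr fun _ => 0))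
    (by positivity : 0 ≤ 2 / lr)
  have : 0 ≤ 2 / lr := by positivity
  simp only [mul_zero, Finset.sum_const_zero]
  linarith

end FTRL

/-! ### Expectations under finitely supported laws -/

section Expect

variable {α β : Type*} [Fintype α] [Fintype β]

/-- Expectation of a real function on a finite type. -/
def expect (p : PMF α) (f : α → ℝ) : ℝ := ∑ a, (p a).toReal * f a

theorem sum_toReal (p : PMF α) : ∑ a, (p a).toReal = 1 := by
  rw [← ENNReal.toReal_sum fun a _ => p.apply_ne_top a]
  have := p.tsum_coe
  rw [tsum_fintype] at this
  rw [this, ENNReal.toReal_one]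

theorem expect_const (p : PMF α) (c : ℝ) : expect p (fun _ => c) = c := by
  rw [expect, ← Finset.sum_mul, sum_toReal, one_mul]

theorem expect_mono (p : PMF α) {f g : α → ℝ} (h : ∀ a, f a ≤ g a) : expect p f ≤ expect p g :=
  Finset.sum_le_sum fun a _ => mul_le_mul_of_nonneg_left (h a) ENNReal.toReal_nonneg

theorem expect_add (p : PMF α) (f g : α → ℝ) :
    expect p (fun a => f a + g a) = expect p f + expect p g := by
  simp only [expect, mul_add, Finset.sum_add_distrib]

theorem expect_sub (p : PMF α) (f g : α → ℝ) :
    expect p (fun a => f a - g a) = expect p f - expect p g := by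
  simp only [expect, mul_sub, Finset.sum_sub_distrib]

theorem expect_const_mul (p : PMF α) (c : ℝ) (f : α → ℝ) :
    expect p (fun a => c * f a) = c * expect p f := by
  simp only [expect, Finset.mul_sum]
  exact Finset.sum_congr rfl fun a _ => by ring

theorem expect_mul_const (p : PMF α) (c : ℝ) (f : α → ℝ) :
    expect p (fun a => f a * c) = expect p f * c := by
  simp only [expect, Finset.sum_mul]
  exact Finset.sum_congr rfl fun a _ => by ring

theorem expect_sum (p : PMF α) {ι : Type*} (I : Finset ι) (f : ι → α → ℝ) :
    expect p (fun a => ∑ i ∈ I, f i a) = ∑ i ∈ I, expect p (f i) := by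
  simp only [expect, Finset.mul_sum]
  exact Finset.sum_comm

theorem expect_nonneg (p : PMF α) {f : α → ℝ} (h : ∀ a, 0 ≤ f a) : 0 ≤ expect p f :=
  Finset.sum_nonneg fun a _ => mul_nonneg ENNReal.toReal_nonneg (h a)

theorem expect_pure (a : α) (f : α → ℝ) : expect (PMF.pure a) f = f a := by
  classical
  rw [expect, Finset.sum_eq_single a]
  · simp [PMF.pure_apply]
  · intro b _ hb
    simp [PMF.pure_apply, hb]
  · simp

theorem expect_bind (p : PMF α) (g : α → PMF β) (f : β → ℝ) :
    expect (p.bind g) f = expect p fun a => expect (g a) f := by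
  simp only [expect, PMF.bind_apply, tsum_fintype]
  have : ∀ b, (∑ a, p a * g a b).toReal = ∑ a, (p a).toReal * (g a b).toReal := by
    intro b
    rw [ENNReal.toReal_sum fun a _ => ENNReal.mul_ne_top (p.apply_ne_top a) ((g a).apply_ne_top b)]
    simp only [ENNReal.toReal_mul]
  simp only [this, Finset.sum_mul, Finset.mul_sum]
  rw [Finset.sum_comm]
  exact Finset.sum_congr rfl fun a _ => Finset.sum_congr rfl fun b _ => by ring

theorem expect_map (p : PMF α) (g : α → β) (f : β → ℝ) :
    expect (p.map g) f = expect p fun a => f (g a) := by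
  rw [PMF.map, expect_bind]
  simp only [Function.comp, expect_pure]

theorem expect_toPMF {X : Finset α} (p : Dist X) (f : α → ℝ) :
    expect p.toPMF f = ∑ a, p.1 a * f a := by
  refine Finset.sum_congr rfl fun a _ => ?_
  rw [Dist.toPMF, PMF.ofFinset_apply, ENNReal.toReal_ofReal (p.2.1 a)]

theorem expect_toPMF_on {X : Finset α} (p : Dist X) (f : α → ℝ) :
    expect p.toPMF f = ∑ a ∈ X, p.1 a * f a := by
  rw [expect_toPMF]
  symm
  refine Finset.sum_subset (Finset.subset_univ X) fun a _ ha => ?_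
  rw [p.2.2.1 a ha, zero_mul]

/-- Markov's inequality for the complement: if `W ≥ 0` has mean at most `δ`, then `W < 1` with
probability at least `1 - δ`. -/
theorem ofReal_one_sub_le_toOuterMeasure {p : PMF α} {G : Set α} {W : α → ℝ} {δ : ℝ}
    (hW : ∀ a, 0 ≤ W a) (hδ : expect p W ≤ δ) (hG : ∀ a ∈ p.support, W a < 1 → a ∈ G) :
    ENNReal.ofReal (1 - δ) ≤ p.toOuterMeasure G := by
  classical
  rw [PMF.toOuterMeasure_apply_fintype]
  have hne : ∑ a, G.indicator p a ≠ ⊤ := by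
    refine ENNReal.sum_ne_top.2 fun a _ => ?_
    exact ne_top_of_le_ne_top (p.apply_ne_top a) (Set.indicator_le_self _ _ a)
  rw [ENNReal.ofReal_le_iff_le_toReal hne, ENNReal.toReal_sum fun a _ =>
    ne_top_of_le_ne_top (p.apply_ne_top a) (Set.indicator_le_self _ _ a)]
  have h1 : expect p (fun a => 1 - W a) ≤ ∑ a, (G.indicator p a).toReal := by
    refine Finset.sum_le_sum fun a _ => ?_
    have hp : 0 ≤ (p a).toReal := ENNReal.toReal_nonneg
    by_cases ha : a ∈ G
    · rw [Set.indicator_of_mem ha]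
      nlinarith [mul_nonneg hp (hW a)]
    · by_cases hs : a ∈ p.support
      · have h : 1 ≤ W a := not_lt.1 fun h => ha (hG a hs h)
        rw [Set.indicator_of_notMem ha, ENNReal.toReal_zero]
        nlinarith
      · rw [PMF.mem_support_iff, not_not] at hs
        rw [hs]
        simp
  rw [expect_sub, expect_const] at h1
  linarith

end Expect

/-! ### Exponential moments -/

theorem exp_le_add_exp_sq (u : ℝ) : Real.exp u ≤ u + Real.exp (u ^ 2) := by
  have h2 := Real.add_one_le_exp (u ^ 2)
  rcases le_total (|u|) 1 with h | h
  · have := (abs_le.1 (Real.abs_exp_sub_one_sub_id_le h)).2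
    linarith
  · rcases le_total 0 u with h0 | h0
    · rw [abs_of_nonneg h0] at h
      have : Real.exp u ≤ Real.exp (u ^ 2) := Real.exp_le_exp.2 (by nlinarith)
      linarith
    · rw [abs_of_nonpos h0] at h
      have : Real.exp u ≤ 1 := Real.exp_le_one_iff.2 h0
      nlinarith

/-- Exponential moment of a bounded variable with nonpositive mean. -/
theorem expect_exp_le_one {α : Type*} [Fintype α] (p : PMF α) {Y : α → ℝ} {b θ : ℝ} (hθ : 0 ≤ θ)
    (hb : ∀ a, |Y a| ≤ b) (hm : expect p Y ≤ 0) :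
    expect p (fun a => Real.exp (θ * Y a - θ ^ 2 * b ^ 2)) ≤ 1 := by
  have h1 : ∀ a, Real.exp (θ * Y a - θ ^ 2 * b ^ 2) ≤
      θ * Real.exp (-(θ ^ 2 * b ^ 2)) * Y a + 1 := by
    intro a
    have h2 : Real.exp ((θ * Y a) ^ 2) ≤ Real.exp (θ ^ 2 * b ^ 2) := by
      apply Real.exp_le_exp.2
      rw [mul_pow]
      have := sq_le_sq' (abs_le.1 (hb a)).1 (abs_le.1 (hb a)).2
      exact mul_le_mul_of_nonneg_left this (by positivity)
    have h3 := (exp_le_add_exp_sq (θ * Y a)).trans (add_le_add_right h2 _)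
    have h4 := mul_le_mul_of_nonneg_right h3 (Real.exp_pos (-(θ ^ 2 * b ^ 2))).le
    rw [← Real.exp_add, add_mul, ← Real.exp_add, add_neg_cancel, Real.exp_zero] at h4
    rw [sub_eq_add_neg]
    linarith
  refine (expect_mono p h1).trans ?_
  rw [expect_add, expect_const_mul, expect_const]
  have : θ * Real.exp (-(θ ^ 2 * b ^ 2)) * expect p Y ≤ 0 :=
    mul_nonpos_of_nonneg_of_nonpos (by positivity) hm
  linarith

/-- Implicit exploration: loss estimates `l / (p a + γ)` with weights at most `γ` do not exceed the
mean losses, on the exponential scale. -/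
theorem expect_exp_ix_le_one {A Z : Type*} [Fintype A] [Fintype Z] {X : Finset A} (p : Dist X)
    (κ : A → PMF Z) {γ : ℝ} (hγ : 0 < γ) {w : A → ℝ} (hw0 : ∀ a, 0 ≤ w a) (hw1 : ∀ a, w a ≤ γ)
    {l : A → Z → ℝ} (hl0 : ∀ a z, 0 ≤ l a z) (hl1 : ∀ a z, l a z ≤ 1) :
    expect p.toPMF (fun a => expect (κ a) fun z =>
      Real.exp (w a * (l a z / (p.1 a + γ)) - ∑ a' ∈ X, w a' * expect (κ a') (l a'))) ≤ 1 := by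
  set c : A → ℝ := fun a => expect (κ a) (l a) with hc
  set σ := ∑ a' ∈ X, w a' * c a'
  have hc0 : ∀ a, 0 ≤ c a := fun a => expect_nonneg _ (hl0 a)
  have h1 : ∀ a, expect (κ a) (fun z => Real.exp (w a * (l a z / (p.1 a + γ)) - σ)) ≤
      Real.exp (-σ) * (1 + (w a / (p.1 a + γ) + (w a / (p.1 a + γ)) ^ 2) * c a) := by
    intro a
    have hpa := p.2.1 a
    have hpg : 0 < p.1 a + γ := by linarith
    have hu0 : 0 ≤ w a / (p.1 a + γ) := div_nonneg (hw0 a) hpg.le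
    have hu1 : w a / (p.1 a + γ) ≤ 1 := by
      rw [div_le_one hpg]
      linarith [hw1 a]
    set u := w a / (p.1 a + γ) with hu
    have h2 : ∀ z, Real.exp (w a * (l a z / (p.1 a + γ)) - σ) ≤
        Real.exp (-σ) * (1 + (u + u ^ 2) * l a z) := by
      intro z
      have e : w a * (l a z / (p.1 a + γ)) - σ = -σ + u * l a z := by
        rw [hu]
        ring
      rw [e, Real.exp_add]
      refine mul_le_mul_of_nonneg_left ?_ (Real.exp_pos _).le
      have h0 := hl0 a z
      have h1 := hl1 a z
      have h3 : |u * l a z| ≤ 1 := by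
        rw [abs_of_nonneg (mul_nonneg hu0 h0)]
        nlinarith
      have h4 := (abs_le.1 (Real.abs_exp_sub_one_sub_id_le h3)).2
      have h5 : (u * l a z) ^ 2 ≤ u ^ 2 * l a z := by
        rw [mul_pow]
        exact mul_le_mul_of_nonneg_left (by nlinarith) (by positivity)
      linarith
    refine (expect_mono _ h2).trans (le_of_eq ?_)
    rw [expect_const_mul, expect_add, expect_const, expect_const_mul]
  refine (expect_mono _ h1).trans ?_
  rw [expect_const_mul, expect_toPMF_on]
  have h3 : ∑ a ∈ X, p.1 a * (1 + (w a / (p.1 a + γ) + (w a / (p.1 a + γ)) ^ 2) * c a) ≤ 1 + σ := by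
    have : (1 : ℝ) + σ = ∑ a ∈ X, (p.1 a + w a * c a) := by
      rw [Finset.sum_add_distrib, p.2.2.2]
    rw [this]
    refine Finset.sum_le_sum fun a _ => ?_
    have hpa := p.2.1 a
    have hpg : 0 < p.1 a + γ := by linarith
    have h4 : p.1 a * (w a / (p.1 a + γ) + (w a / (p.1 a + γ)) ^ 2) ≤ w a := by
      have e : p.1 a * (w a / (p.1 a + γ) + (w a / (p.1 a + γ)) ^ 2) =
          w a * (p.1 a * (p.1 a + γ + w a) / (p.1 a + γ) ^ 2) := by
        field_simp
      rw [e]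
      refine mul_le_of_le_one_right (hw0 a) ?_
      rw [div_le_one (by positivity)]
      nlinarith [hw1 a]
    have h5 := mul_le_mul_of_nonneg_right h4 (hc0 a)
    linarith
  calc Real.exp (-σ) * _ ≤ Real.exp (-σ) * Real.exp σ := by
        refine mul_le_mul_of_nonneg_left (h3.trans ?_) (Real.exp_pos _).le
        have := Real.add_one_le_exp σ
        linarith
    _ = 1 := by rw [← Real.exp_add, neg_add_cancel, Real.exp_zero]

/-! ### The laws of a step, of an episode and of a run -/

section Laws

variable {S A B : Type*} {H : ℕ} (M : MarkovGame S A B H)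

/-- Law of the opponent's action and of the next state, given the learner's action. -/
def MarkovGame.replyLaw (h : ℕ) (s : S) (q : Dist (M.oppActs h)) (a : A) : PMF (B × S) :=
  q.toPMF.bind fun b => (M.trans h s a b).toPMF.map fun s' => (b, s')

/-- Law of both actions and of the next state. -/
def MarkovGame.stepLaw (h : ℕ) (s : S) (p : Dist (M.acts h)) (q : Dist (M.oppActs h)) :
    PMF (A × B × S) :=
  p.toPMF.bind fun a => (M.replyLaw h s q a).map fun z => (a, z)

theorem before_snoc_castSucc {k : ℕ} (ω : Fin k → Episode S A B H) (e : Episode S A B H)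
    (j : Fin k) :
    before (Fin.snoc ω e : Fin (k + 1) → Episode S A B H) j.castSucc = before ω j := by
  funext i
  have : Fin.castLE (j.castSucc).isLt.le i = (Fin.castLE j.isLt.le i).castSucc := rfl
  simp only [before, this, Fin.snoc_castSucc]

theorem before_snoc_last {k : ℕ} (ω : Fin k → Episode S A B H) (e : Episode S A B H) :
    before (Fin.snoc ω e : Fin (k + 1) → Episode S A B H) (Fin.last k) = ω := by
  funext i
  have : Fin.castLE (Fin.last k).isLt.le i = i.castSucc := rfl
  simp only [before, this, Fin.snoc_castSucc]

theorem mem_of_mem_support_toPMF {α : Type*} {X : Finset α} (p : Dist X) {a : α}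
    (ha : a ∈ p.toPMF.support) : a ∈ X := by
  by_contra h
  rw [PMF.mem_support_iff, Dist.toPMF, PMF.ofFinset_apply, p.2.2.1 a h] at ha
  simp at ha

theorem exists_of_mem_support_rollout_succ {M : MarkovGame S A B H} {μ : M.Policy}
    {ν : M.OppPolicy} {n h : ℕ} {s : S} {e : Fin (n + 1) → Step S A B}
    (he : e ∈ (M.rollout μ ν (n + 1) h s).support) :
    ∃ a ∈ M.acts h, ∃ b, ∃ s' ∈ M.states (h + 1), ∃ t ∈ (M.rollout μ ν n (h + 1) s').support,
      e = (Fin.cons (s, a, b, s') t : Fin (n + 1) → Step S A B) := by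
  simp only [MarkovGame.rollout, PMF.mem_support_bind_iff, PMF.mem_support_map_iff] at he
  obtain ⟨a, ha, b, -, s', hs', t, ht, rfl⟩ := he
  exact ⟨a, mem_of_mem_support_toPMF _ ha, b, s', mem_of_mem_support_toPMF _ hs', t, ht, rfl⟩

/-- Almost surely, actions and states are legal. -/
theorem mem_of_mem_support_rollout {M : MarkovGame S A B H} {μ : M.Policy} {ν : M.OppPolicy} :
    ∀ {n h : ℕ} {s : S} {e : Fin n → Step S A B}, e ∈ (M.rollout μ ν n h s).support →
      ∀ i : Fin n, (e i).2.1 ∈ M.acts (h + i) ∧ (e i).2.2.2 ∈ M.states (h + i + 1)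
  | 0, _, _, _ => fun _ i => i.elim0
  | n + 1, h, s, e => by
    intro he i
    obtain ⟨a, ha, b, s', hs', t, ht, rfl⟩ := exists_of_mem_support_rollout_succ he
    induction i using Fin.cases with
    | zero => exact ⟨ha, hs'⟩
    | succ j =>
      have := mem_of_mem_support_rollout ht j
      rw [Fin.cons_succ, Fin.val_succ, show h + ((j : ℕ) + 1) = h + 1 + j by ring]
      exact this

theorem fst_zero_of_mem_support_rollout {M : MarkovGame S A B H} {μ : M.Policy} {ν : M.OppPolicy}
    {n h : ℕ} {s : S} {e : Fin n → Step S A B} (he : e ∈ (M.rollout μ ν n h s).support)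
    (hn : 0 < n) : (e ⟨0, hn⟩).1 = s := by
  cases n with
  | zero => exact absurd hn (lt_irrefl 0)
  | succ n =>
    obtain ⟨a, -, b, s', -, t, -, rfl⟩ := exists_of_mem_support_rollout_succ he
    rfl

/-- Almost surely, each step starts where the previous one ended. -/
theorem fst_succ_of_mem_support_rollout {M : MarkovGame S A B H} {μ : M.Policy} {ν : M.OppPolicy} :
    ∀ {n h : ℕ} {s : S} {e : Fin n → Step S A B}, e ∈ (M.rollout μ ν n h s).support →
      ∀ (i : ℕ) (hi : i + 1 < n), (e ⟨i + 1, hi⟩).1 = (e ⟨i, (Nat.lt_succ_self i).trans hi⟩).2.2.2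
  | 0, _, _, _ => fun _ _ hi => absurd hi (Nat.not_lt_zero _)
  | n + 1, h, s, e => by
    intro he i hi
    obtain ⟨a, -, b, s', -, t, ht, rfl⟩ := exists_of_mem_support_rollout_succ he
    cases i with
    | zero => exact fst_zero_of_mem_support_rollout ht (Nat.lt_of_succ_lt_succ hi)
    | succ i => exact fst_succ_of_mem_support_rollout ht i (Nat.lt_of_succ_lt_succ hi)

theorem mem_support_rollout_of_mem_support_runLaw {M : MarkovGame S A B H} {T : Tuning}
    {ν : ℕ → M.OppPolicy} {init : ∀ k : ℕ, (Fin k → Episode S A B H) → S} :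
    ∀ {K : ℕ} {ω : Fin K → Episode S A B H}, ω ∈ (M.runLaw T ν init K).support → ∀ k : Fin K,
      ω k ∈ (M.rollout (M.policyOf (M.memory T k (before ω k))) (ν k) H 0
        (init k (before ω k))).support
  | 0, _ => fun _ k => k.elim0
  | K + 1, ω => by
    intro hω k
    simp only [MarkovGame.runLaw, PMF.mem_support_bind_iff, PMF.mem_support_map_iff] at hω
    obtain ⟨ω', hω', e, he, rfl⟩ := hω
    induction k using Fin.lastCases with
    | last => rwa [Fin.snoc_last, before_snoc_last]
    | cast j =>
      rw [Fin.snoc_castSucc, before_snoc_castSucc]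
      exact mem_support_rollout_of_mem_support_runLaw hω' j

variable [Fintype S] [Fintype B]

theorem expect_replyLaw (h : ℕ) (s : S) (q : Dist (M.oppActs h)) (a : A) (f : B × S → ℝ) :
    expect (M.replyLaw h s q a) f =
      ∑ b, q.1 b * ∑ s', (M.trans h s a b).1 s' * f (b, s') := by
  simp only [MarkovGame.replyLaw, expect_bind, expect_map, expect_toPMF]

theorem expect_replyLaw_target (h : ℕ) (V : S → ℝ) (s : S) (q : Dist (M.oppActs h)) (a : A) :
    expect (M.replyLaw h s q a) (fun z => M.reward h s a z.1 + V z.2) =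
      ∑ b, q.1 b * (M.reward h s a b + ∑ s', (M.trans h s a b).1 s' * V s') := by
  rw [expect_replyLaw]
  refine Finset.sum_congr rfl fun b _ => ?_
  simp only [mul_add, Finset.sum_add_distrib, ← Finset.sum_mul]
  have : ∑ s', (M.trans h s a b).1 s' = 1 := by
    have := expect_toPMF (M.trans h s a b) (fun _ => 1)
    simpa [expect_const] using this.symm
  rw [this, one_mul]

variable [Fintype A]

theorem expect_stepLaw (h : ℕ) (s : S) (p : Dist (M.acts h)) (q : Dist (M.oppActs h))
    (f : A × B × S → ℝ) :
    expect (M.stepLaw h s p q) f =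
      expect p.toPMF fun a => expect (M.replyLaw h s q a) fun z => f (a, z) := by
  simp only [MarkovGame.stepLaw, expect_bind, expect_map]

theorem oneStep_eq_expect (h : ℕ) (V : S → ℝ) (s : S) (p : Dist (M.acts h))
    (q : Dist (M.oppActs h)) :
    M.oneStep h V s p.1 q.1 = expect p.toPMF fun a =>
      expect (M.replyLaw h s q a) fun z => M.reward h s a z.1 + V z.2 := by
  simp only [expect_replyLaw_target, expect_toPMF, MarkovGame.oneStep, Finset.mul_sum]
  exact Finset.sum_congr rfl fun a _ => Finset.sum_congr rfl fun b _ => by ring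

theorem expect_rollout_succ (μ : M.Policy) (ν : M.OppPolicy) (n h : ℕ) (s : S)
    (f : (Fin (n + 1) → Step S A B) → ℝ) :
    expect (M.rollout μ ν (n + 1) h s) f = expect (M.stepLaw h s (μ h s) (ν h s)) fun z =>
      expect (M.rollout μ ν n (h + 1) z.2.2) fun t =>
        f (Fin.cons (s, z.1, z.2.1, z.2.2) t : Fin (n + 1) → Step S A B) := by
  simp only [MarkovGame.rollout, MarkovGame.stepLaw, MarkovGame.replyLaw, expect_bind, expect_map]

/-- A bound on a conditional mean that holds whatever the state of a step transfers to the
episode. -/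
theorem expect_rollout_apply_le (μ : M.Policy) (ν : M.OppPolicy) (g : Step S A B → ℝ) (c : ℝ) :
    ∀ (n h : ℕ) (s : S) (i : Fin n),
      (∀ s, expect (M.stepLaw (h + i) s (μ (h + i) s) (ν (h + i) s))
        (fun z => g (s, z.1, z.2.1, z.2.2)) ≤ c) →
      expect (M.rollout μ ν n h s) (fun t => g (t i)) ≤ c
  | n + 1, h, s, i => by
    intro hg
    rw [expect_rollout_succ]
    induction i using Fin.cases with
    | zero =>
      simp only [Fin.cons_zero, expect_const]
      exact hg s
    | succ j =>
      simp only [Fin.cons_succ]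
      rw [← expect_const (M.stepLaw h s (μ h s) (ν h s)) c]
      refine expect_mono _ fun z => ?_
      refine expect_rollout_apply_le μ ν g c n (h + 1) z.2.2 j ?_
      have e : h + 1 + (j : ℕ) = h + (j.succ : Fin (n + 1)) := by
        rw [Fin.val_succ]
        ring
      rw [e]
      exact hg

theorem expect_runLaw_succ (T : Tuning) (ν : ℕ → M.OppPolicy)
    (init : ∀ k : ℕ, (Fin k → Episode S A B H) → S) (k : ℕ)
    (f : (Fin (k + 1) → Episode S A B H) → ℝ) :
    expect (M.runLaw T ν init (k + 1)) f = expect (M.runLaw T ν init k) fun ω =>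
      expect (M.rollout (M.policyOf (M.memory T k ω)) (ν k) H 0 (init k ω)) fun e =>
        f (Fin.snoc ω e : Fin (k + 1) → Episode S A B H) := by
  simp only [MarkovGame.runLaw, expect_bind, expect_map]

/-- Increments with conditional exponential moments at most `1` have a sum with exponential moment
at most `1`. -/
theorem expect_runLaw_exp_sum_le (T : Tuning) (ν : ℕ → M.OppPolicy)
    (init : ∀ k : ℕ, (Fin k → Episode S A B H) → S)
    (Y : ∀ k : ℕ, (Fin k → Episode S A B H) → Episode S A B H → ℝ)
    (hY : ∀ k ω, expect (M.rollout (M.policyOf (M.memory T k ω)) (ν k) H 0 (init k ω))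
      (fun e => Real.exp (Y k ω e)) ≤ 1) (K : ℕ) :
    expect (M.runLaw T ν init K)
      (fun ω => Real.exp (∑ k : Fin K, Y k (before ω k) (ω k))) ≤ 1 := by
  induction K with
  | zero => simp [expect_const]
  | succ K ih =>
    rw [expect_runLaw_succ]
    refine le_trans (expect_mono _ fun ω => ?_) ih
    simp only [Fin.sum_univ_castSucc, before_snoc_castSucc, before_snoc_last, Fin.snoc_castSucc,
      Fin.snoc_last, Real.exp_add, Fin.val_castSucc, Fin.val_last, expect_const_mul]
    exact mul_le_of_le_one_right (Real.exp_pos _).le (hY K ω)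

end Laws

/-! ### Total variation and empirical Nash values -/

section Simplex

variable {α : Type*}

theorem convex_simplexOn (X : Finset α) : Convex ℝ (simplexOn X) := by
  intro p hp q hq s t hs ht hst
  refine ⟨fun a => ?_, fun a ha => ?_, ?_⟩
  · have := hp.1 a
    have := hq.1 a
    simp only [Pi.add_apply, Pi.smul_apply, smul_eq_mul]
    positivity
  · simp [hp.2.1 a ha, hq.2.1 a ha]
  · simp only [Pi.add_apply, Pi.smul_apply, smul_eq_mul]
    rw [Finset.sum_add_distrib, ← Finset.mul_sum, ← Finset.mul_sum, hp.2.2, hq.2.2]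
    linarith

theorem isCompact_simplexOn (X : Finset α) : IsCompact (simplexOn X) := by
  have hsub : simplexOn X ⊆ Set.pi Set.univ (fun _ : α => Set.Icc (0 : ℝ) 1) :=
    fun p hp a _ => ⟨hp.1 a, Dist.le_one ⟨p, hp⟩ a⟩
  refine IsCompact.of_isClosed_subset (isCompact_univ_pi fun _ => isCompact_Icc) ?_ hsub
  have h1 : IsClosed {p : α → ℝ | ∀ a, 0 ≤ p a} := by
    simp only [Set.ofPred_forall]
    exact isClosed_iInter fun a => isClosed_le continuous_const (continuous_apply a)
  have h2 : IsClosed {p : α → ℝ | ∀ a, a ∉ X → p a = 0} := by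
    simp only [Set.ofPred_forall]
    exact isClosed_iInter fun a => isClosed_iInter fun _ =>
      isClosed_eq (continuous_apply a) continuous_const
  have h3 : IsClosed {p : α → ℝ | ∑ a ∈ X, p a = 1} :=
    isClosed_eq (continuous_finsetSum _ fun a _ => continuous_apply a) continuous_const
  exact h1.inter (h2.inter h3)

theorem tvDist_nonneg (p q : α → ℝ) : 0 ≤ tvDist p q :=
  Real.iSup_nonneg fun _ => abs_nonneg _

variable [Fintype α]

theorem Dist.sum_eq_one {X : Finset α} (p : Dist X) : ∑ a, p.1 a = 1 := by
  have := expect_toPMF p (fun _ => 1)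
  simpa [expect_const] using this.symm

theorem bddAbove_tvDist (p q : α → ℝ) :
    BddAbove (Set.range fun E : Finset α => |∑ b ∈ E, p b - ∑ b ∈ E, q b|) :=
  (Set.finite_range _).bddAbove

theorem tvDist_le_one {X : Finset α} (p q : Dist X) : tvDist p.1 q.1 ≤ 1 := by
  refine ciSup_le fun E => ?_
  have h : ∀ r : Dist X, 0 ≤ ∑ b ∈ E, r.1 b ∧ ∑ b ∈ E, r.1 b ≤ 1 := fun r =>
    ⟨Finset.sum_nonneg fun b _ => r.2.1 b, by
      rw [← r.sum_eq_one]
      exact Finset.sum_le_univ_sum_of_nonneg r.2.1⟩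
  rw [abs_le]
  constructor <;> linarith [(h p).1, (h p).2, (h q).1, (h q).2]

theorem sum_sub_mul_le_tvDist (p q f : α → ℝ) {c : ℝ} (h0 : ∀ b, 0 ≤ f b) (h1 : ∀ b, f b ≤ c)
    (hc : 0 ≤ c) : ∑ b, (p b - q b) * f b ≤ c * tvDist p q := by
  classical
  set E := Finset.univ.filter fun b => 0 ≤ p b - q b
  have h2 : ∑ b, (p b - q b) * f b ≤ ∑ b ∈ E, c * (p b - q b) := by
    rw [← Finset.sum_filter_add_sum_filter_not Finset.univ (fun b => 0 ≤ p b - q b)]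
    have h3 : ∑ b with ¬0 ≤ p b - q b, (p b - q b) * f b ≤ 0 := by
      refine Finset.sum_nonpos fun b hb => ?_
      have := (Finset.mem_filter.1 hb).2
      exact mul_nonpos_of_nonpos_of_nonneg (by linarith) (h0 b)
    have h4 : ∑ b ∈ E, (p b - q b) * f b ≤ ∑ b ∈ E, c * (p b - q b) := by
      refine Finset.sum_le_sum fun b hb => ?_
      have := (Finset.mem_filter.1 hb).2
      rw [mul_comm c]
      exact mul_le_mul_of_nonneg_left (h1 b) this
    linarith
  refine h2.trans ?_
  rw [← Finset.mul_sum]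
  refine mul_le_mul_of_nonneg_left ?_ hc
  rw [Finset.sum_sub_distrib]
  exact (le_abs_self _).trans (le_ciSup (bddAbove_tvDist p q) E)

end Simplex

section Nash

variable {S A B : Type*} {H : ℕ} (M : MarkovGame S A B H) [Fintype S] [Fintype A] [Fintype B]

theorem MarkovGame.oneStep_eq_sum (h : ℕ) (V : S → ℝ) (s : S) (p : A → ℝ) (q : B → ℝ) :
    M.oneStep h V s p q =
      ∑ b, q b * ∑ a, p a * (M.reward h s a b + ∑ s', (M.trans h s a b).1 s' * V s') := by
  unfold MarkovGame.oneStep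
  rw [Finset.sum_comm]
  refine Finset.sum_congr rfl fun b _ => ?_
  rw [Finset.mul_sum]
  exact Finset.sum_congr rfl fun a _ => by ring

theorem MarkovGame.isLinearMap_oneStep_left (h : ℕ) (V : S → ℝ) (s : S) (q : B → ℝ) :
    IsLinearMap ℝ fun p => M.oneStep h V s p q := by
  constructor
  · intro p p'
    simp only [MarkovGame.oneStep, Pi.add_apply, add_mul, Finset.sum_add_distrib]
  · intro c p
    simp only [MarkovGame.oneStep, Pi.smul_apply, smul_eq_mul, Finset.mul_sum, mul_assoc]

theorem MarkovGame.isLinearMap_oneStep_right (h : ℕ) (V : S → ℝ) (s : S) (p : A → ℝ) :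
    IsLinearMap ℝ fun q => M.oneStep h V s p q := by
  constructor
  · intro q q'
    simp only [MarkovGame.oneStep_eq_sum, Pi.add_apply, add_mul, Finset.sum_add_distrib]
  · intro c q
    simp only [MarkovGame.oneStep_eq_sum, Pi.smul_apply, smul_eq_mul, Finset.mul_sum, mul_assoc]

theorem MarkovGame.oneStep_mem {h : ℕ} {V : S → ℝ} {c : ℝ} (h0 : ∀ s, 0 ≤ V s) (h1 : ∀ s, V s ≤ c)
    (s : S) (p : Dist (M.acts h)) (q : Dist (M.oppActs h)) :
    0 ≤ M.oneStep h V s p.1 q.1 ∧ M.oneStep h V s p.1 q.1 ≤ 1 + c := by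
  have hr := M.reward_mem h s
  rw [oneStep_eq_expect]
  constructor
  · exact expect_nonneg _ fun a => expect_nonneg _ fun z => add_nonneg (hr _ _).1 (h0 _)
  · rw [← expect_const p.toPMF (1 + c)]
    refine expect_mono _ fun a => ?_
    rw [← expect_const (M.replyLaw h s q a) (1 + c)]
    exact expect_mono _ fun z => add_le_add (hr _ _).2 (h1 _)

theorem MarkovGame.oneStep_mono {h : ℕ} {V W : S → ℝ} (hVW : ∀ s ∈ M.states (h + 1), V s ≤ W s)
    (s : S) (p : Dist (M.acts h)) (q : Dist (M.oppActs h)) :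
    M.oneStep h V s p.1 q.1 ≤ M.oneStep h W s p.1 q.1 := by
  refine Finset.sum_le_sum fun a _ => Finset.sum_le_sum fun b _ => ?_
  refine mul_le_mul_of_nonneg_left (add_le_add le_rfl (Finset.sum_le_sum fun s' _ => ?_))
    (mul_nonneg (p.2.1 a) (q.2.1 b))
  by_cases hs : s' ∈ M.states (h + 1)
  · exact mul_le_mul_of_nonneg_left (hVW s' hs) ((M.trans h s a b).2.1 s')
  · rw [(M.trans h s a b).2.2.1 s' hs, zero_mul, zero_mul]

instance nonempty_dist_acts (h : ℕ) : Nonempty (Dist (M.acts h)) :=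
  ⟨uniformOn _ (M.acts_nonempty h)⟩

theorem MarkovGame.maxmin_mem {K : ℕ} (hK : 0 < K) (ν : ℕ → M.OppPolicy) {h : ℕ} {V : S → ℝ}
    {c : ℝ} (h0 : ∀ s, 0 ≤ V s) (h1 : ∀ s, V s ≤ c) (s : S) :
    0 ≤ (⨆ p : Dist (M.acts h), ⨅ k : Fin K, M.oneStep h V s p.1 (ν k h s).1) ∧
      (⨆ p : Dist (M.acts h), ⨅ k : Fin K, M.oneStep h V s p.1 (ν k h s).1) ≤ 1 + c := by
  have : Nonempty (Fin K) := ⟨⟨0, hK⟩⟩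
  have hb := fun (p : Dist (M.acts h)) (k : Fin K) => M.oneStep_mem h0 h1 s p (ν k h s)
  constructor
  · exact Real.iSup_nonneg fun p => le_ciInf fun k => (hb p k).1
  · refine ciSup_le fun p => ?_
    have h2 : BddBelow (Set.range fun k : Fin K => M.oneStep h V s p.1 (ν k h s).1) :=
      (Set.finite_range _).bddBelow
    exact (ciInf_le h2 ⟨0, hK⟩).trans (hb p ⟨0, hK⟩).2

theorem MarkovGame.empNashAux_mem {K : ℕ} (hK : 0 < K) (ν : ℕ → M.OppPolicy) (n : ℕ) :
    ∀ (h : ℕ) (s : S), 0 ≤ M.empNashAux K ν n h s ∧ M.empNashAux K ν n h s ≤ n := by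
  induction n with
  | zero => simp [MarkovGame.empNashAux]
  | succ n ih =>
    intro h s
    have := M.maxmin_mem hK ν (h := h) (fun s => (ih (h + 1) s).1) (fun s => (ih (h + 1) s).2) s
    rw [Nat.cast_succ, add_comm (n : ℝ)]
    exact this

theorem MarkovGame.empNash_nonneg {K : ℕ} (hK : 0 < K) (ν : ℕ → M.OppPolicy) (h : ℕ) (s : S) :
    0 ≤ M.empNash K ν h s :=
  (M.empNashAux_mem hK ν _ h s).1

theorem MarkovGame.empNash_le {K : ℕ} (hK : 0 < K) (ν : ℕ → M.OppPolicy) {h : ℕ} (hh : h ≤ H)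
    (s : S) :
    M.empNash K ν h s ≤ (H : ℝ) - h := by
  rw [← Nat.cast_sub hh]
  exact (M.empNashAux_mem hK ν _ h s).2

theorem MarkovGame.empNash_terminal (K : ℕ) (ν : ℕ → M.OppPolicy) (s : S) :
    M.empNash K ν H s = 0 := by
  simp [MarkovGame.empNash, MarkovGame.empNashAux]

theorem MarkovGame.empNash_eq_iSup (K : ℕ) (ν : ℕ → M.OppPolicy) {h : ℕ} (hh : h < H) (s : S) :
    M.empNash K ν h s = ⨆ p : Dist (M.acts h), ⨅ k : Fin K,
      M.oneStep h (M.empNash K ν (h + 1)) s p.1 (ν k h s).1 := by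
  have e : H - h = (H - (h + 1)) + 1 := by omega
  simp only [MarkovGame.empNash]
  rw [e]
  rfl

/-- Minimax theorem for the stage game with the empirical Nash values as continuation values: some
mixed action guarantees the value against all `K` mixed actions of the opponent, and against `νs`
nothing better is possible. -/
theorem MarkovGame.exists_minimax {K : ℕ} (hK : 0 < K) {ν : ℕ → M.OppPolicy} {νs : ℕ → S → B → ℝ}
    (hνs : M.IsMinimax K ν νs) {h : ℕ} (hh : h < H) {s : S} (hs : s ∈ M.states h) :
    ∃ p : Dist (M.acts h),
      (∀ k : Fin K, M.empNash K ν h s ≤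
        M.oneStep h (M.empNash K ν (h + 1)) s p.1 (ν k h s).1) ∧
      ∀ p' : Dist (M.acts h),
        M.oneStep h (M.empNash K ν (h + 1)) s p'.1 (νs h s) ≤ M.empNash K ν h s := by
  have hne : Nonempty (Fin K) := ⟨⟨0, hK⟩⟩
  set V := M.empNash K ν (h + 1) with hV
  set f : (B → ℝ) → (A → ℝ) → ℝ := fun q p => M.oneStep h V s p q with hf
  have hcr : ∀ p, Continuous fun q => f q p := by
    intro p
    simp only [hf, MarkovGame.oneStep]
    fun_prop
  have hcl : ∀ q, Continuous fun p => f q p := by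
    intro q
    simp only [hf, MarkovGame.oneStep]
    fun_prop
  have hlr : ∀ p, IsLinearMap ℝ fun q => f q p := fun p => M.isLinearMap_oneStep_right h V s p
  have hll : ∀ q, IsLinearMap ℝ fun p => f q p := fun q => M.isLinearMap_oneStep_left h V s q
  have hsub := fun k : Fin K => subset_convexHull ℝ (Set.range fun k : Fin K => (ν k h s).1)
    (Set.mem_range_self k)
  obtain ⟨a, ha, b, hb, hab⟩ := Sion.exists_isSaddlePointOn (X := M.oppHull K ν h s)
    (Y := simplexOn (M.acts h)) (f := f) ⟨_, hsub ⟨0, hK⟩⟩ (convex_convexHull ℝ _)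
    ((Set.finite_range _).isCompact_convexHull ℝ)
    (fun p _ => (hcr p).lowerSemicontinuous.lowerSemicontinuousOn _)
    (fun p _ => ((hlr p).mk' _).convexOn (convex_convexHull ℝ _) |>.quasiconvexOn)
    (convex_simplexOn _) ⟨_, (uniformOn _ (M.acts_nonempty h)).2⟩ (isCompact_simplexOn _)
    (fun q _ => (hcl q).upperSemicontinuous.upperSemicontinuousOn _)
    (fun q _ => ((hll q).mk' _).concaveOn (convex_simplexOn _) |>.quasiconcaveOn)
  have hinf : ∀ p : Dist (M.acts h), ⨅ k : Fin K, f (ν k h s).1 p.1 ≤ f a b := by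
    intro p
    refine le_trans ?_ (hab a ha p.1 p.2)
    have hconv : Convex ℝ {q | ⨅ k : Fin K, f (ν k h s).1 p.1 ≤ f q p.1} :=
      convex_halfSpace_ge (hlr p.1) _
    have := convexHull_min (s := Set.range fun k : Fin K => (ν k h s).1) (by
      rintro _ ⟨k, rfl⟩
      have h2 : BddBelow (Set.range fun k : Fin K => f (ν k h s).1 p.1) :=
        (Set.finite_range _).bddBelow
      exact ciInf_le h2 k) hconv
    exact this ha
  have hval : M.empNash K ν h s = f a b := by
    rw [M.empNash_eq_iSup K ν hh s]
    apply le_antisymm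
    · exact ciSup_le hinf
    · refine le_ciSup_of_le ⟨f a b, ?_⟩ (⟨b, hb⟩ : Dist (M.acts h)) ?_
      · rintro _ ⟨p, rfl⟩
        exact hinf p
      · exact le_ciInf fun k => hab _ (hsub k) b hb
  rw [hval]
  refine ⟨⟨b, hb⟩, fun k => hab _ (hsub k) b hb, fun p' => ?_⟩
  obtain ⟨h1, h2⟩ := hνs h hh s hs
  have h3 : BddAbove (Set.range fun p : Dist (M.acts h) => M.oneStep h V s p.1 (νs h s)) := by
    have := (isCompact_simplexOn (M.acts h)).bddAbove_image (hcl (νs h s)).continuousOn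
    refine this.mono ?_
    rintro _ ⟨p, rfl⟩
    exact ⟨p.1, p.2, rfl⟩
  refine (le_ciSup h3 p').trans ((h2 a ha).trans ?_)
  exact ciSup_le fun p => hab a ha p.1 p.2

theorem MarkovGame.IsMinimax.mem_simplexOn {M : MarkovGame S A B H} {K : ℕ} {ν : ℕ → M.OppPolicy}
    {νs : ℕ → S → B → ℝ} (hνs : M.IsMinimax K ν νs) {h : ℕ} (hh : h < H) {s : S}
    (hs : s ∈ M.states h) : νs h s ∈ simplexOn (M.oppActs h) := by
  refine convexHull_min ?_ (convex_simplexOn (M.oppActs h)) (hνs h hh s hs).1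
  rintro _ ⟨k, rfl⟩
  exact (ν k h s).2

/-- Whatever the learner plays, it gets at most the empirical Nash value, up to the distance of the
opponent's mixed action from the minimax one. -/
theorem MarkovGame.oneStep_le_empNash_add {K : ℕ} (hK : 0 < K) {ν : ℕ → M.OppPolicy}
    {νs : ℕ → S → B → ℝ} (hνs : M.IsMinimax K ν νs) {h : ℕ} (hh : h < H) {s : S}
    (hs : s ∈ M.states h) (p : Dist (M.acts h)) (q : B → ℝ) :
    M.oneStep h (M.empNash K ν (h + 1)) s p.1 q ≤
      M.empNash K ν h s + H * tvDist q (νs h s) := by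
  obtain ⟨-, -, h1⟩ := M.exists_minimax hK hνs hh hs
  have h2 := h1 p
  set V := M.empNash K ν (h + 1) with hV
  set F : B → ℝ := fun b => ∑ a, p.1 a * (M.reward h s a b + ∑ s', (M.trans h s a b).1 s' * V s')
    with hF
  have hh' : ((h + 1 : ℕ) : ℝ) ≤ H := by exact_mod_cast hh
  have hin : ∀ a b, 0 ≤ M.reward h s a b + ∑ s', (M.trans h s a b).1 s' * V s' ∧
      M.reward h s a b + ∑ s', (M.trans h s a b).1 s' * V s' ≤ H := by
    intro a b
    have hr := M.reward_mem h s a b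
    rw [← expect_toPMF]
    have hV0 := expect_nonneg (M.trans h s a b).toPMF fun s' => M.empNash_nonneg hK ν (h + 1) s'
    have hV1 := expect_mono (M.trans h s a b).toPMF fun s' => M.empNash_le hK ν hh s'
    rw [expect_const] at hV1
    push_cast at hV1
    have : (0 : ℝ) ≤ h := Nat.cast_nonneg h
    exact ⟨add_nonneg hr.1 hV0, by linarith [hr.2]⟩
  have h3 : ∑ b, (q b - νs h s b) * F b ≤ H * tvDist q (νs h s) := by
    refine sum_sub_mul_le_tvDist q (νs h s) F (fun b => ?_) (fun b => ?_) (Nat.cast_nonneg H)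
    · exact Finset.sum_nonneg fun a _ => mul_nonneg (p.2.1 a) (hin a b).1
    · simp only [hF]
      rw [← expect_toPMF, ← expect_const p.toPMF (H : ℝ)]
      exact expect_mono _ fun a => (hin a b).2
  rw [M.oneStep_eq_sum] at h2 ⊢
  simp only [sub_mul, Finset.sum_sub_distrib] at h3
  linarith

end Nash

/-! ### The evolution of a single cell -/

/-- Lengths of the epochs, with the convention that epoch `τ` has length `epochLen η (τ + 1)`; thus
`epochLen η τ` is the value of `prevN` during epoch `τ`, and serves as a label of the epoch. -/
def epochLen (η : ℝ) : ℕ → ℕ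
  | 0 => 1
  | τ + 1 => ⌈(1 + η) * (epochLen η τ : ℝ)⌉₊

section EpochLen

variable {η : ℝ}

theorem one_add_pow_le_epochLen (hη : 0 < η) : ∀ τ : ℕ, (1 + η) ^ τ ≤ (epochLen η τ : ℝ)
  | 0 => by simp [epochLen]
  | τ + 1 => by
    refine le_trans ?_ (Nat.le_ceil _)
    rw [pow_succ']
    exact mul_le_mul_of_nonneg_left (one_add_pow_le_epochLen hη τ) (by linarith)

theorem one_le_epochLen (hη : 0 < η) (τ : ℕ) : 1 ≤ epochLen η τ := by
  have : (1 : ℝ) ≤ epochLen η τ :=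
    (one_le_pow₀ (by linarith)).trans (one_add_pow_le_epochLen hη τ)
  exact_mod_cast this

theorem epochLen_strictMono (hη : 0 < η) : StrictMono (epochLen η) := by
  refine strictMono_nat_of_lt_succ fun τ => ?_
  rw [epochLen, Nat.lt_ceil]
  have : (1 : ℝ) ≤ epochLen η τ := by exact_mod_cast one_le_epochLen hη τ
  nlinarith

theorem epochLen_succ_le_mul (η : ℝ) (hη : 0 < η) (τ : ℕ) :
    (epochLen η (τ + 1) : ℝ) ≤ (1 + η) * epochLen η τ + 1 := by
  rw [epochLen]
  exact (Nat.ceil_lt_add_one (by positivity)).le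

theorem epochLen_succ_le_two_mul (hη1 : η ≤ 1) (τ : ℕ) :
    epochLen η (τ + 1) ≤ 2 * epochLen η τ := by
  rw [epochLen, Nat.ceil_le]
  push_cast
  exact mul_le_mul_of_nonneg_right (by linarith) (Nat.cast_nonneg _)

end EpochLen

/-- The sequence `c` of contents of a cell of step `h` over the episodes; in the episodes `k` with
`vis k` the cell is visited with action `a k` and target `y k`. -/
structure IsCellRun {A : Type*} {X : Finset A} (T : Tuning) (hX : X.Nonempty) (H h : ℕ)
    (c : ℕ → Cell X) (vis : ℕ → Prop) (a : ℕ → A) (y : ℕ → ℝ) : Prop where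
  zero : c 0 =
    { V := (H : ℝ) - h
      pol := uniformOn X hX
      prevN := 1
      N := 0
      total := 0
      bandit := BanditState.start A }
  visit : ∀ k, vis k → c (k + 1) = (c k).visit T hX H h (a k) (y k)
  skip : ∀ k, ¬vis k → c (k + 1) = c k

section CellRun

variable {A : Type*} {X : Finset A}

open Classical in
/-- The visits, before episode `k`, in the epoch labelled `P`. -/
def epochVisits (c : ℕ → Cell X) (vis : ℕ → Prop) (P k : ℕ) : Finset ℕ :=
  (Finset.range k).filter fun j => vis j ∧ (c j).prevN = P

open Classical in
/-- The visits, before episode `k`, in the epoch labelled `P` and in block `i` of its bandit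
instance. -/
def blockVisits (c : ℕ → Cell X) (vis : ℕ → Prop) (P i k : ℕ) : Finset ℕ :=
  (Finset.range k).filter fun j => vis j ∧ (c j).prevN = P ∧ (c j).bandit.block = i

variable {c : ℕ → Cell X} {vis : ℕ → Prop}

theorem mem_epochVisits {P k j : ℕ} :
    j ∈ epochVisits c vis P k ↔ j < k ∧ vis j ∧ (c j).prevN = P := by
  simp [epochVisits]

theorem mem_blockVisits {P i k j : ℕ} :
    j ∈ blockVisits c vis P i k ↔
      j < k ∧ vis j ∧ (c j).prevN = P ∧ (c j).bandit.block = i := by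
  simp [blockVisits]

theorem epochVisits_zero (P : ℕ) : epochVisits c vis P 0 = ∅ := by
  ext j
  simp [mem_epochVisits]

theorem blockVisits_zero (P i : ℕ) : blockVisits c vis P i 0 = ∅ := by
  ext j
  simp [mem_blockVisits]

theorem epochVisits_succ_of_not {P k : ℕ} (h : ¬(vis k ∧ (c k).prevN = P)) :
    epochVisits c vis P (k + 1) = epochVisits c vis P k := by
  classical
  simp only [epochVisits, Finset.range_add_one, Finset.filter_insert, if_neg h]

theorem epochVisits_succ_self {k : ℕ} (h : vis k) :
    epochVisits c vis (c k).prevN (k + 1) = insert k (epochVisits c vis (c k).prevN k) := by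
  classical
  simp only [epochVisits, Finset.range_add_one, Finset.filter_insert, h, true_and, if_true]

theorem blockVisits_succ_of_not {P i k : ℕ}
    (h : ¬(vis k ∧ (c k).prevN = P ∧ (c k).bandit.block = i)) :
    blockVisits c vis P i (k + 1) = blockVisits c vis P i k := by
  classical
  simp only [blockVisits, Finset.range_add_one, Finset.filter_insert, if_neg h]

theorem blockVisits_succ_self {k : ℕ} (h : vis k) :
    blockVisits c vis (c k).prevN (c k).bandit.block (k + 1) =
      insert k (blockVisits c vis (c k).prevN (c k).bandit.block k) := by
  classical
  simp only [blockVisits, Finset.range_add_one, Finset.filter_insert, h, and_self, if_true]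

theorem self_notMem_epochVisits {P k : ℕ} : k ∉ epochVisits c vis P k := by
  simp [mem_epochVisits]

theorem self_notMem_blockVisits {P i k : ℕ} : k ∉ blockVisits c vis P i k := by
  simp [mem_blockVisits]

theorem card_epochVisits_le (P k : ℕ) : (epochVisits c vis P k).card ≤ k := by
  have : epochVisits c vis P k ⊆ Finset.range k := fun j hj =>
    Finset.mem_range.2 (mem_epochVisits.1 hj).1
  simpa using Finset.card_le_card this

/-- The contents of a cell before episode `k`, expressed through its visits; `τ` is the index of
the current epoch. -/
structure EpochInv (T : Tuning) (H h : ℕ) (c : ℕ → Cell X) (vis : ℕ → Prop) (y : ℕ → ℝ)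
    (k τ : ℕ) : Prop where
  prevN : (c k).prevN = epochLen T.eta τ
  card_past : ∀ σ < τ, (epochVisits c vis (epochLen T.eta σ) k).card = epochLen T.eta (σ + 1)
  mono : ∀ j < k, (c j).prevN ≤ (c k).prevN
  card : (epochVisits c vis (epochLen T.eta τ) k).card = (c k).N
  N_lt : (c k).N < epochLen T.eta (τ + 1)
  total : (c k).total = ∑ j ∈ epochVisits c vis (epochLen T.eta τ) k, y j
  V_zero : τ = 0 → (c k).V = (H : ℝ) - h
  V_succ : ∀ σ, τ = σ + 1 → (c k).V = min ((H : ℝ) - h)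
    ((∑ j ∈ epochVisits c vis (epochLen T.eta σ) k, y j) / (epochLen T.eta (σ + 1) : ℝ) +
      √(T.iota / (epochLen T.eta (σ + 1) : ℝ)))

variable {T : Tuning} {hX : X.Nonempty} {H h : ℕ} {a : ℕ → A} {y : ℕ → ℝ}

theorem IsCellRun.exists_epochInv (hc : IsCellRun T hX H h c vis a y) (hη : 0 < T.eta) (k : ℕ) :
    ∃ τ, EpochInv T H h c vis y k τ := by
  classical
  have hmono := epochLen_strictMono hη
  induction k with
  | zero =>
    refine ⟨0, ?_, ?_, ?_, ?_, ?_, ?_, ?_, ?_⟩ <;> simp [hc.zero, epochVisits_zero, epochLen]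
    linarith
  | succ k ih =>
    obtain ⟨τ, ih⟩ := ih
    by_cases hv : vis k
    · have hin : ∀ P, (c k).prevN ≠ P →
          epochVisits c vis P (k + 1) = epochVisits c vis P k := fun P hP =>
        epochVisits_succ_of_not fun h => hP h.2
      have hself : epochVisits c vis (epochLen T.eta τ) (k + 1) =
          insert k (epochVisits c vis (epochLen T.eta τ) k) := by
        have := epochVisits_succ_self (c := c) hv
        rwa [ih.prevN] at this
      have hcard : (epochVisits c vis (epochLen T.eta τ) (k + 1)).card = (c k).N + 1 := by
        rw [hself, Finset.card_insert_of_notMem self_notMem_epochVisits, ih.card]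
      have hsum : ∑ j ∈ epochVisits c vis (epochLen T.eta τ) (k + 1), y j =
          (c k).total + y k := by
        rw [hself, Finset.sum_insert self_notMem_epochVisits, ih.total, add_comm]
      have hne : ∀ σ < τ, (c k).prevN ≠ epochLen T.eta σ := fun σ hσ => by
        rw [ih.prevN]
        exact (hmono hσ).ne'
      have hlen : ⌈(1 + T.eta) * ((c k).prevN : ℝ)⌉₊ = epochLen T.eta (τ + 1) := by
        rw [ih.prevN, epochLen]
      by_cases he : (c k).N + 1 = epochLen T.eta (τ + 1)
      · have hck : c (k + 1) = _ := hc.visit k hv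
        rw [Cell.visit, if_pos (by rw [hlen]; exact he)] at hck
        have hempty : epochVisits c vis (epochLen T.eta (τ + 1)) (k + 1) = ∅ := by
          ext j
          simp only [mem_epochVisits, Finset.notMem_empty, iff_false, not_and]
          intro hj _ hP
          have h1 : (c j).prevN ≤ (c k).prevN := by
            rcases Nat.lt_succ_iff_lt_or_eq.1 hj with h | h
            · exact ih.mono j h
            · rw [h]
          rw [hP, ih.prevN] at h1
          exact absurd (hmono (Nat.lt_succ_self τ)) (not_lt.2 h1)
        refine ⟨τ + 1, ?_, ?_, ?_, ?_, ?_, ?_, ?_, ?_⟩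
        · rw [hck]
          exact he
        · intro σ hσ
          rcases Nat.lt_succ_iff_lt_or_eq.1 hσ with h | h
          · rw [hin _ (hne σ h)]
            exact ih.card_past σ h
          · rw [h, hcard, he]
        · intro j hj
          have h2 : (c k).prevN ≤ (c (k + 1)).prevN := by
            rw [hck, ih.prevN]
            dsimp only
            rw [he]
            exact (hmono (Nat.lt_succ_self τ)).le
          rcases Nat.lt_succ_iff_lt_or_eq.1 hj with h | h
          · exact (ih.mono j h).trans h2
          · rw [h]
            exact h2
        · rw [hempty, hck]
          rfl
        · rw [hck]
          exact one_le_epochLen hη _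
        · rw [hempty, hck]
          rfl
        · exact fun h => absurd h (Nat.succ_ne_zero τ)
        · intro σ hσ
          obtain rfl : τ = σ := Nat.succ_injective hσ
          rw [hck, hsum, ← he]
      · have hck : c (k + 1) = _ := hc.visit k hv
        rw [Cell.visit, if_neg (by rw [hlen]; exact he)] at hck
        refine ⟨τ, ?_, ?_, ?_, ?_, ?_, ?_, ?_, ?_⟩
        · rw [hck]
          exact ih.prevN
        · intro σ hσ
          rw [hin _ (hne σ hσ)]
          exact ih.card_past σ hσ
        · intro j hj
          rw [hck]
          rcases Nat.lt_succ_iff_lt_or_eq.1 hj with h | h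
          · exact ih.mono j h
          · rw [h]
        · rw [hcard, hck]
        · rw [hck]
          exact lt_of_le_of_ne ih.N_lt he
        · rw [hsum, hck]
        · rw [hck]
          exact ih.V_zero
        · intro σ hσ
          rw [hck, hin _ (hne σ (by omega))]
          exact ih.V_succ σ hσ
    · have hck := hc.skip k hv
      have hin : ∀ P, epochVisits c vis P (k + 1) = epochVisits c vis P k := fun P =>
        epochVisits_succ_of_not fun h => hv h.1
      refine ⟨τ, ?_, ?_, ?_, ?_, ?_, ?_, ?_, ?_⟩
      · rw [hck]
        exact ih.prevN
      · simpa only [hin] using ih.card_past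
      · intro j hj
        rw [hck]
        rcases Nat.lt_succ_iff_lt_or_eq.1 hj with h | h
        · exact ih.mono j h
        · rw [h]
      · rw [hin, hck, ih.card]
      · rw [hck]
        exact ih.N_lt
      · rw [hin, hck, ih.total]
      · rw [hck]
        exact ih.V_zero
      · simpa only [hin, hck] using ih.V_succ

/-- The implicit exploration loss estimates of the visit in episode `j`. -/
def lossEst (T : Tuning) (H : ℕ) (c : ℕ → Cell X) (a : ℕ → A) (y : ℕ → ℝ) (j : ℕ) (a' : A) : ℝ :=
  open Classical in
  if a' = a j then (1 - y j / H) / ((c j).pol.1 (a j) + ixParam T X.card (c j).bandit.block) else 0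

/-- The state of the bandit instance of a cell before episode `k`, expressed through the visits in
the current block. -/
structure BlockInv (T : Tuning) (H : ℕ) (c : ℕ → Cell X) (vis : ℕ → Prop) (a : ℕ → A) (y : ℕ → ℝ)
    (k : ℕ) : Prop where
  leader : IsLeader X (learningRate T (c k).bandit.block) (c k).bandit.loss (c k).pol
  loss : ∀ a', (c k).bandit.loss a' =
    ∑ j ∈ blockVisits c vis (c k).prevN (c k).bandit.block k, lossEst T H c a y j a'
  used : (blockVisits c vis (c k).prevN (c k).bandit.block k).card = (c k).bandit.used
  used_lt : (c k).bandit.used < 2 ^ (c k).bandit.block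
  N_eq : (c k).N + 1 = 2 ^ (c k).bandit.block + (c k).bandit.used
  mono : ∀ j < k, (c j).prevN = (c k).prevN → (c j).bandit.block ≤ (c k).bandit.block

theorem learningRate_pos (hlr : 0 < T.lrConst) (i : ℕ) : 0 < learningRate T i := by
  unfold learningRate
  positivity

theorem IsCellRun.blockInv (hc : IsCellRun T hX H h c vis a y) (hη : 0 < T.eta)
    (hlr : 0 < T.lrConst) (k : ℕ) : BlockInv T H c vis a y k := by
  classical
  have hmono := epochLen_strictMono hη
  induction k with
  | zero =>
    refine ⟨?_, ?_, ?_, ?_, ?_, ?_⟩ <;> simp [hc.zero, blockVisits_zero, BanditState.start]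
    exact uniformOn_isLeader hX (learningRate_pos hlr 0)
  | succ k ih =>
    obtain ⟨τ, hE⟩ := hc.exists_epochInv hη k
    obtain ⟨τ', hE'⟩ := hc.exists_epochInv hη (k + 1)
    by_cases hv : vis k
    · have hself := blockVisits_succ_self (c := c) hv
      have hle : ∀ j < k + 1, (c j).prevN = (c k).prevN →
          (c j).bandit.block ≤ (c k).bandit.block := by
        intro j hj hP
        rcases Nat.lt_succ_iff_lt_or_eq.1 hj with h | h
        · exact ih.mono j h hP
        · rw [h]
      have hlen : ⌈(1 + T.eta) * ((c k).prevN : ℝ)⌉₊ = epochLen T.eta (τ + 1) := by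
        rw [hE.prevN, epochLen]
      by_cases he : (c k).N + 1 = epochLen T.eta (τ + 1)
      · have hck : c (k + 1) = _ := hc.visit k hv
        rw [Cell.visit, if_pos (by rw [hlen]; exact he)] at hck
        have hnew : ∀ j < k + 1, (c j).prevN ≠ (c (k + 1)).prevN := by
          intro j hj
          have h1 : (c j).prevN ≤ (c k).prevN := by
            rcases Nat.lt_succ_iff_lt_or_eq.1 hj with h | h
            · exact hE.mono j h
            · rw [h]
          have h2 : (c (k + 1)).prevN = epochLen T.eta (τ + 1) := by
            rw [hck]
            exact he
          rw [h2]
          rw [hE.prevN] at h1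
          exact (h1.trans_lt (hmono (Nat.lt_succ_self τ))).ne
        have hempty : ∀ i, blockVisits c vis (c (k + 1)).prevN i (k + 1) = ∅ := by
          intro i
          ext j
          simp only [mem_blockVisits, Finset.notMem_empty, iff_false, not_and]
          exact fun hj _ hP => absurd hP (hnew j hj)
        refine ⟨?_, ?_, ?_, ?_, ?_, ?_⟩
        · rw [hck]
          exact uniformOn_isLeader hX (learningRate_pos hlr 0)
        · intro a'
          rw [hempty, hck]
          rfl
        · rw [hempty, hck]
          rfl
        · rw [hck]
          simp [BanditState.start]
        · rw [hck]
          simp [BanditState.start]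
        · exact fun j hj hP => absurd hP (hnew j hj)
      · have hck : c (k + 1) = _ := hc.visit k hv
        rw [Cell.visit, if_neg (by rw [hlen]; exact he)] at hck
        have hlead : IsLeader X (learningRate T (c (k + 1)).bandit.block) (c (k + 1)).bandit.loss
            (c (k + 1)).pol := by
          rw [hck]
          exact ftrl_isLeader hX _ _
        have hP' : (c (k + 1)).prevN = (c k).prevN := by rw [hck]
        have hN' : (c (k + 1)).N = (c k).N + 1 := by rw [hck]
        have hb' : (c (k + 1)).bandit =
            (c k).bandit.update T X (c k).pol.1 (a k) (y k / H) := by rw [hck]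
        by_cases hu : (c k).bandit.used + 1 = 2 ^ (c k).bandit.block
        · rw [BanditState.update, if_pos hu] at hb'
          have hempty : blockVisits c vis (c k).prevN ((c k).bandit.block + 1) (k + 1) = ∅ := by
            ext j
            simp only [mem_blockVisits, Finset.notMem_empty, iff_false, not_and]
            intro hj _ hP hblock
            have := hle j hj hP
            omega
          refine ⟨hlead, ?_, ?_, ?_, ?_, ?_⟩
          · intro a'
            rw [hP', hb', hempty, Finset.sum_empty]
          · rw [hP', hb', hempty, Finset.card_empty]
          · rw [hb']
            positivity
          · rw [hN', hb', ih.N_eq, pow_succ]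
            dsimp only
            omega
          · intro j hj hP
            rw [hP'] at hP
            rw [hb']
            exact (hle j hj hP).trans (Nat.le_succ _)
        · rw [BanditState.update, if_neg hu] at hb'
          refine ⟨hlead, ?_, ?_, ?_, ?_, ?_⟩
          · intro a'
            rw [hP', hb', hself, Finset.sum_insert self_notMem_blockVisits]
            simp only [ih.loss a']
            rw [add_comm, lossEst]
          · rw [hP', hb', hself, Finset.card_insert_of_notMem self_notMem_blockVisits, ih.used]
          · rw [hb']
            exact lt_of_le_of_ne ih.used_lt hu
          · rw [hN', hb', ih.N_eq]
            ring
          · intro j hj hP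
            rw [hP'] at hP
            rw [hb']
            exact hle j hj hP
    · have hck := hc.skip k hv
      have hin : ∀ P i, blockVisits c vis P i (k + 1) = blockVisits c vis P i k := fun P i =>
        blockVisits_succ_of_not fun h => hv h.1
      refine ⟨?_, ?_, ?_, ?_, ?_, ?_⟩
      · rw [hck]
        exact ih.leader
      · simpa only [hin, hck] using ih.loss
      · simpa only [hin, hck] using ih.used
      · rw [hck]
        exact ih.used_lt
      · rw [hck]
        exact ih.N_eq
      · intro j hj hP
        rw [hck] at hP ⊢
        rcases Nat.lt_succ_iff_lt_or_eq.1 hj with h | h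
        · exact ih.mono j h hP
        · rw [h]

theorem IsCellRun.card_blockVisits_le (hc : IsCellRun T hX H h c vis a y) (hη : 0 < T.eta)
    (hlr : 0 < T.lrConst) (P i k : ℕ) : (blockVisits c vis P i k).card ≤ 2 ^ i := by
  classical
  induction k with
  | zero => simp [blockVisits_zero]
  | succ k ih =>
    by_cases hk : vis k ∧ (c k).prevN = P ∧ (c k).bandit.block = i
    · obtain ⟨hv, rfl, rfl⟩ := hk
      have hI := hc.blockInv hη hlr k
      rw [blockVisits_succ_self hv, Finset.card_insert_of_notMem self_notMem_blockVisits, hI.used]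
      exact hI.used_lt
    · rwa [blockVisits_succ_of_not hk]

end CellRun

/-! ### Regret of the bandit instance of a cell -/

section CellBounds

variable {A : Type*} {X : Finset A} {T : Tuning} {hX : X.Nonempty} {H h : ℕ} {c : ℕ → Cell X}
  {vis : ℕ → Prop} {a : ℕ → A} {y : ℕ → ℝ}

theorem lossEst_nonneg (hy : ∀ j, y j / H ≤ 1) (hix : ∀ i, 0 < ixParam T X.card i) (j : ℕ)
    (a' : A) : 0 ≤ lossEst T H c a y j a' := by
  unfold lossEst
  split_ifs
  · exact div_nonneg (by linarith [hy j]) (add_nonneg ((c j).pol.2.1 _) (hix _).le)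
  · exact le_rfl

theorem lossEst_self (j : ℕ) : lossEst T H c a y j (a j) =
    (1 - y j / H) / ((c j).pol.1 (a j) + ixParam T X.card (c j).bandit.block) :=
  if_pos rfl

/-- Telescoping of the FTRL potential over the visits in a block. -/
theorem IsCellRun.sum_blockVisits_le_potential (hc : IsCellRun T hX H h c vis a y)
    (hη : 0 < T.eta) (hlr : 0 < T.lrConst) (hix : ∀ i, 0 < ixParam T X.card i)
    (hy : ∀ j, y j / H ≤ 1) (P i k : ℕ) :
    ∑ j ∈ blockVisits c vis P i k, ∑ a' ∈ X, ((c j).pol.1 a' * lossEst T H c a y j a' -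
        learningRate T i * ((c j).pol.1 a' * √((c j).pol.1 a')) * lossEst T H c a y j a' ^ 2) ≤
      ftrlPotential X hX (learningRate T i)
        (fun a' => ∑ j ∈ blockVisits c vis P i k, lossEst T H c a y j a') -
      ftrlPotential X hX (learningRate T i) (fun _ => 0) := by
  induction k with
  | zero => simp [blockVisits_zero]
  | succ k ih =>
    by_cases hk : vis k ∧ (c k).prevN = P ∧ (c k).bandit.block = i
    · obtain ⟨hv, rfl, rfl⟩ := hk
      have hI := hc.blockInv hη hlr k
      have h1 := hI.leader.potential_add_ge hX (learningRate_pos hlr _)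
        (lossEst_nonneg (c := c) (a := a) hy hix k)
      rw [funext hI.loss] at h1
      rw [blockVisits_succ_self hv]
      simp only [Finset.sum_insert self_notMem_blockVisits]
      simp only [add_comm (lossEst T H c a y k _)]
      linarith
    · rwa [blockVisits_succ_of_not hk]

/-- Regret of the visits in a block, in terms of the estimated losses of the comparator `q` and of
the played actions. The term with `ixParam` is the bias of the estimates: at the played action
`p e = l - γ e`, where `e` is the estimate of the loss `l`. -/
theorem IsCellRun.sum_blockVisits_loss_le (hc : IsCellRun T hX H h c vis a y)
    (hη : 0 < T.eta) (hlr : 0 < T.lrConst) (hix : ∀ i, 0 < ixParam T X.card i)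
    (hy0 : ∀ j, 0 ≤ y j / H) (hy : ∀ j, y j / H ≤ 1) (P i k : ℕ) (ha : ∀ j < k, vis j → a j ∈ X)
    (q : Dist X) :
    ∑ j ∈ blockVisits c vis P i k, (1 - y j / H) ≤
      ∑ j ∈ blockVisits c vis P i k, ∑ a' ∈ X, q.1 a' * lossEst T H c a y j a' +
      ∑ j ∈ blockVisits c vis P i k, (ixParam T X.card i + learningRate T i *
        √((c j).pol.1 (a j))) * lossEst T H c a y j (a j) +
      2 / learningRate T i * √X.card := by
  have hl := learningRate_pos hlr i
  have h1 := hc.sum_blockVisits_le_potential hη hlr hix hy P i k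
  have h2 := ftrlPotential_le hX hl (fun a' => ∑ j ∈ blockVisits c vis P i k,
    lossEst T H c a y j a') q
  have h3 := ftrlPotential_zero_ge hX hl
  have h4 : ∑ a' ∈ X, q.1 a' * ∑ j ∈ blockVisits c vis P i k, lossEst T H c a y j a' =
      ∑ j ∈ blockVisits c vis P i k, ∑ a' ∈ X, q.1 a' * lossEst T H c a y j a' := by
    simp only [Finset.mul_sum]
    exact Finset.sum_comm
  have h5 : ∑ j ∈ blockVisits c vis P i k, ((1 - y j / H) - (ixParam T X.card i +
      learningRate T i * √((c j).pol.1 (a j))) * lossEst T H c a y j (a j)) ≤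
      ∑ j ∈ blockVisits c vis P i k, ∑ a' ∈ X, ((c j).pol.1 a' * lossEst T H c a y j a' -
        learningRate T i * ((c j).pol.1 a' * √((c j).pol.1 a')) *
          lossEst T H c a y j a' ^ 2) := by
    refine Finset.sum_le_sum fun j hj => ?_
    obtain ⟨hjk, hv, -, hb⟩ := mem_blockVisits.1 hj
    have hle := (c j).pol.2.1 (a j)
    have hg := hix i
    rw [Finset.sum_eq_single_of_mem (a j) (ha j hjk hv) fun b _ hb => by
      rw [lossEst, if_neg hb]
      ring, lossEst_self, hb]
    obtain ⟨p, hp⟩ : ∃ p, p = (c j).pol.1 (a j) := ⟨_, rfl⟩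
    obtain ⟨l, hl'⟩ : ∃ l, l = 1 - y j / H := ⟨_, rfl⟩
    rw [← hp, ← hl']
    rw [← hp] at hle
    have hl0 : 0 ≤ l := by linarith [hy j]
    have hl1 : l ≤ 1 := by linarith [hy0 j]
    have hs := Real.sqrt_nonneg p
    set γ := ixParam T X.card i
    have hpg : 0 < p + γ := by linarith
    set e := l / (p + γ) with he
    have he0 : 0 ≤ e := div_nonneg hl0 hpg.le
    have h6 : p * e + γ * e = l := by
      rw [he]
      field_simp
    have h7 : p * e ≤ 1 := by nlinarith [mul_nonneg hg.le he0]
    have h8 : learningRate T i * (p * √p) * e ^ 2 ≤ learningRate T i * √p * e := by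
      have := mul_le_mul_of_nonneg_left h7 (mul_nonneg (mul_nonneg hl.le hs) he0)
      linarith
    linarith
  rw [Finset.sum_sub_distrib] at h5
  linarith

/-! ### Decomposition of the visits of a cell into epochs and blocks -/

theorem IsCellRun.two_pow_block_le (hc : IsCellRun T hX H h c vis a y) (hη : 0 < T.eta)
    (hlr : 0 < T.lrConst) {τ j K : ℕ} (hj : j ∈ epochVisits c vis (epochLen T.eta τ) K) :
    2 ^ (c j).bandit.block ≤ epochLen T.eta (τ + 1) ∧ 2 ^ (c j).bandit.block ≤ K := by
  obtain ⟨hjK, -, hP⟩ := mem_epochVisits.1 hj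
  obtain ⟨σ, hE⟩ := hc.exists_epochInv hη j
  obtain rfl : σ = τ := (epochLen_strictMono hη).injective (hE.prevN.symm.trans hP)
  have h1 := (hc.blockInv hη hlr j).N_eq
  have h2 := hE.N_lt
  have h3 : (c j).N ≤ j := hE.card ▸ card_epochVisits_le _ _
  omega

theorem sum_sqrt_two_pow_le (m : ℕ) :
    ∑ i ∈ Finset.range (m + 1), √((2 : ℝ) ^ i) ≤ 4 * √((2 : ℝ) ^ m) := by
  induction m with
  | zero => norm_num
  | succ m ih =>
    rw [Finset.sum_range_succ, pow_succ, Real.sqrt_mul (by positivity)]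
    have h1 : (4 : ℝ) / 3 ≤ √2 := Real.le_sqrt_of_sq_le (by norm_num)
    nlinarith [Real.sqrt_nonneg ((2 : ℝ) ^ m)]

/-- Bounds on the blocks of the doubling trick add up geometrically over an epoch. -/
theorem IsCellRun.sum_epochVisits_le_of_block (hc : IsCellRun T hX H h c vis a y)
    (hη : 0 < T.eta) (hlr : 0 < T.lrConst) {K : ℕ} (hK : K ≠ 0) (τ : ℕ) {f : ℕ → ℝ} {C : ℝ}
    (hC : 0 ≤ C)
    (hf : ∀ i ≤ Nat.log 2 K,
      ∑ j ∈ blockVisits c vis (epochLen T.eta τ) i K, f j ≤ C * √((2 : ℝ) ^ i)) :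
    ∑ j ∈ epochVisits c vis (epochLen T.eta τ) K, f j ≤ 4 * C * √(epochLen T.eta (τ + 1)) := by
  classical
  set L := epochLen T.eta (τ + 1) with hL
  have hL0 : L ≠ 0 := Nat.one_le_iff_ne_zero.1 (one_le_epochLen hη _)
  set m := min (Nat.log 2 L) (Nat.log 2 K) with hm
  have hmap : ∀ j ∈ epochVisits c vis (epochLen T.eta τ) K,
      (c j).bandit.block ∈ Finset.range (m + 1) := by
    intro j hj
    have h1 := hc.two_pow_block_le hη hlr hj
    rw [Finset.mem_range, Nat.lt_succ_iff, hm, le_min_iff]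
    exact ⟨(Nat.le_log_iff_pow_le (by norm_num) hL0).2 h1.1,
      (Nat.le_log_iff_pow_le (by norm_num) hK).2 h1.2⟩
  rw [← Finset.sum_fiberwise_of_maps_to hmap]
  have h2 : ∀ i ∈ Finset.range (m + 1),
      ∑ j ∈ epochVisits c vis (epochLen T.eta τ) K with (c j).bandit.block = i, f j ≤
        C * √((2 : ℝ) ^ i) := by
    intro i hi
    refine le_trans (le_of_eq ?_) (hf i ?_)
    · refine Finset.sum_congr ?_ fun _ _ => rfl
      ext j
      simp only [Finset.mem_filter, mem_epochVisits, mem_blockVisits]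
      tauto
    · exact (Nat.lt_succ_iff.1 (Finset.mem_range.1 hi)).trans (min_le_right _ _)
  refine (Finset.sum_le_sum h2).trans ?_
  rw [← Finset.mul_sum]
  have h3 : (2 : ℝ) ^ m ≤ L := by
    have h4 : 2 ^ m ≤ L :=
      (Nat.pow_le_pow_right (by norm_num) (min_le_left _ _)).trans (Nat.pow_log_le_self 2 hL0)
    exact_mod_cast h4
  calc C * ∑ i ∈ Finset.range (m + 1), √((2 : ℝ) ^ i) ≤ C * (4 * √L) :=
        mul_le_mul_of_nonneg_left ((sum_sqrt_two_pow_le m).trans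
          (mul_le_mul_of_nonneg_left (Real.sqrt_le_sqrt h3) (by norm_num))) hC
    _ = 4 * C * √L := by ring

open Classical in
/-- The visits of a cell before episode `K`. -/
def cellVisits (vis : ℕ → Prop) (K : ℕ) : Finset ℕ := (Finset.range K).filter vis

theorem mem_cellVisits {K j : ℕ} : j ∈ cellVisits vis K ↔ j < K ∧ vis j := by
  simp [cellVisits]

theorem IsCellRun.prevN_mono (hc : IsCellRun T hX H h c vis a y) (hη : 0 < T.eta) {j k : ℕ}
    (hjk : j ≤ k) : (c j).prevN ≤ (c k).prevN := by
  rcases hjk.lt_or_eq with hlt | rfl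
  · obtain ⟨τ, hE⟩ := hc.exists_epochInv hη k
    exact hE.mono j hlt
  · exact le_rfl

theorem IsCellRun.sum_cellVisits (hc : IsCellRun T hX H h c vis a y) (hη : 0 < T.eta) {K t : ℕ}
    (hE : EpochInv T H h c vis y K t) (f : ℕ → ℝ) :
    ∑ j ∈ cellVisits vis K, f j =
      ∑ τ ∈ Finset.range (t + 1), ∑ j ∈ epochVisits c vis (epochLen T.eta τ) K, f j := by
  classical
  have hmono := epochLen_strictMono hη
  have hdis : Set.PairwiseDisjoint (↑(Finset.range (t + 1)))
      fun τ => epochVisits c vis (epochLen T.eta τ) K := by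
    intro σ _ τ _ hne
    refine Finset.disjoint_left.2 fun j h1 h2 => hne (hmono.injective ?_)
    rw [← (mem_epochVisits.1 h1).2.2, (mem_epochVisits.1 h2).2.2]
  rw [← Finset.sum_biUnion hdis]
  refine Finset.sum_congr ?_ fun _ _ => rfl
  ext j
  simp only [Finset.mem_biUnion, Finset.mem_range, mem_epochVisits, mem_cellVisits]
  constructor
  · rintro ⟨hj, hv⟩
    obtain ⟨τ, hτ⟩ := hc.exists_epochInv hη j
    refine ⟨τ, ?_, hj, hv, hτ.prevN⟩
    have h1 := hE.mono j hj
    rw [hτ.prevN, hE.prevN] at h1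
    exact Nat.lt_succ_iff.2 (hmono.le_iff_le.1 h1)
  · rintro ⟨τ, -, hj, hv, -⟩
    exact ⟨hj, hv⟩

/-- Visits in a past epoch are not added to. -/
theorem IsCellRun.epochVisits_eq_of_lt (hc : IsCellRun T hX H h c vis a y) (hη : 0 < T.eta)
    {P k K : ℕ} (hkK : k ≤ K) (hP : P < (c k).prevN) :
    epochVisits c vis P k = epochVisits c vis P K := by
  ext j
  simp only [mem_epochVisits]
  constructor
  · rintro ⟨h1, h2⟩
    exact ⟨h1.trans_le hkK, h2⟩
  · rintro ⟨h1, h2, h3⟩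
    refine ⟨?_, h2, h3⟩
    by_contra hj
    have := hc.prevN_mono hη (not_lt.1 hj)
    omega

theorem EpochInv.epochLen_le {K t : ℕ} (hK : 1 ≤ K) (hE : EpochInv T H h c vis y K t) :
    epochLen T.eta t ≤ K := by
  cases t with
  | zero => exact hK
  | succ t =>
    rw [← hE.card_past t (Nat.lt_succ_self t)]
    exact card_epochVisits_le _ _

/-- The number of epochs that a cell completes in `K` episodes. -/
theorem EpochInv.le_epochBound {K t : ℕ} (hη : 0 < T.eta) (hK : 1 ≤ K)
    (hE : EpochInv T H h c vis y K t) : t ≤ epochBound K T.eta := by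
  have h1 : (1 + T.eta) ^ t ≤ (K : ℝ) :=
    (one_add_pow_le_epochLen hη t).trans (by exact_mod_cast hE.epochLen_le hK)
  have h2 := Real.log_le_log (by positivity) h1
  rw [Real.log_pow] at h2
  have h3 : T.eta / (1 + T.eta) ≤ Real.log (1 + T.eta) := by
    have := Real.one_sub_inv_le_log_of_pos (by linarith : 0 < 1 + T.eta)
    refine le_trans (le_of_eq ?_) this
    field_simp
    ring
  have h4 : (t : ℝ) ≤ (1 + T.eta) * Real.log K / T.eta := by
    rw [le_div_iff₀ hη]
    have h5 := (mul_le_mul_of_nonneg_left h3 (Nat.cast_nonneg t)).trans h2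
    have h6 := mul_le_mul_of_nonneg_left h5 (by linarith : 0 ≤ 1 + T.eta)
    refine le_trans (le_of_eq ?_) h6
    field_simp
  exact_mod_cast h4.trans (Nat.le_ceil _)

theorem IsCellRun.sum_sqrt_epochLen_le (hc : IsCellRun T hX H h c vis a y) (hη : 0 < T.eta)
    (hη1 : T.eta ≤ 1) {K t : ℕ} (hE : EpochInv T H h c vis y K t) :
    ∑ τ ∈ Finset.range (t + 1), √(epochLen T.eta (τ + 1)) ≤
      √((t + 1) * (3 * (cellVisits vis K).card + 2)) := by
  apply Real.le_sqrt_of_sq_le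
  refine sq_sum_le_card_mul_sum_sq.trans ?_
  rw [Finset.card_range]
  push_cast
  refine mul_le_mul_of_nonneg_left ?_ (by positivity)
  simp only [Real.sq_sqrt (Nat.cast_nonneg _)]
  have h1 := hc.sum_cellVisits hη hE fun _ => 1
  simp only [Finset.sum_const, nsmul_eq_mul, mul_one] at h1
  rw [Finset.sum_range_succ] at h1 ⊢
  have h2 : ∀ τ ∈ Finset.range t, ((epochVisits c vis (epochLen T.eta τ) K).card : ℝ) =
      epochLen T.eta (τ + 1) := fun τ hτ => by
    rw [hE.card_past τ (Finset.mem_range.1 hτ)]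
  rw [Finset.sum_congr rfl h2] at h1
  have h3 : (epochLen T.eta (t + 1) : ℝ) ≤ 2 * epochLen T.eta t := by
    exact_mod_cast epochLen_succ_le_two_mul hη1 t
  have h4 : (epochLen T.eta t : ℝ) ≤ (cellVisits vis K).card + 1 := by
    cases t with
    | zero =>
      simp only [epochLen, Nat.cast_one]
      linarith [(Nat.cast_nonneg (cellVisits vis K).card : (0 : ℝ) ≤ _)]
    | succ t =>
      rw [Finset.sum_range_succ] at h1
      have : (0 : ℝ) ≤ ∑ τ ∈ Finset.range t, (epochLen T.eta (τ + 1) : ℝ) :=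
        Finset.sum_nonneg fun _ _ => Nat.cast_nonneg _
      have : (0 : ℝ) ≤ ((epochVisits c vis (epochLen T.eta (t + 1)) K).card : ℝ) :=
        Nat.cast_nonneg _
      linarith
  have h5 : (0 : ℝ) ≤ ((epochVisits c vis (epochLen T.eta t) K).card : ℝ) := Nat.cast_nonneg _
  linarith

/-! ### Errors of the estimates of a cell -/

/-- Transfer from an epoch with `L` visits to the next one, with `w * L` visits: `D`, `G` and `U`
are the sums over the epoch of the errors at the next step, of the losses relative to the Nash
value and of the distances of the opponent from the minimax policy. When `w ≤ 1` the bandit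
guarantee `G - D ≤ b` is used, and otherwise the bound `-G ≤ H U + b`. -/
theorem epoch_transfer {w η L D G U b Hr : ℝ} (hw0 : 0 ≤ w) (hw2 : w ≤ 2)
    (hw : w ≤ 1 + η + 1 / L) (hη : 0 ≤ η) (hL : 0 < L) (hD0 : 0 ≤ D) (hD : D ≤ Hr * L)
    (hU0 : 0 ≤ U) (hU : U ≤ L) (hH0 : 0 ≤ Hr) (hHb : Hr ≤ b) (h1 : G - D ≤ b)
    (h2 : -G ≤ Hr * U + b) : w * (D - G) + G ≤ (1 + η) * D + η * Hr * U + 3 * b := by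
  have hb : 0 ≤ b := hH0.trans hHb
  rcases le_total w 1 with h | h
  · have h3 := mul_le_mul_of_nonneg_left h1 (sub_nonneg.2 h)
    have h4 : (1 - w) * b ≤ b := by nlinarith
    have h5 : 0 ≤ η * D := mul_nonneg hη hD0
    have h6 : 0 ≤ η * Hr * U := mul_nonneg (mul_nonneg hη hH0) hU0
    linarith
  · have h3 := mul_le_mul_of_nonneg_left h2 (sub_nonneg.2 h)
    have h4 : w * D ≤ (1 + η) * D + Hr := by
      have h5 := mul_le_mul_of_nonneg_right hw hD0
      have h6 : 1 / L * D ≤ Hr := by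
        rw [one_div, inv_mul_le_iff₀ hL]
        linarith
      linarith
    have h5 : (w - 1) * (Hr * U) ≤ η * Hr * U + Hr := by
      have h6 := mul_le_mul_of_nonneg_right (by linarith : w - 1 ≤ η + 1 / L)
        (mul_nonneg hH0 hU0)
      have h7 : 1 / L * (Hr * U) ≤ Hr := by
        rw [one_div, inv_mul_le_iff₀ hL]
        nlinarith
      linarith
    have h6 : (w - 1) * b ≤ b := by nlinarith
    linarith

/-- Total error of the estimates used at the visits of a cell. The loss `G` relative to the
reference value `Vs` and the error `D` at the next step satisfy `y = Vs - G + D`; adding the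
losses on the left allows the incomplete last epochs to be paid for by the bandit guarantee. -/
theorem IsCellRun.sum_error_le (hc : IsCellRun T hX H h c vis a y) (hη : 0 < T.eta)
    (hη1 : T.eta ≤ 1) (hι : 0 ≤ T.iota) {K t : ℕ} (hE : EpochInv T H h c vis y K t)
    {Vs e : ℝ} {D G U : ℕ → ℝ} (hVs0 : 0 ≤ Vs)
    (hy : ∀ j ∈ cellVisits vis K, y j = Vs - G j + D j)
    (hD0 : ∀ j ∈ cellVisits vis K, 0 ≤ D j) (hD1 : ∀ j ∈ cellVisits vis K, D j ≤ H)
    (hU0 : ∀ j ∈ cellVisits vis K, 0 ≤ U j) (hU1 : ∀ j ∈ cellVisits vis K, U j ≤ 1)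
    (hιe : √T.iota ≤ e) (hHe : (H : ℝ) ≤ e)
    (hreg : ∀ τ ≤ t, ∑ j ∈ epochVisits c vis (epochLen T.eta τ) K, (Vs - y j) ≤
      e * √(epochLen T.eta (τ + 1)))
    (hmart : ∀ τ ≤ t, ∑ j ∈ epochVisits c vis (epochLen T.eta τ) K, (-G j - H * U j) ≤
      e * √(epochLen T.eta (τ + 1))) :
    ∑ j ∈ cellVisits vis K, ((c j).V - Vs + G j) ≤
      (1 + T.eta) * ∑ j ∈ cellVisits vis K, D j + T.eta * H * ∑ j ∈ cellVisits vis K, U j +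
      5 * e * ∑ τ ∈ Finset.range (t + 1), √(epochLen T.eta (τ + 1)) := by
  have hmono := epochLen_strictMono hη
  have he0 : 0 ≤ e := (Nat.cast_nonneg H).trans hHe
  have hsub : ∀ τ, epochVisits c vis (epochLen T.eta τ) K ⊆ cellVisits vis K := fun τ j hj =>
    mem_cellVisits.2 ⟨(mem_epochVisits.1 hj).1, (mem_epochVisits.1 hj).2.1⟩
  set E := fun τ => epochVisits c vis (epochLen T.eta τ) K with hEdef
  set L := fun τ => (epochLen T.eta (τ + 1) : ℝ) with hLdef
  have hL1 : ∀ τ, 1 ≤ L τ := fun τ => by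
    simp only [hLdef]
    exact_mod_cast one_le_epochLen hη _
  set SD := fun τ => ∑ j ∈ E τ, D j with hSD
  set SG := fun τ => ∑ j ∈ E τ, G j with hSG
  set SU := fun τ => ∑ j ∈ E τ, U j with hSU
  set b := fun τ => e * √(L τ) with hb
  have hcard : ∀ τ ≤ t, ((E τ).card : ℝ) ≤ L τ := by
    intro τ hτ
    rcases hτ.lt_or_eq with h | h
    · simp only [hEdef, hLdef]
      exact_mod_cast (hE.card_past τ h).le
    · rw [h]
      have h1 := hE.card
      have h2 := hE.N_lt
      simp only [hEdef, hLdef]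
      rw [h1]
      exact_mod_cast h2.le
  have hSD0 : ∀ τ, 0 ≤ SD τ := fun τ => Finset.sum_nonneg fun j hj => hD0 j (hsub τ hj)
  have hSU0 : ∀ τ, 0 ≤ SU τ := fun τ => Finset.sum_nonneg fun j hj => hU0 j (hsub τ hj)
  have hSD1 : ∀ τ ≤ t, SD τ ≤ H * L τ := fun τ hτ => by
    have h1 : SD τ ≤ ∑ j ∈ E τ, (H : ℝ) := Finset.sum_le_sum fun j hj => hD1 j (hsub τ hj)
    rw [Finset.sum_const, nsmul_eq_mul, mul_comm] at h1
    exact h1.trans (mul_le_mul_of_nonneg_left (hcard τ hτ) (Nat.cast_nonneg H))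
  have hSU1 : ∀ τ ≤ t, SU τ ≤ L τ := fun τ hτ => by
    have h1 : SU τ ≤ ∑ j ∈ E τ, (1 : ℝ) := Finset.sum_le_sum fun j hj => hU1 j (hsub τ hj)
    rw [Finset.sum_const, nsmul_eq_mul, mul_one] at h1
    exact h1.trans (hcard τ hτ)
  have hb1 : ∀ τ, e ≤ b τ := fun τ =>
    le_mul_of_one_le_right he0 (Real.one_le_sqrt.2 (hL1 τ))
  have hVy : ∀ τ, ∑ j ∈ E τ, (Vs - y j) = SG τ - SD τ := fun τ => by
    rw [← Finset.sum_sub_distrib]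
    refine Finset.sum_congr rfl fun j hj => ?_
    rw [hy j (hsub τ hj)]
    ring
  have hreg' : ∀ τ ≤ t, SG τ - SD τ ≤ b τ := fun τ hτ => hVy τ ▸ hreg τ hτ
  have hmart' : ∀ τ ≤ t, -SG τ ≤ H * SU τ + b τ := fun τ hτ => by
    have h1 := hmart τ hτ
    rw [Finset.sum_sub_distrib, Finset.sum_neg_distrib, ← Finset.mul_sum] at h1
    simp only [hSG, hSU, hb, hEdef, hLdef]
    linarith
  -- In the first epoch the estimates are the initial ones.
  have hfirst : ∑ j ∈ E 0, ((c j).V - Vs) ≤ 2 * b 0 := by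
    have h1 : ∑ j ∈ E 0, ((c j).V - Vs) ≤ ∑ j ∈ E 0, (H : ℝ) := by
      refine Finset.sum_le_sum fun j hj => ?_
      obtain ⟨τ, hτ⟩ := hc.exists_epochInv hη j
      have h2 : τ = 0 := hmono.injective (hτ.prevN.symm.trans (mem_epochVisits.1 hj).2.2)
      rw [hτ.V_zero h2]
      linarith [(Nat.cast_nonneg h : (0 : ℝ) ≤ h)]
    have h2 : L 0 ≤ 2 := by
      have := epochLen_succ_le_two_mul hη1 0
      simp only [epochLen, hLdef] at this ⊢
      exact_mod_cast this
    rw [Finset.sum_const, nsmul_eq_mul] at h1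
    have h3 := (hcard 0 (Nat.zero_le t)).trans h2
    have h4 := hb1 0
    nlinarith [(Nat.cast_nonneg H : (0 : ℝ) ≤ H)]
  have hnext : ∀ τ < t, ∑ j ∈ E (τ + 1), ((c j).V - Vs) ≤
      (E (τ + 1)).card / L τ * (SD τ - SG τ) + 2 * b τ := by
    intro τ hτ
    have hL0 : 0 < L τ := by linarith [hL1 τ]
    have h1 : ∑ j ∈ E (τ + 1), ((c j).V - Vs) ≤
        ∑ j ∈ E (τ + 1), ((SD τ - SG τ) / L τ + √(T.iota / L τ)) := by
      refine Finset.sum_le_sum fun j hj => ?_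
      obtain ⟨hjK, -, hP⟩ := mem_epochVisits.1 hj
      obtain ⟨σ, hσ⟩ := hc.exists_epochInv hη j
      have h2 : σ = τ + 1 := hmono.injective (hσ.prevN.symm.trans hP)
      have h3 := hσ.V_succ τ h2
      rw [hc.epochVisits_eq_of_lt hη hjK.le (hP ▸ hmono (Nat.lt_succ_self τ))] at h3
      have h4 := h3.trans_le (min_le_right _ _)
      have h5 : (∑ i ∈ E τ, y i) / L τ - Vs = (SD τ - SG τ) / L τ := by
        have h6 := hVy τ
        rw [Finset.sum_sub_distrib, Finset.sum_const, nsmul_eq_mul] at h6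
        have h7 : ((E τ).card : ℝ) = L τ := by
          simp only [hEdef, hLdef]
          exact_mod_cast hE.card_past τ hτ
        rw [h7] at h6
        field_simp
        linarith
      linarith
    refine h1.trans ?_
    rw [Finset.sum_const, nsmul_eq_mul, mul_add]
    have h2 : ((E (τ + 1)).card : ℝ) ≤ 2 * L τ := by
      refine (hcard (τ + 1) hτ).trans ?_
      simp only [hLdef]
      exact_mod_cast epochLen_succ_le_two_mul hη1 (τ + 1)
    have h3 : ((E (τ + 1)).card : ℝ) * √(T.iota / L τ) ≤ 2 * b τ := by
      refine (mul_le_mul_of_nonneg_right h2 (Real.sqrt_nonneg _)).trans ?_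
      rw [Real.sqrt_div hι]
      have h4 : 2 * L τ * (√T.iota / √(L τ)) = 2 * (√T.iota * √(L τ)) := by
        have h5 : 0 < √(L τ) := Real.sqrt_pos.2 hL0
        have h6 : √(L τ) * √(L τ) = L τ := Real.mul_self_sqrt hL0.le
        field_simp
        linear_combination √T.iota * (-1) * h6
      rw [h4]
      exact mul_le_mul_of_nonneg_left
        (mul_le_mul_of_nonneg_right hιe (Real.sqrt_nonneg _)) (by norm_num)
    have h4 : ((E (τ + 1)).card : ℝ) * ((SD τ - SG τ) / L τ) =
        (E (τ + 1)).card / L τ * (SD τ - SG τ) := by ring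
    linarith
  have hstep : ∀ τ < t, ∑ j ∈ E (τ + 1), ((c j).V - Vs) + SG τ ≤
      (1 + T.eta) * SD τ + T.eta * H * SU τ + 5 * b τ := by
    intro τ hτ
    have hL0 : 0 < L τ := by linarith [hL1 τ]
    have h1 : ((E (τ + 1)).card : ℝ) ≤ (1 + T.eta) * L τ + 1 :=
      (hcard (τ + 1) hτ).trans (epochLen_succ_le_mul _ hη _)
    have h2 : ((E (τ + 1)).card : ℝ) ≤ 2 * L τ := by
      refine (hcard (τ + 1) hτ).trans ?_
      simp only [hLdef]
      exact_mod_cast epochLen_succ_le_two_mul hη1 (τ + 1)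
    have h3 := epoch_transfer (w := (E (τ + 1)).card / L τ) (η := T.eta) (L := L τ)
      (D := SD τ) (G := SG τ) (U := SU τ) (b := b τ) (Hr := H) (by positivity)
      (by rwa [div_le_iff₀ hL0])
      (by rw [div_le_iff₀ hL0, add_mul, one_div, inv_mul_cancel₀ hL0.ne']; exact h1)
      hη.le hL0 (hSD0 τ) (hSD1 τ hτ.le) (hSU0 τ) (hSU1 τ hτ.le) (Nat.cast_nonneg H)
      (hHe.trans (hb1 τ)) (hreg' τ hτ.le) (hmart' τ hτ.le)
    have h4 := hnext τ hτ
    linarith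
  have hsumeq : ∑ j ∈ cellVisits vis K, ((c j).V - Vs + G j) =
      ∑ j ∈ E 0, ((c j).V - Vs) +
        ∑ τ ∈ Finset.range t, (∑ j ∈ E (τ + 1), ((c j).V - Vs) + SG τ) + SG t := by
    rw [Finset.sum_add_distrib, hc.sum_cellVisits hη hE, hc.sum_cellVisits hη hE,
      Finset.sum_range_succ', Finset.sum_range_succ, Finset.sum_add_distrib]
    ring
  rw [hsumeq, Finset.sum_add_distrib, hc.sum_cellVisits hη hE D, hc.sum_cellVisits hη hE U]
  have h1 := Finset.sum_le_sum fun τ hτ => hstep τ (Finset.mem_range.1 hτ)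
  simp only [Finset.sum_add_distrib, ← Finset.mul_sum] at h1
  have h2 := hreg' t le_rfl
  have h3 : 2 * b 0 + (5 * ∑ τ ∈ Finset.range t, b τ + b t) ≤
      5 * ∑ τ ∈ Finset.range (t + 1), b τ := by
    have hbn : ∀ τ, 0 ≤ b τ := fun τ => he0.trans (hb1 τ)
    have h4 : 2 * b 0 ≤ 4 * b t := by
      have h5 : b 0 ≤ b t := by
        refine mul_le_mul_of_nonneg_left (Real.sqrt_le_sqrt ?_) he0
        simp only [hLdef]
        exact_mod_cast hmono.monotone (Nat.succ_le_succ (Nat.zero_le t))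
      linarith [hbn t]
    rw [Finset.sum_range_succ]
    linarith
  have h4 : 5 * e * ∑ τ ∈ Finset.range (t + 1), √(L τ) =
      5 * ∑ τ ∈ Finset.range (t + 1), b τ := by
    simp only [hb, ← Finset.mul_sum]
    ring
  simp only [hLdef] at h4
  rw [h4, Finset.sum_range_succ _ t, Finset.sum_range_succ _ t]
  have h5 : SD t ≤ (1 + T.eta) * SD t := by nlinarith [hSD0 t]
  have h6 : 0 ≤ T.eta * H * SU t := by
    have := hSU0 t
    positivity
  simp only [hSD, hSU, hEdef] at hfirst h1 h2 h5 h6 ⊢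
  rw [mul_add, mul_add]
  linarith

end CellBounds

/-! ### Range of the estimates -/

section Memory

variable {S A B : Type*} {H : ℕ} (M : MarkovGame S A B H)

theorem MarkovGame.memory_mem (T : Tuning) : ∀ (k : ℕ) (ω : Fin k → Episode S A B H) (h : ℕ)
    (s : S), h ≤ H → 0 ≤ (M.memory T k ω h s).V ∧ (M.memory T k ω h s).V ≤ (H : ℝ) - h ∧
      0 ≤ (M.memory T k ω h s).total
  | 0, ω, h, s => by
    intro hh
    have : (h : ℝ) ≤ H := by exact_mod_cast hh
    simp only [MarkovGame.memory, MarkovGame.initMemory]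
    exact ⟨by linarith, le_rfl, le_rfl⟩
  | k + 1, ω, h, s => by
    intro hh
    have hh' : (h : ℝ) ≤ H := by exact_mod_cast hh
    have ih := MarkovGame.memory_mem T k (Fin.init ω)
    simp only [MarkovGame.memory, MarkovGame.update]
    split_ifs with h1 h2
    · have hr := (M.reward_mem h s (ω (Fin.last k) ⟨h, h1⟩).2.1 (ω (Fin.last k) ⟨h, h1⟩).2.2.1).1
      have hV := (ih (h + 1) (ω (Fin.last k) ⟨h, h1⟩).2.2.2 h1).1
      obtain ⟨i1, i2, i3⟩ := ih h s hh
      simp only [Cell.visit]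
      split_ifs
      · refine ⟨le_min (by linarith) ?_, min_le_left _ _, le_rfl⟩
        exact add_nonneg (div_nonneg (add_nonneg i3 (add_nonneg hr hV)) (Nat.cast_nonneg _))
          (Real.sqrt_nonneg _)
      · exact ⟨i1, i2, add_nonneg i3 (add_nonneg hr hV)⟩
    · exact ih h s hh
    · exact ih h s hh

theorem MarkovGame.memory_terminal (T : Tuning) (k : ℕ) (ω : Fin k → Episode S A B H) (s : S) :
    (M.memory T k ω H s).V = 0 := by
  have h1 := M.memory_mem T k ω H s le_rfl
  rw [sub_self] at h1
  exact le_antisymm h1.2.1 h1.1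

end Memory

/-! ### Exponential supermartingales along a run -/

section Tests

variable {S A B : Type*} {H : ℕ} (M : MarkovGame S A B H)

open Classical in
/-- Increment of a process that moves, by `φ`, only at the visits to `(h, s)`; `φ` depends on the
memory and on the opponent's policy in the episode, and on the outcome of the step. -/
def MarkovGame.visitIncr (T : Tuning) (ν : ℕ → M.OppPolicy) (h : Fin H) (s : S)
    (φ : M.Memory → M.OppPolicy → A × B × S → ℝ) (k : ℕ) (ω : Fin k → Episode S A B H)
    (e : Episode S A B H) : ℝ :=
  if (e h).1 = s then φ (M.memory T k ω) (ν k) (e h).2 else 0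

/-- The loss that is fed to the bandit instance of `(h, s)` when the next estimates are `V`. -/
def MarkovGame.normLoss (h : ℕ) (s : S) (V : S → ℝ) (a : A) (z : B × S) : ℝ :=
  1 - (M.reward h s a z.1 + V z.2) / H

theorem MarkovGame.normLoss_mem {h : ℕ} (hh : h < H) {V : S → ℝ} (h0 : ∀ s, 0 ≤ V s)
    (h1 : ∀ s, V s ≤ (H : ℝ) - ((h + 1 : ℕ) : ℝ)) (s : S) (a : A) (z : B × S) :
    0 ≤ M.normLoss h s V a z ∧ M.normLoss h s V a z ≤ 1 := by
  have hH : (0 : ℝ) < H := by exact_mod_cast (Nat.zero_le h).trans_lt hh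
  have hr := M.reward_mem h s a z.1
  have hV0 := h0 z.2
  have hV1 := h1 z.2
  push_cast at hV1
  have hn : (0 : ℝ) ≤ h := Nat.cast_nonneg h
  have h2 : (M.reward h s a z.1 + V z.2) / H ≤ 1 := by
    rw [div_le_one hH]
    linarith [hr.2]
  have h3 : 0 ≤ (M.reward h s a z.1 + V z.2) / H := div_nonneg (add_nonneg hr.1 hV0) hH.le
  unfold MarkovGame.normLoss
  exact ⟨by linarith, by linarith⟩

variable [Fintype S] [Fintype A] [Fintype B]

open Classical in
/-- Weighted excess of the loss estimates over the mean losses, in block `i` of epoch `τ` of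
`(h, s)`; the weights `w` may depend on the current policy. -/
def MarkovGame.ixExcess (T : Tuning) (h : ℕ) (s : S) (τ i : ℕ) (w : Dist (M.acts h) → A → ℝ)
    (m : M.Memory) (q : M.OppPolicy) (z : A × B × S) : ℝ :=
  if (m h s).prevN = epochLen T.eta τ ∧ (m h s).bandit.block = i then
    w (m h s).pol z.1 * (M.normLoss h s (fun s' => (m (h + 1) s').V) z.1 z.2 /
        ((m h s).pol.1 z.1 + ixParam T (M.acts h).card i)) -
      ∑ a ∈ M.acts h, w (m h s).pol a *
        expect (M.replyLaw h s (q h s) a) (M.normLoss h s (fun s' => (m (h + 1) s').V) a)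
  else 0

open Classical in
/-- Excess, over its conditional mean, of the gain relative to the empirical Nash value in epoch
`τ` of `(h, s)`, scaled by `θ` and compensated. -/
def MarkovGame.gainExcess (T : Tuning) (K : ℕ) (ν : ℕ → M.OppPolicy) (νs : ℕ → S → B → ℝ)
    (h : ℕ) (s : S) (τ : ℕ) (θ : ℝ) (m : M.Memory) (q : M.OppPolicy) (z : A × B × S) : ℝ :=
  if (m h s).prevN = epochLen T.eta τ then
    θ * (M.reward h s z.1 z.2.1 + M.empNash K ν (h + 1) z.2.2 - M.empNash K ν h s -
      H * tvDist (q h s).1 (νs h s)) - θ ^ 2 * (2 * H) ^ 2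
  else 0

/-- Excess of the total reward of an episode over its conditional mean, scaled by `θ` and
compensated. -/
def MarkovGame.returnExcess (T : Tuning) (ν : ℕ → M.OppPolicy)
    (init : ∀ k : ℕ, (Fin k → Episode S A B H) → S) (θ : ℝ) (k : ℕ)
    (ω : Fin k → Episode S A B H) (e : Episode S A B H) : ℝ :=
  θ * (∑ h : Fin H, M.reward h (e h).1 (e h).2.1 (e h).2.2.1 -
    M.value (M.policyOf (M.memory T k ω)) (ν k) 0 (init k ω)) - θ ^ 2 * (H : ℝ) ^ 2

variable {M}

theorem expect_exp_visitIncr_le_one {T : Tuning} {ν : ℕ → M.OppPolicy} {h : Fin H} {s : S}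
    {φ : M.Memory → M.OppPolicy → A × B × S → ℝ} {k : ℕ} {ω : Fin k → Episode S A B H}
    (hφ : expect (M.stepLaw h s (M.memory T k ω h s).pol (ν k h s))
      (fun z => Real.exp (φ (M.memory T k ω) (ν k) z)) ≤ 1) (s₀ : S) :
    expect (M.rollout (M.policyOf (M.memory T k ω)) (ν k) H 0 s₀)
      (fun e => Real.exp (M.visitIncr T ν h s φ k ω e)) ≤ 1 := by
  classical
  refine expect_rollout_apply_le M (M.policyOf (M.memory T k ω)) (ν k)
    (fun st => Real.exp (if st.1 = s then φ (M.memory T k ω) (ν k) st.2 else 0)) 1 H 0 s₀ h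
    fun s' => ?_
  rw [Nat.zero_add]
  by_cases hs : s' = s
  · subst hs
    simp only [if_true]
    exact hφ
  · simp [hs, expect_const]

theorem expect_exp_ixExcess_le_one {T : Tuning} {h : ℕ} (hh : h < H) {s : S} {τ i : ℕ}
    {w : Dist (M.acts h) → A → ℝ} (hix : 0 < ixParam T (M.acts h).card i)
    (hw0 : ∀ p a, 0 ≤ w p a) (hw1 : ∀ p a, w p a ≤ ixParam T (M.acts h).card i) (k : ℕ)
    (ω : Fin k → Episode S A B H) (q : M.OppPolicy) :
    expect (M.stepLaw h s (M.memory T k ω h s).pol (q h s))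
      (fun z => Real.exp (M.ixExcess T h s τ i w (M.memory T k ω) q z)) ≤ 1 := by
  rw [expect_stepLaw]
  by_cases hc : (M.memory T k ω h s).prevN = epochLen T.eta τ ∧
      (M.memory T k ω h s).bandit.block = i
  · simp only [MarkovGame.ixExcess, if_pos hc]
    have hl := M.normLoss_mem hh (fun s' => (M.memory_mem T k ω (h + 1) s' hh).1)
      (fun s' => (M.memory_mem T k ω (h + 1) s' hh).2.1) s
    exact expect_exp_ix_le_one (M.memory T k ω h s).pol (fun a => M.replyLaw h s (q h s) a) hix
      (hw0 _) (hw1 _) (l := M.normLoss h s fun s' => (M.memory T k ω (h + 1) s').V)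
      (fun a z => (hl a z).1) (fun a z => (hl a z).2)
  · simp only [MarkovGame.ixExcess, if_neg hc, Real.exp_zero, expect_const]
    exact le_rfl

theorem expect_exp_gainExcess_le_one {T : Tuning} {K : ℕ} (hK : 0 < K) {ν : ℕ → M.OppPolicy}
    {νs : ℕ → S → B → ℝ} (hνs : M.IsMinimax K ν νs) {h : ℕ} (hh : h < H) {s : S}
    (hs : s ∈ M.states h) (τ : ℕ) {θ : ℝ} (hθ : 0 ≤ θ) (m : M.Memory) (q : M.OppPolicy) :
    expect (M.stepLaw h s (m h s).pol (q h s))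
      (fun z => Real.exp (M.gainExcess T K ν νs h s τ θ m q z)) ≤ 1 := by
  by_cases hc : (m h s).prevN = epochLen T.eta τ
  · simp only [MarkovGame.gainExcess, if_pos hc]
    refine expect_exp_le_one _ hθ (fun z => ?_) ?_
    · have hr := M.reward_mem h s z.1 z.2.1
      have hV0 := M.empNash_nonneg hK ν (h + 1) z.2.2
      have hV1 := M.empNash_le hK ν hh z.2.2
      have hU0 := M.empNash_nonneg hK ν h s
      have hU1 := M.empNash_le hK ν hh.le s
      have ht0 := tvDist_nonneg (q h s).1 (νs h s)
      have ht1 := tvDist_le_one (q h s) ⟨νs h s, hνs.mem_simplexOn hh hs⟩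
      have hn : (0 : ℝ) ≤ h := Nat.cast_nonneg h
      have hHr : (0 : ℝ) ≤ H := Nat.cast_nonneg H
      push_cast at hV1
      have h1 : (H : ℝ) * tvDist (q h s).1 (νs h s) ≤ H := by nlinarith
      have h2 : 0 ≤ (H : ℝ) * tvDist (q h s).1 (νs h s) := mul_nonneg hHr ht0
      rw [abs_le]
      constructor <;> linarith [hr.1, hr.2]
    · rw [expect_sub, expect_sub, expect_const, expect_const, expect_stepLaw]
      have h1 := oneStep_eq_expect M h (M.empNash K ν (h + 1)) s (m h s).pol (q h s)
      have h2 := M.oneStep_le_empNash_add hK hνs hh hs (m h s).pol (q h s).1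
      rw [h1] at h2
      linarith
  · simp only [MarkovGame.gainExcess, if_neg hc, Real.exp_zero, expect_const]
    exact le_rfl

theorem expect_exp_returnExcess_le_one {T : Tuning} {ν : ℕ → M.OppPolicy}
    {init : ∀ k : ℕ, (Fin k → Episode S A B H) → S} {θ : ℝ} (hθ : 0 ≤ θ) (k : ℕ)
    (ω : Fin k → Episode S A B H) :
    expect (M.rollout (M.policyOf (M.memory T k ω)) (ν k) H 0 (init k ω))
      (fun e => Real.exp (M.returnExcess T ν init θ k ω e)) ≤ 1 := by
  have hval : M.value (M.policyOf (M.memory T k ω)) (ν k) 0 (init k ω) =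
      expect (M.rollout (M.policyOf (M.memory T k ω)) (ν k) H 0 (init k ω))
        fun e => ∑ h : Fin H, M.reward h (e h).1 (e h).2.1 (e h).2.2.1 := by
    simp only [MarkovGame.value, expect, Nat.sub_zero, Nat.zero_add]
  have hsum : ∀ e : Episode S A B H,
      0 ≤ ∑ h : Fin H, M.reward h (e h).1 (e h).2.1 (e h).2.2.1 ∧
      ∑ h : Fin H, M.reward h (e h).1 (e h).2.1 (e h).2.2.1 ≤ H := by
    intro e
    refine ⟨Finset.sum_nonneg fun h _ => (M.reward_mem _ _ _ _).1, ?_⟩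
    have h1 : ∑ h : Fin H, M.reward h (e h).1 (e h).2.1 (e h).2.2.1 ≤ ∑ _h : Fin H, (1 : ℝ) :=
      Finset.sum_le_sum fun h _ => (M.reward_mem h _ _ _).2
    simpa using h1
  unfold MarkovGame.returnExcess
  refine expect_exp_le_one _ hθ (fun e => ?_) ?_
  · have h0 : 0 ≤ M.value (M.policyOf (M.memory T k ω)) (ν k) 0 (init k ω) := by
      rw [hval]
      exact expect_nonneg _ fun e => (hsum e).1
    have h1 : M.value (M.policyOf (M.memory T k ω)) (ν k) 0 (init k ω) ≤ H := by
      rw [hval]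
      refine (expect_mono _ fun e => (hsum e).2).trans (le_of_eq (expect_const _ _))
    rw [abs_le]
    constructor <;> linarith [(hsum e).1, (hsum e).2]
  · rw [expect_sub, expect_const, hval, sub_self]

end Tests

/-! ### Regret of the bandit instances along a run -/

/-- Constant in the regret bound of a block of the bandit subroutine. -/
def blockConst (cη cγ : ℝ) : ℝ := 3 / cγ + 3 * cη / cγ + cγ + cη + 2 / cη + 3

theorem blockConst_ge_three {cη cγ : ℝ} (hcη : 0 < cη) (hcγ : 0 < cγ) :
    3 ≤ blockConst cη cγ := by
  have : 0 ≤ 3 / cγ + 3 * cη / cγ + cγ + cη + 2 / cη := by positivity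
  unfold blockConst
  linarith

/-- The tuning of a block: `x²` is the number of actions, `d²` the logarithmic factor and `N²` the
length of the block. When `N < d` the number `m` of rounds is already small enough. -/
theorem block_numeric {cη cγ x d N Λ m γ lr Sl Sc Sq Sx W : ℝ} (hcη : 0 < cη) (hcγ : 0 < cγ)
    (hx : 1 ≤ x) (hd : 1 ≤ d) (hN : 1 ≤ N) (hγ : γ = cγ * d / (x * N)) (hlr : lr = cη / N)
    (hΛ : Λ ≤ 3 * d ^ 2) (h0 : Sl ≤ Sq + Sx + 2 / lr * x) (h1 : γ * Sq - γ * Sc ≤ Λ)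
    (h2 : γ / (γ + lr) * (Sx - W) ≤ Λ) (hW : W ≤ m * (γ * x ^ 2 + lr * x)) (hm : m ≤ N ^ 2)
    (h3 : Sl - Sc ≤ m) : Sl - Sc ≤ blockConst cη cγ * (x * d) * N := by
  have hxdN : 0 ≤ x * d * N := by positivity
  have hd0 : 0 < d := by linarith
  have hx0 : 0 < x := by linarith
  have hN0 : 0 < N := by linarith
  rcases le_total N d with hNd | hNd
  · have h4 : Sl - Sc ≤ x * d * N := by
      have h5 : N * N ≤ d * N := mul_le_mul_of_nonneg_right hNd hN0.le
      have h6 : d * N ≤ x * (d * N) := le_mul_of_one_le_left (by positivity) hx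
      nlinarith
    have h5 := mul_le_mul_of_nonneg_right (blockConst_ge_three hcη hcγ) hxdN
    linarith
  · have hγ0 : 0 < γ := by
      rw [hγ]
      positivity
    have hl0 : 0 < lr := by
      rw [hlr]
      positivity
    have e1 : Sq - Sc ≤ 3 / cγ * (x * d * N) := by
      have h5 : γ * (Sq - Sc) ≤ 3 * d ^ 2 := by linarith
      rw [← le_div_iff₀' hγ0] at h5
      refine h5.trans (le_of_eq ?_)
      rw [hγ]
      field_simp
    have e2 : Sx - W ≤ 3 * d ^ 2 + 3 * cη / cγ * (x * d) := by
      have h5 : γ / (γ + lr) * (Sx - W) ≤ 3 * d ^ 2 := h2.trans hΛ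
      rw [← le_div_iff₀' (by positivity)] at h5
      refine h5.trans (le_of_eq ?_)
      rw [hγ, hlr]
      field_simp
    have e3 : W ≤ (cγ * d + cη) * (x * N) := by
      refine (hW.trans (mul_le_mul_of_nonneg_right hm (by positivity))).trans (le_of_eq ?_)
      rw [hγ, hlr]
      field_simp
    have e4 : 2 / lr * x = 2 / cη * (x * N) := by
      rw [hlr]
      field_simp
    have hxN : x * N ≤ x * d * N := by nlinarith [mul_pos hx0 hN0]
    have hxd : x * d ≤ x * d * N := le_mul_of_one_le_right (by positivity) hN
    have hdd : d ^ 2 ≤ x * d * N := by nlinarith [mul_pos hd0 hN0]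
    have f1 := mul_le_mul_of_nonneg_left hxd (by positivity : 0 ≤ 3 * cη / cγ)
    have f2 := mul_le_mul_of_nonneg_left hxN hcη.le
    have f3 := mul_le_mul_of_nonneg_left hxN (by positivity : 0 ≤ 2 / cη)
    rw [e4] at h0
    have f4 : (cγ * d + cη) * (x * N) = cγ * (x * d * N) + cη * (x * N) := by ring
    unfold blockConst
    have f5 : (3 / cγ + 3 * cη / cγ + cγ + cη + 2 / cη + 3) * (x * d) * N =
      3 / cγ * (x * d * N) + 3 * cη / cγ * (x * d * N) + cγ * (x * d * N) + cη * (x * d * N) +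
        2 / cη * (x * d * N) + 3 * (x * d * N) := by ring
    rw [f5]
    linarith

section Run

variable {S A B : Type*} {H : ℕ} (M : MarkovGame S A B H)

/-- The learner's memory before episode `k` of the sequence `e` of episodes. -/
def MarkovGame.runMemory (T : Tuning) (e : ℕ → Episode S A B H) (k : ℕ) : M.Memory :=
  M.memory T k fun i => e i

/-- The target observed at step `h` of episode `k`, if the state is `s`. -/
def MarkovGame.target (T : Tuning) (e : ℕ → Episode S A B H) (h : Fin H) (s : S) (k : ℕ) : ℝ :=
  M.reward h s (e k h).2.1 (e k h).2.2.1 + (M.runMemory T e k (h + 1) (e k h).2.2.2).V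

/-- Episode `k` visits the pair `(h, s)`. -/
def Visits (e : ℕ → Episode S A B H) (h : Fin H) (s : S) (k : ℕ) : Prop := (e k h).1 = s

variable {M}

theorem isCellRun_runMemory (T : Tuning) (e : ℕ → Episode S A B H) (h : Fin H) (s : S) :
    IsCellRun T (M.acts_nonempty h) H h (fun k => M.runMemory T e k h s) (Visits e h s)
      (fun k => (e k h).2.1) (M.target T e h s) where
  zero := rfl
  visit k hk := by
    have : M.runMemory T e (k + 1) = M.update T (M.runMemory T e k) (e k) := rfl
    simp only [this, MarkovGame.update, dif_pos h.isLt]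
    exact if_pos hk
  skip k hk := by
    have : M.runMemory T e (k + 1) = M.update T (M.runMemory T e k) (e k) := rfl
    simp only [this, MarkovGame.update, dif_pos h.isLt]
    exact if_neg hk

theorem runMemory_mem (T : Tuning) (e : ℕ → Episode S A B H) (k : ℕ) {h : ℕ} (hh : h ≤ H) (s : S) :
    0 ≤ (M.runMemory T e k h s).V ∧ (M.runMemory T e k h s).V ≤ (H : ℝ) - h :=
  ⟨(M.memory_mem T k _ h s hh).1, (M.memory_mem T k _ h s hh).2.1⟩

theorem target_div_mem (T : Tuning) (e : ℕ → Episode S A B H) (h : Fin H) (s : S) (k : ℕ) :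
    0 ≤ M.target T e h s k / H ∧ M.target T e h s k / H ≤ 1 := by
  have := M.normLoss_mem h.isLt (V := fun s' => (M.runMemory T e k (h + 1) s').V)
    (fun s' => (runMemory_mem T e k h.isLt s').1) (fun s' => (runMemory_mem T e k h.isLt s').2) s
    (e k h).2.1 (e k h).2.2
  have e1 : M.target T e h s k / H =
      1 - M.normLoss h s (fun s' => (M.runMemory T e k (h + 1) s').V) (e k h).2.1 (e k h).2.2 := by
    simp only [MarkovGame.normLoss, MarkovGame.target]
    ring
  rw [e1]
  constructor <;> linarith [this.1, this.2]

theorem sum_visitIncr (T : Tuning) (ν : ℕ → M.OppPolicy) (e : ℕ → Episode S A B H) (h : Fin H)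
    (s : S) (φ : M.Memory → M.OppPolicy → A × B × S → ℝ) (K : ℕ) :
    ∑ k ∈ Finset.range K, M.visitIncr T ν h s φ k (fun i => e i) (e k) =
      ∑ k ∈ cellVisits (Visits e h s) K, φ (M.runMemory T e k) (ν k) (e k h).2 := by
  classical
  simp only [MarkovGame.visitIncr, cellVisits, Finset.sum_filter, Visits]
  exact Finset.sum_congr rfl fun k _ => by congr

/-- Weights of the test that controls the stability terms and the bias of a block: a multiple of
`γ + lr * √p`, scaled so as not to exceed `γ`. -/
def stabWeight {X : Finset A} (γ lr : ℝ) (p : Dist X) (a : A) : ℝ :=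
  γ / (γ + lr) * (γ + lr * √(p.1 a))

theorem stabWeight_mem {X : Finset A} {γ lr : ℝ} (hγ : 0 < γ) (hlr : 0 < lr) (p : Dist X) (a : A) :
    0 ≤ stabWeight γ lr p a ∧ stabWeight γ lr p a ≤ γ := by
  have h1 : √(p.1 a) ≤ 1 := Real.sqrt_le_one.2 (p.le_one a)
  unfold stabWeight
  refine ⟨by positivity, ?_⟩
  rw [div_mul_eq_mul_div, div_le_iff₀ (by positivity)]
  exact mul_le_mul_of_nonneg_left (by nlinarith) hγ.le

variable [Fintype S] [Fintype B]

/-- Mean loss of action `a` in episode `k` at `(h, s)`. -/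
def MarkovGame.meanLoss (M : MarkovGame S A B H) (T : Tuning) (ν : ℕ → M.OppPolicy)
    (e : ℕ → Episode S A B H) (h : Fin H) (s : S) (k : ℕ) (a : A) : ℝ :=
  expect (M.replyLaw h s (ν k h s) a)
    (M.normLoss h s (fun s' => (M.runMemory T e k (h + 1) s').V) a)

theorem meanLoss_mem (T : Tuning) (ν : ℕ → M.OppPolicy) (e : ℕ → Episode S A B H) (h : Fin H)
    (s : S) (k : ℕ) (a : A) :
    0 ≤ M.meanLoss T ν e h s k a ∧ M.meanLoss T ν e h s k a ≤ 1 := by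
  have := M.normLoss_mem h.isLt (V := fun s' => (M.runMemory T e k (h + 1) s').V)
    (fun s' => (runMemory_mem T e k h.isLt s').1) (fun s' => (runMemory_mem T e k h.isLt s').2) s a
  exact ⟨expect_nonneg _ fun z => (this z).1,
    (expect_mono _ fun z => (this z).2).trans (le_of_eq (expect_const _ _))⟩

theorem meanLoss_eq (T : Tuning) (ν : ℕ → M.OppPolicy) (e : ℕ → Episode S A B H) (h : Fin H)
    (s : S) (k : ℕ) (a : A) :
    M.meanLoss T ν e h s k a = 1 - expect (M.replyLaw h s (ν k h s) a)
      (fun z => M.reward h s a z.1 + (M.runMemory T e k (h + 1) z.2).V) * (H : ℝ)⁻¹ := by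
  rw [← expect_mul_const, MarkovGame.meanLoss, ← expect_const (M.replyLaw h s (ν k h s) a) 1,
    ← expect_sub]
  rfl

theorem sum_ixExcess (T : Tuning) (ν : ℕ → M.OppPolicy) (e : ℕ → Episode S A B H) (h : Fin H)
    (s : S) (τ i : ℕ) (w : Dist (M.acts h) → A → ℝ) (K : ℕ) :
    ∑ k ∈ Finset.range K, M.visitIncr T ν h s (M.ixExcess T h s τ i w) k (fun i => e i) (e k) =
      ∑ k ∈ blockVisits (fun k => M.runMemory T e k h s) (Visits e h s) (epochLen T.eta τ) i K,
        (w (M.runMemory T e k h s).pol (e k h).2.1 *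
          lossEst T H (fun k => M.runMemory T e k h s) (fun k => (e k h).2.1)
            (M.target T e h s) k (e k h).2.1 -
        ∑ a ∈ M.acts h, w (M.runMemory T e k h s).pol a * M.meanLoss T ν e h s k a) := by
  classical
  rw [sum_visitIncr]
  simp only [MarkovGame.ixExcess]
  rw [← Finset.sum_filter]
  refine Finset.sum_congr ?_ fun k hk => ?_
  · ext k
    simp only [Finset.mem_filter, mem_cellVisits, mem_blockVisits]
    tauto
  · have hb := (mem_blockVisits.1 hk).2.2.2
    rw [lossEst_self (c := fun k => M.runMemory T e k h s) (a := fun k => (e k h).2.1) k]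
    simp only [hb]
    rfl

variable [Fintype A]

theorem sum_mul_meanLoss (T : Tuning) (ν : ℕ → M.OppPolicy) (e : ℕ → Episode S A B H) (h : Fin H)
    (s : S) (k : ℕ) (p : Dist (M.acts h)) :
    ∑ a ∈ M.acts h, p.1 a * M.meanLoss T ν e h s k a =
      1 - M.oneStep h (fun s' => (M.runMemory T e k (h + 1) s').V) s p.1 (ν k h s).1 / H := by
  rw [← expect_toPMF_on, oneStep_eq_expect, div_eq_mul_inv, funext (meanLoss_eq T ν e h s k)]
  simp only [expect_sub, expect_const, expect_mul_const]

/-- Regret of a block of a bandit instance against the mixed action `q`, given that the two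
implicit exploration tests are passed. -/
theorem sum_block_regret_le {T : Tuning} {ν : ℕ → M.OppPolicy} {e : ℕ → Episode S A B H}
    {h : Fin H} {s : S} {K τ i : ℕ} {Λ D : ℝ} (hη : 0 < T.eta) (hlr : 0 < T.lrConst)
    (hix : 0 < T.ixConst) (hD : D = Real.log ((M.acts h).card / T.conf)) (hD1 : 1 ≤ D)
    (hΛ : Λ ≤ 3 * D) (ha : ∀ j < K, (e j h).2.1 ∈ M.acts h) (q : Dist (M.acts h))
    (h1 : ∑ k ∈ Finset.range K, M.visitIncr T ν h s (M.ixExcess T h s τ i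
      fun _ a => ixParam T (M.acts h).card i * q.1 a) k (fun i => e i) (e k) ≤ Λ)
    (h2 : ∑ k ∈ Finset.range K, M.visitIncr T ν h s (M.ixExcess T h s τ i
      (stabWeight (ixParam T (M.acts h).card i) (learningRate T i))) k (fun i => e i) (e k) ≤ Λ) :
    ∑ k ∈ blockVisits (fun k => M.runMemory T e k h s) (Visits e h s) (epochLen T.eta τ) i K,
      (M.oneStep h (fun s' => (M.runMemory T e k (h + 1) s').V) s q.1 (ν k h s).1 -
        M.target T e h s k) ≤
      H * (blockConst T.lrConst T.ixConst * √((M.acts h).card * D)) * √((2 : ℝ) ^ i) := by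
  have hc := isCellRun_runMemory (M := M) T e h s
  set n := (M.acts h).card with hn
  have hn1 : (1 : ℝ) ≤ n := by exact_mod_cast (M.acts_nonempty h).card_pos
  have hH : (0 : ℝ) < H := by exact_mod_cast (Nat.zero_le _).trans_lt h.isLt
  set Bv := blockVisits (fun k => M.runMemory T e k h s) (Visits e h s) (epochLen T.eta τ) i K
    with hBv
  have hixp : ∀ i, ixParam T n i = T.ixConst * √D / (√n * √((2 : ℝ) ^ i)) := by
    intro i
    rw [ixParam, ← hD, Real.sqrt_div (by linarith), Real.sqrt_mul (by linarith)]
    ring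
  have hix0 : ∀ i, 0 < ixParam T n i := by
    intro i
    rw [hixp]
    have : 0 < √D := Real.sqrt_pos.2 (by linarith)
    have : 0 < √(n : ℝ) := Real.sqrt_pos.2 (by linarith)
    positivity
  have hy := target_div_mem (M := M) T e h s
  have hreg := hc.sum_blockVisits_loss_le hη hlr hix0 (fun j => (hy j).1) (fun j => (hy j).2)
    (epochLen T.eta τ) i K (fun j hj _ => ha j hj) q
  have hlr0 := learningRate_pos hlr i
  have hcard : (Bv.card : ℝ) ≤ √((2 : ℝ) ^ i) ^ 2 := by
    rw [Real.sq_sqrt (by positivity)]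
    exact_mod_cast hc.card_blockVisits_le hη hlr (epochLen T.eta τ) i K
  rw [sum_ixExcess] at h1 h2
  set lE := lossEst T H (fun k => M.runMemory T e k h s) (fun k => (e k h).2.1)
    (M.target T e h s) with hlE
  set γ := ixParam T n i with hγ
  set lr := learningRate T i with hlrd
  have h2π : (1 : ℝ) ≤ √((2 : ℝ) ^ i) := Real.one_le_sqrt.2 (one_le_pow₀ (by norm_num))
  have hml := meanLoss_mem T ν e h s
  have key := block_numeric (cη := T.lrConst) (cγ := T.ixConst) (x := √n) (d := √D)
    (N := √((2 : ℝ) ^ i)) (Λ := Λ) (m := Bv.card) (γ := γ) (lr := lr)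
    (Sl := ∑ j ∈ Bv, (1 - M.target T e h s j / H))
    (Sc := ∑ j ∈ Bv, ∑ a ∈ M.acts h, q.1 a * M.meanLoss T ν e h s j a)
    (Sq := ∑ j ∈ Bv, ∑ a ∈ M.acts h, q.1 a * lE j a)
    (Sx := ∑ j ∈ Bv, (γ + lr * √((M.runMemory T e j h s).pol.1 (e j h).2.1)) *
      lE j (e j h).2.1)
    (W := ∑ j ∈ Bv, ∑ a ∈ M.acts h, (γ + lr * √((M.runMemory T e j h s).pol.1 a)) *
      M.meanLoss T ν e h s j a)
    hlr hix (Real.one_le_sqrt.2 hn1) (Real.one_le_sqrt.2 hD1) h2π (hixp i)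
    (by simp only [hlrd, learningRate])
    (by rwa [Real.sq_sqrt (by linarith)]) hreg ?_ ?_ ?_ hcard ?_
  · have e1 : ∑ k ∈ Bv, (M.oneStep h (fun s' => (M.runMemory T e k (h + 1) s').V) s q.1
        (ν k h s).1 - M.target T e h s k) =
        H * (∑ j ∈ Bv, (1 - M.target T e h s j / H) -
          ∑ j ∈ Bv, ∑ a ∈ M.acts h, q.1 a * M.meanLoss T ν e h s j a) := by
      rw [← Finset.sum_sub_distrib, Finset.mul_sum]
      refine Finset.sum_congr rfl fun j _ => ?_
      rw [sum_mul_meanLoss]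
      field_simp
      ring
    rw [e1, Real.sqrt_mul (by linarith), mul_assoc]
    exact mul_le_mul_of_nonneg_left key hH.le
  · refine le_trans (le_of_eq ?_) h1
    rw [← mul_sub, ← Finset.sum_sub_distrib, Finset.mul_sum]
    refine Finset.sum_congr rfl fun j hj => ?_
    have e1 : ∑ a ∈ M.acts h, q.1 a * lE j a = q.1 (e j h).2.1 * lE j (e j h).2.1 := by
      refine Finset.sum_eq_single_of_mem _ (ha j (mem_blockVisits.1 hj).1) fun b _ hb => ?_
      rw [hlE, lossEst, if_neg hb, mul_zero]
    rw [e1, mul_sub, Finset.mul_sum, ← mul_assoc]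
    simp only [mul_assoc]
  · refine le_trans (le_of_eq ?_) h2
    rw [← Finset.sum_sub_distrib, Finset.mul_sum]
    refine Finset.sum_congr rfl fun j _ => ?_
    simp only [stabWeight]
    rw [mul_sub, Finset.mul_sum]
    simp only [mul_assoc]
  · rw [← nsmul_eq_mul, ← Finset.sum_const]
    refine Finset.sum_le_sum fun j _ => ?_
    have e1 : ∑ a ∈ M.acts h, (γ + lr * √((M.runMemory T e j h s).pol.1 a)) *
        M.meanLoss T ν e h s j a ≤
        ∑ a ∈ M.acts h, (γ + lr * √((M.runMemory T e j h s).pol.1 a)) := by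
      refine Finset.sum_le_sum fun a _ => mul_le_of_le_one_right ?_ (hml j a).2
      exact add_nonneg (hix0 i).le (mul_nonneg hlr0.le (Real.sqrt_nonneg _))
    refine e1.trans ?_
    rw [Finset.sum_add_distrib, Finset.sum_const, nsmul_eq_mul, ← Finset.mul_sum,
      Real.sq_sqrt (by linarith), mul_comm γ]
    have e2 := mul_le_mul_of_nonneg_left (sum_sqrt_le (M.runMemory T e j h s).pol) hlr0.le
    linarith
  · rw [← Finset.sum_sub_distrib]
    have e1 : ∑ j ∈ Bv, ((1 - M.target T e h s j / H) -
        ∑ a ∈ M.acts h, q.1 a * M.meanLoss T ν e h s j a) ≤ ∑ j ∈ Bv, (1 : ℝ) := by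
      refine Finset.sum_le_sum fun j _ => ?_
      have e2 : 0 ≤ ∑ a ∈ M.acts h, q.1 a * M.meanLoss T ν e h s j a :=
        Finset.sum_nonneg fun a _ => mul_nonneg (q.2.1 a) (hml j a).1
      linarith [(hy j).1]
    simpa using e1

end Run

/-! ### Cardinalities -/

section Card

variable {S A B : Type*} {H : ℕ}

theorem one_le_numStates (M : MarkovGame S A B H) : 1 ≤ M.numStates := by
  classical
  rw [← M.card_terminal]
  unfold MarkovGame.numStates
  convert! Finset.card_le_card (Finset.subset_biUnion_of_mem M.states
    (Finset.mem_range.2 (Nat.lt_succ_self H)))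

theorem card_states_le (M : MarkovGame S A B H) (h : Fin H) :
    (M.states h).card ≤ M.numStates := by
  classical
  unfold MarkovGame.numStates
  convert! Finset.card_le_card (Finset.subset_biUnion_of_mem M.states
    (Finset.mem_range.2 (h.isLt.trans (Nat.lt_succ_self H))))

theorem card_acts_le (M : MarkovGame S A B H) (h : Fin H) :
    (M.acts h).card ≤ M.numActs := by
  classical
  unfold MarkovGame.numActs
  convert! Finset.card_le_card (Finset.subset_biUnion_of_mem M.acts (Finset.mem_range.2 h.isLt))

end Card

/-! ### Deterministic analysis of a run that passes the tests -/

/-- Backward recursion over the steps. For the tails `E h + ∑ G i` over `i ≥ h` the factor `1 + η`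
produces the extra term `-η ∑ G i` over `i > h`, so no upper bound on the losses `G` is needed. -/
theorem backward_recursion {H : ℕ} {η b : ℝ} {E G U : ℕ → ℝ} (hη : 0 ≤ η) (hηH : η * H ≤ 1)
    (hb : 0 ≤ b) (hU : ∀ h, 0 ≤ U h) (hE : E H = 0)
    (h1 : ∀ h < H, E h + G h ≤ (1 + η) * E (h + 1) + η * H * U h + b)
    (h2 : ∀ h < H, -G h ≤ H * U h + b) :
    E 0 + ∑ h ∈ Finset.range H, G h ≤
      6 * (η * (H : ℝ) ^ 2 * ∑ h ∈ Finset.range H, U h + H * b) := by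
  have hHr : (0 : ℝ) ≤ H := Nat.cast_nonneg H
  set W := H * ∑ h ∈ Finset.range H, U h + H * b with hW
  have hSU : 0 ≤ ∑ h ∈ Finset.range H, U h := Finset.sum_nonneg fun h _ => hU h
  have hW0 : 0 ≤ W := by positivity
  have hG : ∀ h ≤ H, -∑ i ∈ Finset.Ico h H, G i ≤ W := by
    intro h _
    rw [← Finset.sum_neg_distrib]
    have h3 : ∑ i ∈ Finset.Ico h H, -G i ≤ ∑ i ∈ Finset.Ico h H, (H * U i + b) :=
      Finset.sum_le_sum fun i hi => h2 i (Finset.mem_Ico.1 hi).2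
    have h4 : ∑ i ∈ Finset.Ico h H, (H * U i + b) ≤ ∑ i ∈ Finset.range H, (H * U i + b) := by
      refine Finset.sum_le_sum_of_subset_of_nonneg ?_ fun i _ _ => ?_
      · intro i hi
        exact Finset.mem_range.2 (Finset.mem_Ico.1 hi).2
      · have := hU i
        positivity
    refine (h3.trans h4).trans (le_of_eq ?_)
    rw [Finset.sum_add_distrib, ← Finset.mul_sum, Finset.sum_const, Finset.card_range,
      nsmul_eq_mul]
  have key : ∀ n ≤ H, E (H - n) + ∑ i ∈ Finset.Ico (H - n) H, G i ≤
      (1 + η) ^ n * ∑ i ∈ Finset.Ico (H - n) H, (η * H * U i + b + η * W) := by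
    intro n
    induction n with
    | zero => simp [hE]
    | succ n ih =>
      intro hn
      have hlt : H - (n + 1) < H := by omega
      have hs : H - (n + 1) + 1 = H - n := by omega
      have i1 := ih (by omega)
      rw [Finset.sum_eq_sum_Ico_succ_bot hlt, Finset.sum_eq_sum_Ico_succ_bot hlt, hs]
      have i2 := h1 _ hlt
      rw [hs] at i2
      have i3 := hG (H - n) (Nat.sub_le _ _)
      have i4 := mul_le_mul_of_nonneg_left i1 (by linarith : 0 ≤ 1 + η)
      have i5 := mul_le_mul_of_nonneg_left i3 hη
      have hX : 0 ≤ η * H * U (H - (n + 1)) + b + η * W := by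
        have := hU (H - (n + 1))
        positivity
      have i6 : η * H * U (H - (n + 1)) + b + η * W ≤
          (1 + η) ^ (n + 1) * (η * H * U (H - (n + 1)) + b + η * W) :=
        le_mul_of_one_le_left hX (one_le_pow₀ (by linarith))
      rw [mul_add ((1 + η) ^ (n + 1))]
      rw [pow_succ'] at i6 ⊢
      linarith
  have h3 := key H le_rfl
  rw [Nat.sub_self, ← Finset.range_eq_Ico] at h3
  refine h3.trans ?_
  have h4 : (1 + η) ^ H ≤ 3 := by
    have e1 : (1 + η) ^ H ≤ Real.exp η ^ H := by
      refine pow_le_pow_left₀ (by linarith) ?_ H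
      linarith [Real.add_one_le_exp η]
    rw [← Real.exp_nat_mul] at e1
    have e2 : Real.exp (H * η) ≤ Real.exp 1 := Real.exp_le_exp.2 (by linarith)
    linarith [Real.exp_one_lt_three]
  have h5 : ∑ i ∈ Finset.range H, (η * H * U i + b + η * W) =
      η * H * ∑ h ∈ Finset.range H, U h + H * b + H * (η * W) := by
    rw [Finset.sum_add_distrib, Finset.sum_add_distrib, ← Finset.mul_sum, Finset.sum_const,
      Finset.sum_const, Finset.card_range, nsmul_eq_mul, nsmul_eq_mul]
  have h6 : 0 ≤ ∑ i ∈ Finset.range H, (η * H * U i + b + η * W) :=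
    Finset.sum_nonneg fun i _ => by
      have := hU i
      positivity
  refine (mul_le_mul_of_nonneg_right h4 h6).trans ?_
  rw [h5, hW]
  have hHsq : (H : ℝ) ≤ (H : ℝ) ^ 2 := by exact_mod_cast Nat.le_self_pow two_ne_zero H
  have h7 : η * H * ∑ h ∈ Finset.range H, U h ≤ η * (H : ℝ) ^ 2 * ∑ h ∈ Finset.range H, U h :=
    mul_le_mul_of_nonneg_right (mul_le_mul_of_nonneg_left hHsq hη) hSU
  have h8 : H * (η * (H * b)) ≤ H * b := by
    have := mul_le_mul_of_nonneg_right hηH (mul_nonneg hHr hb)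
    linarith
  linarith

section GoodRun

variable {S A B : Type*} {H : ℕ} [Fintype S] [Fintype A] [Fintype B]

/-- What is needed of a run of `K` episodes: it is a possible run, in each epoch of each pair the
bandit regret against some maximin action is small, and so are the fluctuations of the gains. -/
structure IsGoodRun (M : MarkovGame S A B H) (T : Tuning) (K : ℕ) (ν : ℕ → M.OppPolicy)
    (νs : ℕ → S → B → ℝ) (e : ℕ → Episode S A B H) : Prop where
  state_mem : ∀ k < K, ∀ h : Fin H, (e k h).1 ∈ M.states h
  next_mem : ∀ k < K, ∀ h : Fin H, (e k h).2.2.2 ∈ M.states (h + 1)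
  chain : ∀ k < K, ∀ (h : ℕ) (hh : h + 1 < H),
    (e k ⟨h + 1, hh⟩).1 = (e k ⟨h, (Nat.lt_succ_self h).trans hh⟩).2.2.2
  regret : ∀ (h : Fin H), ∀ s ∈ M.states h, ∃ q : Dist (M.acts h),
    (∀ k < K, M.empNash K ν h s ≤ M.oneStep h (M.empNash K ν (h + 1)) s q.1 (ν k h s).1) ∧
    ∀ τ ≤ epochBound K T.eta,
      ∑ k ∈ epochVisits (fun k => M.runMemory T e k h s) (Visits e h s) (epochLen T.eta τ) K,
        (M.oneStep h (fun s' => (M.runMemory T e k (h + 1) s').V) s q.1 (ν k h s).1 -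
          M.target T e h s k) ≤ √T.iota * √(epochLen T.eta (τ + 1))
  gain : ∀ (h : Fin H), ∀ s ∈ M.states h, ∀ τ ≤ epochBound K T.eta,
    ∑ k ∈ epochVisits (fun k => M.runMemory T e k h s) (Visits e h s) (epochLen T.eta τ) K,
      (M.reward h s (e k h).2.1 (e k h).2.2.1 + M.empNash K ν (h + 1) (e k h).2.2.2 -
        M.empNash K ν h s - H * tvDist (ν k h s).1 (νs h s)) ≤
      √T.iota * √(epochLen T.eta (τ + 1))

variable {M : MarkovGame S A B H} {T : Tuning} {K : ℕ} {ν : ℕ → M.OppPolicy}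
  {νs : ℕ → S → B → ℝ} {e : ℕ → Episode S A B H}

/-- Optimism: the estimates never fall below the empirical Nash values. -/
theorem IsGoodRun.optimism (hg : IsGoodRun M T K ν νs e) (hη : 0 < T.eta) (hι : 0 ≤ T.iota)
    (hK : 1 ≤ K) : ∀ k ≤ K, ∀ h ≤ H, ∀ s ∈ M.states h,
      M.empNash K ν h s ≤ (M.runMemory T e k h s).V := by
  intro k
  induction k using Nat.strong_induction_on with
  | _ k ih =>
    intro hk h hh s hs
    rcases hh.lt_or_eq with hlt | rfl
    · have hc := isCellRun_runMemory (M := M) T e ⟨h, hlt⟩ s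
      obtain ⟨τ, hE⟩ := hc.exists_epochInv hη k
      obtain ⟨t, ht⟩ := hc.exists_epochInv hη K
      have hV := M.empNash_le hK ν hh s
      cases τ with
      | zero => exact hV.trans (hE.V_zero rfl).ge
      | succ σ =>
        have hmono := epochLen_strictMono hη
        have hσ : σ ≤ epochBound K T.eta := by
          have h1 := hc.prevN_mono hη hk
          rw [hE.prevN, ht.prevN] at h1
          have h2 := hmono.le_iff_le.1 h1
          have h3 := ht.le_epochBound hη hK
          omega
        rw [show (M.runMemory T e k h s).V = _ from hE.V_succ σ rfl]
        refine le_min hV ?_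
        obtain ⟨q, hq1, hq2⟩ := hg.regret ⟨h, hlt⟩ s hs
        have h1 := hq2 σ hσ
        have hfix := hc.epochVisits_eq_of_lt hη hk (P := epochLen T.eta σ)
          (hE.prevN ▸ hmono (Nat.lt_succ_self σ))
        dsimp only at hfix h1
        rw [← hfix] at h1
        have hcard := hE.card_past σ (Nat.lt_succ_self σ)
        dsimp only at hcard ⊢
        set F := epochVisits (fun k => M.runMemory T e k h s) (Visits e ⟨h, hlt⟩ s)
          (epochLen T.eta σ) k with hF
        set L : ℝ := ((epochLen T.eta (σ + 1) : ℕ) : ℝ) with hL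
        have hL0 : 0 < L := by
          rw [hL]
          exact_mod_cast one_le_epochLen hη (σ + 1)
        have h2 : L * M.empNash K ν h s ≤ ∑ j ∈ F,
            M.oneStep h (fun s' => (M.runMemory T e j (h + 1) s').V) s q.1 (ν j h s).1 := by
          rw [hL, ← hcard, ← nsmul_eq_mul, ← Finset.sum_const]
          refine Finset.sum_le_sum fun j hj => ?_
          have hjk : j < k := (mem_epochVisits.1 hj).1
          refine (hq1 j (hjk.trans_le hk)).trans (M.oneStep_mono ?_ s q (ν j h s))
          exact fun s' hs' => ih j hjk (hjk.le.trans hk) (h + 1) hlt s' hs'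
        rw [Finset.sum_sub_distrib] at h1
        have h3 : L * M.empNash K ν h s ≤
            ∑ j ∈ F, M.target T e ⟨h, hlt⟩ s j + √T.iota * √L := by linarith
        have h4 : L * ((∑ j ∈ F, M.target T e ⟨h, hlt⟩ s j) / L + √(T.iota / L)) =
            ∑ j ∈ F, M.target T e ⟨h, hlt⟩ s j + √T.iota * √L := by
          rw [Real.sqrt_div hι]
          have h5 : 0 < √L := Real.sqrt_pos.2 hL0
          have h6 : √L * √L = L := Real.mul_self_sqrt hL0.le
          field_simp
          linear_combination √T.iota * (-1) * h6
        rw [← h4] at h3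
        exact le_of_mul_le_mul_left h3 hL0
    · rw [M.empNash_terminal]
      exact (runMemory_mem T e k le_rfl s).1

/-- Loss at step `h` of episode `k`, relative to the empirical Nash value. It telescopes along an
episode; both signs are possible. -/
def MarkovGame.stepLoss (M : MarkovGame S A B H) (K : ℕ) (ν : ℕ → M.OppPolicy)
    (e : ℕ → Episode S A B H) (h : Fin H) (k : ℕ) : ℝ :=
  M.empNash K ν h (e k h).1 - (M.reward h (e k h).1 (e k h).2.1 (e k h).2.2.1 +
    M.empNash K ν (h + 1) (e k h).2.2.2)

theorem IsGoodRun.sum_eq_sum_states (hg : IsGoodRun M T K ν νs e) (h : Fin H) (f : ℕ → ℝ) :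
    ∑ k ∈ Finset.range K, f k =
      ∑ s ∈ M.states h, ∑ k ∈ cellVisits (Visits e h s) K, f k := by
  classical
  rw [← Finset.sum_fiberwise_of_maps_to (s := Finset.range K) (t := M.states h)
    (g := fun k => (e k h).1) fun k hk => hg.state_mem k (Finset.mem_range.1 hk) h]
  refine Finset.sum_congr rfl fun s _ => Finset.sum_congr ?_ fun _ _ => rfl
  ext k
  simp [mem_cellVisits, Visits]

/-- Cauchy–Schwarz over all epochs of all states of a step. -/
theorem IsGoodRun.sum_states_sqrt_le (hg : IsGoodRun M T K ν νs e) (hη : 0 < T.eta)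
    (hη1 : T.eta ≤ 1) (hK : 1 ≤ K) (h : Fin H) {t : S → ℕ}
    (ht : ∀ s, EpochInv T H h (fun k => M.runMemory T e k h s) (Visits e h s)
      (M.target T e h s) K (t s)) :
    ∑ s ∈ M.states h, ∑ τ ∈ Finset.range (t s + 1), √(epochLen T.eta (τ + 1)) ≤
      √(M.numStates * ((epochBound K T.eta + 1) * (3 * K + 2 * M.numStates))) := by
  classical
  have hcard : ((M.states h).card : ℝ) ≤ M.numStates := by exact_mod_cast card_states_le M h
  have h1 : ∀ s, ∑ τ ∈ Finset.range (t s + 1), √(epochLen T.eta (τ + 1)) ≤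
      √((epochBound K T.eta + 1) * (3 * (cellVisits (Visits e h s) K).card + 2)) := by
    intro s
    refine ((isCellRun_runMemory T e h s).sum_sqrt_epochLen_le hη hη1 (ht s)).trans ?_
    refine Real.sqrt_le_sqrt (mul_le_mul_of_nonneg_right ?_ (by positivity))
    have : (t s : ℝ) ≤ epochBound K T.eta := by exact_mod_cast (ht s).le_epochBound hη hK
    linarith
  refine (Finset.sum_le_sum fun s _ => h1 s).trans ?_
  apply Real.le_sqrt_of_sq_le
  refine sq_sum_le_card_mul_sum_sq.trans ?_
  have h2 : ∀ s : S, √((epochBound K T.eta + 1) *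
      (3 * ((cellVisits (Visits e h s) K).card : ℝ) + 2)) ^ 2 =
      (epochBound K T.eta + 1) * (3 * ((cellVisits (Visits e h s) K).card : ℝ) + 2) :=
    fun s => Real.sq_sqrt (by positivity)
  simp only [h2]
  rw [← Finset.mul_sum]
  have h3 := hg.sum_eq_sum_states h fun _ => 1
  simp only [Finset.sum_const, nsmul_eq_mul, mul_one, Finset.card_range] at h3
  rw [Finset.sum_add_distrib, ← Finset.mul_sum, ← h3, Finset.sum_const, nsmul_eq_mul]
  refine mul_le_mul hcard (mul_le_mul_of_nonneg_left ?_ (by positivity)) (by positivity)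
    (by positivity)
  linarith

/-- Bounds on the total error and on the total gain at a step. -/
theorem IsGoodRun.step_bounds (hg : IsGoodRun M T K ν νs e) (hη : 0 < T.eta)
    (hη1 : T.eta ≤ 1) (hHι : (H : ℝ) ≤ √T.iota) (hK : 1 ≤ K) (hνs : M.IsMinimax K ν νs)
    (h : Fin H) {b : ℝ}
    (hb : b = 5 * √T.iota *
      √(M.numStates * ((epochBound K T.eta + 1) * (3 * K + 2 * M.numStates)))) :
    (∑ k ∈ Finset.range K, ((M.runMemory T e k h (e k h).1).V - M.empNash K ν h (e k h).1 +
        M.stepLoss K ν e h k) ≤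
      (1 + T.eta) * ∑ k ∈ Finset.range K, ((M.runMemory T e k (h + 1) (e k h).2.2.2).V -
        M.empNash K ν (h + 1) (e k h).2.2.2) +
      T.eta * H * ∑ k ∈ Finset.range K, tvDist (ν k h (e k h).1).1 (νs h (e k h).1) + b) ∧
    -∑ k ∈ Finset.range K, M.stepLoss K ν e h k ≤
      H * ∑ k ∈ Finset.range K, tvDist (ν k h (e k h).1).1 (νs h (e k h).1) + b := by
  have hι : 0 < T.iota := by
    have : (1 : ℝ) ≤ H := by exact_mod_cast (Nat.zero_le _).trans_lt h.isLt
    exact Real.sqrt_pos.1 (by linarith)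
  have hopt := hg.optimism hη hι.le hK
  have hc := isCellRun_runMemory (M := M) T e h
  choose t ht using fun s => (hc s).exists_epochInv hη K
  have htM : ∀ s, ∀ τ ≤ t s, τ ≤ epochBound K T.eta := fun s τ hτ =>
    hτ.trans ((ht s).le_epochBound hη hK)
  have hcell : ∀ s, ∀ k ∈ cellVisits (Visits e h s) K, (e k h).1 = s := fun s k hk =>
    (mem_cellVisits.1 hk).2
  have hepoch : ∀ s P, ∀ k ∈ epochVisits (fun k => M.runMemory T e k h s) (Visits e h s) P K,
      k < K ∧ (e k h).1 = s := fun s P k hk =>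
    ⟨(mem_epochVisits.1 hk).1, (mem_epochVisits.1 hk).2.1⟩
  have hsum := hg.sum_states_sqrt_le hη hη1 hK h ht
  have hH1 : ((h + 1 : ℕ) : ℝ) ≤ H := by exact_mod_cast h.isLt
  have hmart : ∀ s ∈ M.states h, ∀ τ ≤ t s,
      ∑ k ∈ epochVisits (fun k => M.runMemory T e k h s) (Visits e h s) (epochLen T.eta τ) K,
        (-M.stepLoss K ν e h k - H * tvDist (ν k h (e k h).1).1 (νs h (e k h).1)) ≤
      √T.iota * √(epochLen T.eta (τ + 1)) := by
    intro s hs τ hτ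
    refine le_trans (le_of_eq ?_) (hg.gain h s hs τ (htM s τ hτ))
    refine Finset.sum_congr rfl fun k hk => ?_
    rw [MarkovGame.stepLoss, (hepoch s _ k hk).2]
    ring
  constructor
  · have h1 : ∀ s ∈ M.states h, ∑ k ∈ cellVisits (Visits e h s) K,
        ((M.runMemory T e k h (e k h).1).V - M.empNash K ν h (e k h).1 +
          M.stepLoss K ν e h k) ≤
        (1 + T.eta) * ∑ k ∈ cellVisits (Visits e h s) K,
          ((M.runMemory T e k (h + 1) (e k h).2.2.2).V -
            M.empNash K ν (h + 1) (e k h).2.2.2) +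
        T.eta * H * ∑ k ∈ cellVisits (Visits e h s) K,
          tvDist (ν k h (e k h).1).1 (νs h (e k h).1) +
        5 * √T.iota * ∑ τ ∈ Finset.range (t s + 1), √(epochLen T.eta (τ + 1)) := by
      intro s hs
      have h2 := (hc s).sum_error_le hη hη1 hι.le (ht s) (Vs := M.empNash K ν h s)
        (e := √T.iota)
        (D := fun k => (M.runMemory T e k (h + 1) (e k h).2.2.2).V -
            M.empNash K ν (h + 1) (e k h).2.2.2)
        (G := M.stepLoss K ν e h) (U := fun k => tvDist (ν k h (e k h).1).1 (νs h (e k h).1))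
        (M.empNash_nonneg hK ν h s) ?_ ?_ ?_ ?_ ?_ le_rfl hHι ?_ (hmart s hs)
      · refine le_trans (le_of_eq ?_) h2
        refine Finset.sum_congr rfl fun k hk => ?_
        rw [hcell s k hk]
      · intro k hk
        rw [MarkovGame.stepLoss, hcell s k hk, MarkovGame.target]
        ring
      · intro k hk
        have hkK := (mem_cellVisits.1 hk).1
        exact sub_nonneg.2 (hopt k hkK.le (h + 1) h.isLt _ (hg.next_mem k hkK h))
      · intro k _
        have h3 := (runMemory_mem (M := M) T e k h.isLt (e k h).2.2.2).2
        have h4 := M.empNash_nonneg hK ν (h + 1) (e k h).2.2.2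
        have h5 : (0 : ℝ) ≤ ((h + 1 : ℕ) : ℝ) := Nat.cast_nonneg _
        linarith
      · exact fun k _ => tvDist_nonneg _ _
      · intro k hk
        have hkK := (mem_cellVisits.1 hk).1
        exact tvDist_le_one (ν k h (e k h).1)
          ⟨_, hνs.mem_simplexOn h.isLt (hg.state_mem k hkK h)⟩
      · intro τ hτ
        obtain ⟨q, hq1, hq2⟩ := hg.regret h s hs
        refine le_trans (Finset.sum_le_sum fun k hk => ?_) (hq2 τ (htM s τ hτ))
        have hkK := (hepoch s _ k hk).1
        refine sub_le_sub_right ((hq1 k hkK).trans (M.oneStep_mono ?_ s q (ν k h s))) _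
        exact fun s' hs' => hopt k hkK.le (h + 1) h.isLt s' hs'
    have h2 := Finset.sum_le_sum h1
    rw [Finset.sum_add_distrib, Finset.sum_add_distrib, ← Finset.mul_sum, ← Finset.mul_sum,
      ← Finset.mul_sum, ← hg.sum_eq_sum_states, ← hg.sum_eq_sum_states,
      ← hg.sum_eq_sum_states] at h2
    have h3 := mul_le_mul_of_nonneg_left hsum (by positivity : 0 ≤ 5 * √T.iota)
    rw [hb]
    linarith
  · have h1 : ∀ s ∈ M.states h, ∑ k ∈ cellVisits (Visits e h s) K,
        (-M.stepLoss K ν e h k - H * tvDist (ν k h (e k h).1).1 (νs h (e k h).1)) ≤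
        √T.iota * ∑ τ ∈ Finset.range (t s + 1), √(epochLen T.eta (τ + 1)) := by
      intro s hs
      rw [(hc s).sum_cellVisits hη (ht s), Finset.mul_sum]
      exact Finset.sum_le_sum fun τ hτ =>
        hmart s hs τ (Nat.lt_succ_iff.1 (Finset.mem_range.1 hτ))
    have h2 := Finset.sum_le_sum h1
    rw [← hg.sum_eq_sum_states, ← Finset.mul_sum, Finset.sum_sub_distrib, Finset.sum_neg_distrib,
      ← Finset.mul_sum] at h2
    have h3 := mul_le_mul_of_nonneg_left hsum (Real.sqrt_nonneg T.iota)
    have h4 : 0 ≤ √T.iota *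
        √(M.numStates * ((epochBound K T.eta + 1) * (3 * K + 2 * M.numStates))) := by positivity
    rw [hb]
    linarith

/-- Value, in a family `F` of functions of the state, at step `h` of an episode; `0` at the end. -/
def alongEpisode (F : ℕ → S → ℝ) (e : Episode S A B H) (h : ℕ) : ℝ :=
  if hh : h < H then F h (e ⟨h, hh⟩).1 else 0

theorem IsGoodRun.apply_next (hg : IsGoodRun M T K ν νs e) {F : ℕ → S → ℝ} (hF : ∀ s, F H s = 0)
    {k : ℕ} (hk : k < K) (h : Fin H) :
    F (h + 1) (e k h).2.2.2 = alongEpisode F (e k) (h + 1) := by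
  unfold alongEpisode
  split_ifs with hh
  · rw [hg.chain k hk h hh]
  · have : (h : ℕ) + 1 = H := le_antisymm h.isLt (not_lt.1 hh)
    rw [this]
    exact hF _

/-- Bound on the difference between the estimates at the initial states and the total reward. -/
theorem IsGoodRun.sum_estimate_sub_return_le (hg : IsGoodRun M T K ν νs e) (hη : 0 < T.eta)
    (hηH : T.eta * H ≤ 1) (hH : 0 < H) (hHι : (H : ℝ) ≤ √T.iota) (hK : 1 ≤ K)
    (hνs : M.IsMinimax K ν νs) :
    ∑ k ∈ Finset.range K, ((M.runMemory T e k 0 (e k ⟨0, hH⟩).1).V -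
      ∑ h : Fin H, M.reward h (e k h).1 (e k h).2.1 (e k h).2.2.1) ≤
    6 * (T.eta * (H : ℝ) ^ 2 * ∑ h : Fin H, ∑ k ∈ Finset.range K,
        tvDist (ν k h (e k h).1).1 (νs h (e k h).1) +
      H * (5 * √T.iota *
        √(M.numStates * ((epochBound K T.eta + 1) * (3 * K + 2 * M.numStates))))) := by
  have hη1 : T.eta ≤ 1 := by
    have : (1 : ℝ) ≤ H := by exact_mod_cast hH
    nlinarith
  set b := 5 * √T.iota *
    √(M.numStates * ((epochBound K T.eta + 1) * (3 * K + 2 * M.numStates))) with hb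
  set E : ℕ → ℝ := fun h => ∑ k ∈ Finset.range K, alongEpisode
    (fun h s => (M.runMemory T e k h s).V - M.empNash K ν h s) (e k) h with hE
  set G : ℕ → ℝ := fun h => if hh : h < H then
    ∑ k ∈ Finset.range K, M.stepLoss K ν e ⟨h, hh⟩ k else 0 with hG
  set U : ℕ → ℝ := fun h => if hh : h < H then ∑ k ∈ Finset.range K,
    tvDist (ν k h (e k ⟨h, hh⟩).1).1 (νs h (e k ⟨h, hh⟩).1) else 0 with hU
  have hEH : ∀ k s, (M.runMemory T e k H s).V - M.empNash K ν H s = 0 := fun k s => by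
    rw [M.empNash_terminal, sub_zero]
    exact M.memory_terminal T k _ s
  have hnext : ∀ (h : ℕ) (hh : h < H), ∑ k ∈ Finset.range K,
      ((M.runMemory T e k (h + 1) (e k ⟨h, hh⟩).2.2.2).V -
        M.empNash K ν (h + 1) (e k ⟨h, hh⟩).2.2.2) = E (h + 1) := fun h hh => by
    refine Finset.sum_congr rfl fun k hk => ?_
    exact hg.apply_next (F := fun h s => (M.runMemory T e k h s).V - M.empNash K ν h s) (hEH k)
      (Finset.mem_range.1 hk) ⟨h, hh⟩
  have hEval : ∀ (h : ℕ) (hh : h < H), E h = ∑ k ∈ Finset.range K,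
      ((M.runMemory T e k h (e k ⟨h, hh⟩).1).V - M.empNash K ν h (e k ⟨h, hh⟩).1) :=
    fun h hh => by
      simp only [hE, alongEpisode, dif_pos hh]
  have hrec := backward_recursion (H := H) (b := b) (E := E) (G := G) (U := U) hη.le hηH
    (by positivity) ?_ ?_ ?_ ?_
  · have hGsum : ∑ h ∈ Finset.range H, G h = ∑ k ∈ Finset.range K,
        (M.empNash K ν 0 (e k ⟨0, hH⟩).1 -
          ∑ h : Fin H, M.reward h (e k h).1 (e k h).2.1 (e k h).2.2.1) := by
      rw [← Fin.sum_univ_eq_sum_range]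
      simp only [hG, Fin.is_lt, dite_true, Fin.eta]
      rw [Finset.sum_comm]
      refine Finset.sum_congr rfl fun k hk => ?_
      have h1 : ∀ h : Fin H, M.stepLoss K ν e h k =
          alongEpisode (M.empNash K ν) (e k) h - alongEpisode (M.empNash K ν) (e k) (h + 1) -
            M.reward h (e k h).1 (e k h).2.1 (e k h).2.2.1 := by
        intro h
        rw [← hg.apply_next (M.empNash_terminal K ν) (Finset.mem_range.1 hk) h,
          MarkovGame.stepLoss]
        simp only [alongEpisode, dif_pos h.isLt]
        ring
      simp only [h1]
      rw [Finset.sum_sub_distrib, Fin.sum_univ_eq_sum_range (fun h =>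
        alongEpisode (M.empNash K ν) (e k) h - alongEpisode (M.empNash K ν) (e k) (h + 1)),
        Finset.sum_range_sub']
      simp [alongEpisode, hH]
    have hUsum : ∑ h ∈ Finset.range H, U h = ∑ h : Fin H, ∑ k ∈ Finset.range K,
        tvDist (ν k h (e k h).1).1 (νs h (e k h).1) := by
      rw [← Fin.sum_univ_eq_sum_range]
      simp only [hU, Fin.is_lt, dite_true, Fin.eta]
    rw [hGsum, hUsum, hEval 0 hH, ← Finset.sum_add_distrib] at hrec
    refine le_trans (le_of_eq ?_) hrec
    exact Finset.sum_congr rfl fun k _ => by ring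
  · intro h
    simp only [hU]
    split_ifs
    · exact Finset.sum_nonneg fun k _ => tvDist_nonneg _ _
    · exact le_rfl
  · simp [hE, alongEpisode]
  · intro h hh
    have h1 := (hg.step_bounds hη hη1 hHι hK hνs ⟨h, hh⟩ hb).1
    rw [Finset.sum_add_distrib] at h1
    dsimp only at h1
    rw [hnext h hh, ← hEval h hh] at h1
    simpa only [hG, hU, dif_pos hh] using h1
  · intro h hh
    have h1 := (hg.step_bounds hη hη1 hHι hK hνs ⟨h, hh⟩ hb).2
    simpa only [hG, hU, dif_pos hh] using h1

end GoodRun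

/-! ### Union bound over the tests -/

section Union

variable {S A B : Type*} {H : ℕ} [Fintype S] [Fintype A] [Fintype B]

/-- Union bound for finitely many processes with conditional exponential moments at most `1`. -/
theorem ofReal_le_runLaw_of_tests {M : MarkovGame S A B H} {T : Tuning} {ν : ℕ → M.OppPolicy}
    {init : ∀ k : ℕ, (Fin k → Episode S A B H) → S} {K : ℕ} {ι : Type*} (I : Finset ι)
    (Y : ι → ∀ k : ℕ, (Fin k → Episode S A B H) → Episode S A B H → ℝ)
    (hY : ∀ i ∈ I, ∀ k ω, expect (M.rollout (M.policyOf (M.memory T k ω)) (ν k) H 0 (init k ω))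
      (fun e => Real.exp (Y i k ω e)) ≤ 1)
    {Λ δ : ℝ} (hδ : I.card * Real.exp (-Λ) ≤ δ) {G : Set (Fin K → Episode S A B H)}
    (hG : ∀ ω ∈ (M.runLaw T ν init K).support,
      (∀ i ∈ I, ∑ k : Fin K, Y i k (before ω k) (ω k) ≤ Λ) → ω ∈ G) :
    ENNReal.ofReal (1 - δ) ≤ (M.runLaw T ν init K).toOuterMeasure G := by
  refine ofReal_one_sub_le_toOuterMeasure
    (W := fun ω => ∑ i ∈ I, Real.exp (∑ k : Fin K, Y i k (before ω k) (ω k)) * Real.exp (-Λ))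
    (fun ω => Finset.sum_nonneg fun i _ => by positivity) ?_ fun ω hω hW => hG ω hω fun i hi => ?_
  · refine le_trans ?_ hδ
    rw [expect_sum, ← nsmul_eq_mul, ← Finset.sum_const]
    refine Finset.sum_le_sum fun i hi => ?_
    rw [expect_mul_const]
    exact mul_le_of_le_one_left (Real.exp_pos _).le
      (expect_runLaw_exp_sum_le M T ν init (Y i) (hY i hi) K)
  · have h1 := (Finset.single_le_sum (f := fun i =>
      Real.exp (∑ k : Fin K, Y i k (before ω k) (ω k)) * Real.exp (-Λ))
      (fun i _ => by positivity) hi).trans_lt hW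
    rw [← Real.exp_add, Real.exp_lt_one_iff] at h1
    linarith

end Union

/-- Optimizing the scale in a compensated exponential bound. -/
theorem le_two_sqrt_of_compensated {θ Λ D D' x : ℝ} (hΛ : 0 < Λ) (hD : 0 < D) (hD' : D' ≤ D)
    (hθ : θ = √(Λ / D)) (h : θ * x - θ ^ 2 * D' ≤ Λ) : x ≤ 2 * √(Λ * D) := by
  have hl : 0 < √Λ := Real.sqrt_pos.2 hΛ
  have hm : 0 < √D := Real.sqrt_pos.2 hD
  have hl2 : √Λ * √Λ = Λ := Real.mul_self_sqrt hΛ.le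
  have hθ0 : 0 < θ := by
    rw [hθ]
    positivity
  have hθ2 : θ ^ 2 * D = Λ := by
    rw [hθ, Real.sq_sqrt (by positivity)]
    field_simp
  have h1 : θ ^ 2 * D' ≤ Λ := hθ2 ▸ mul_le_mul_of_nonneg_left hD' (by positivity)
  have h2 : θ * x ≤ θ * (2 * √(Λ * D)) := by
    have h3 : θ * (2 * √(Λ * D)) = 2 * Λ := by
      rw [hθ, Real.sqrt_div hΛ.le, Real.sqrt_mul hΛ.le]
      field_simp
      linear_combination hl2
    linarith
  exact le_of_mul_le_mul_left h2 hθ0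

theorem IsCellRun.card_epochVisits_le_epochLen {A : Type*} {X : Finset A} {T : Tuning}
    {hX : X.Nonempty} {H h : ℕ} {c : ℕ → Cell X} {vis : ℕ → Prop} {a : ℕ → A} {y : ℕ → ℝ}
    (hc : IsCellRun T hX H h c vis a y) (hη : 0 < T.eta) (τ K : ℕ) :
    (epochVisits c vis (epochLen T.eta τ) K).card ≤ epochLen T.eta (τ + 1) := by
  obtain ⟨t, hE⟩ := hc.exists_epochInv hη K
  rcases lt_trichotomy τ t with h1 | rfl | h1
  · exact (hE.card_past τ h1).le
  · exact hE.card ▸ hE.N_lt.le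
  · have : epochVisits c vis (epochLen T.eta τ) K = ∅ := by
      ext j
      simp only [mem_epochVisits, Finset.notMem_empty, iff_false, not_and]
      intro hj _ hP
      have h2 := hc.prevN_mono hη hj.le
      rw [hP, hE.prevN] at h2
      exact absurd (epochLen_strictMono hη h1) (not_lt.2 h2)
    rw [this]
    exact Nat.zero_le _

section Gain

variable {S A B : Type*} {H : ℕ} [Fintype S] [Fintype A] [Fintype B] {M : MarkovGame S A B H}

/-- Fluctuations of the gains in an epoch, given that the corresponding test is passed. -/
theorem sum_gain_le {T : Tuning} {K : ℕ} {ν : ℕ → M.OppPolicy} {νs : ℕ → S → B → ℝ}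
    {e : ℕ → Episode S A B H} {h : Fin H} {s : S} {τ : ℕ} {θ Λ : ℝ} (hη : 0 < T.eta)
    (hΛ : 0 < Λ) (hθ : θ = √(Λ / ((2 * H) ^ 2 * epochLen T.eta (τ + 1))))
    (ht : ∑ k ∈ Finset.range K, M.visitIncr T ν h s (M.gainExcess T K ν νs h s τ θ) k
      (fun i => e i) (e k) ≤ Λ) :
    ∑ k ∈ epochVisits (fun k => M.runMemory T e k h s) (Visits e h s) (epochLen T.eta τ) K,
      (M.reward h s (e k h).2.1 (e k h).2.2.1 + M.empNash K ν (h + 1) (e k h).2.2.2 -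
        M.empNash K ν h s - H * tvDist (ν k h s).1 (νs h s)) ≤
      4 * H * √Λ * √(epochLen T.eta (τ + 1)) := by
  classical
  have hH : (0 : ℝ) < H := by exact_mod_cast (Nat.zero_le _).trans_lt h.isLt
  have hL : (0 : ℝ) < epochLen T.eta (τ + 1) := by exact_mod_cast one_le_epochLen hη (τ + 1)
  have hcard := (isCellRun_runMemory (M := M) T e h s).card_epochVisits_le_epochLen hη τ K
  set F := epochVisits (fun k => M.runMemory T e k h s) (Visits e h s) (epochLen T.eta τ) K
    with hF
  rw [sum_visitIncr] at ht
  simp only [MarkovGame.gainExcess] at ht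
  rw [← Finset.sum_filter] at ht
  have e1 : (cellVisits (Visits e h s) K).filter
      (fun k => (M.runMemory T e k h s).prevN = epochLen T.eta τ) = F := by
    ext k
    simp only [hF, Finset.mem_filter, mem_cellVisits, mem_epochVisits]
    tauto
  rw [e1, Finset.sum_sub_distrib, ← Finset.mul_sum, Finset.sum_const, nsmul_eq_mul] at ht
  have hcard' : (F.card : ℝ) ≤ epochLen T.eta (τ + 1) := by exact_mod_cast hcard
  refine (le_two_sqrt_of_compensated (D := (2 * H) ^ 2 * epochLen T.eta (τ + 1))
    (D' := (2 * H) ^ 2 * F.card) hΛ (by positivity)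
    (mul_le_mul_of_nonneg_left hcard' (by positivity)) hθ (by linarith)).trans (le_of_eq ?_)
  rw [Real.sqrt_mul hΛ.le, Real.sqrt_mul (by positivity), Real.sqrt_sq (by positivity)]
  ring

end Gain

/-! ### Constants -/

theorem half_le_log {K : ℕ} (hK : 2 ≤ K) : 1 / 2 ≤ Real.log K := by
  have h1 : (2 : ℝ) ≤ K := by exact_mod_cast hK
  have h2 := Real.log_le_log (by norm_num) h1
  linarith [Real.log_two_gt_d9]

theorem two_mul_log_le_epochBound {K : ℕ} (hK : 2 ≤ K) {η : ℝ} (hη : 0 < η) (hη1 : η ≤ 1) :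
    2 * Real.log K ≤ epochBound K η := by
  refine le_trans ?_ (Nat.le_ceil _)
  rw [le_div_iff₀ hη]
  nlinarith [half_le_log hK]

theorem epochBound_add_one_le {K : ℕ} (hK : 2 ≤ K) {η : ℝ} (hη : 0 < η) (hη1 : η ≤ 1) :
    (epochBound K η : ℝ) + 1 ≤ 6 * (Real.log K / η) := by
  have hl := half_le_log hK
  have h1 : (epochBound K η : ℝ) < (1 + η) * Real.log K / η + 1 :=
    Nat.ceil_lt_add_one (by positivity)
  have h2 : (1 + η) * Real.log K / η ≤ 2 * (Real.log K / η) := by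
    rw [mul_div_assoc]
    exact mul_le_mul_of_nonneg_right (by linarith) (by positivity)
  have h3 : 1 / 2 ≤ Real.log K / η := by
    rw [le_div_iff₀ hη]
    linarith
  linarith

theorem log_two_le_epochBound {K : ℕ} (hK : 2 ≤ K) {η : ℝ} (hη : 0 < η) (hη1 : η ≤ 1) :
    Nat.log 2 K ≤ epochBound K η := by
  have h1 : ((2 : ℝ) ^ Nat.log 2 K) ≤ K := by
    exact_mod_cast Nat.pow_log_le_self 2 (by omega : K ≠ 0)
  have h2 := Real.log_le_log (by positivity) h1
  rw [Real.log_pow] at h2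
  have h3 := two_mul_log_le_epochBound hK hη hη1
  have h4 : (Nat.log 2 K : ℝ) * (1 / 2) ≤ Nat.log 2 K * Real.log 2 :=
    mul_le_mul_of_nonneg_left (by linarith [Real.log_two_gt_d9]) (Nat.cast_nonneg _)
  have h5 : (Nat.log 2 K : ℝ) ≤ epochBound K η := by linarith
  exact_mod_cast h5

theorem epochBound_le {K : ℕ} (hK : 2 ≤ K) {η : ℝ} (hη : 1 / (K : ℝ) ≤ η) :
    (epochBound K η : ℝ) ≤ 2 * (K : ℝ) ^ 2 := by
  have hK0 : (2 : ℝ) ≤ K := by exact_mod_cast hK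
  have hη0 : 0 < η := lt_of_lt_of_le (by positivity) hη
  have hl := half_le_log hK
  have hl1 : Real.log K ≤ K - 1 := Real.log_le_sub_one_of_pos (by linarith)
  have h1 : (epochBound K η : ℝ) < (1 + η) * Real.log K / η + 1 :=
    Nat.ceil_lt_add_one (by positivity)
  have h2 : (1 + η) * Real.log K / η = Real.log K / η + Real.log K := by
    field_simp
  have h3 : Real.log K / η ≤ K * (K - 1) := by
    rw [div_le_iff₀ hη0]
    have h4 : 1 ≤ K * η := by
      rw [div_le_iff₀ (by linarith)] at hη
      linarith
    nlinarith
  nlinarith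

/-- Bounds on `log (n / conf)`, where `conf` is the confidence parameter of the bandit instances;
the upper bound uses `n / conf ≤ x ^ 6`, where `x` is the argument of the logarithm in `ι`. -/
theorem conf_bounds {H s K m a n : ℕ} {δ : ℝ} (hH : 1 ≤ H) (hs : 1 ≤ s) (hK : 2 ≤ K) (hm : 1 ≤ m)
    (hmK : (m : ℝ) ≤ 2 * (K : ℝ) ^ 2) (hn : 1 ≤ n) (hna : n ≤ a) (hδ0 : 0 < δ) (hδ1 : δ < 1) :
    1 ≤ Real.log (n / (δ / (4 * H * s * m))) ∧
    Real.log (1 / (δ / (4 * H * s * m))) ≤ Real.log (n / (δ / (4 * H * s * m))) ∧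
    Real.log (n / (δ / (4 * H * s * m))) ≤ 6 * Real.log (H * K * a * s / δ) := by
  have hH' : (1 : ℝ) ≤ H := by exact_mod_cast hH
  have hs' : (1 : ℝ) ≤ s := by exact_mod_cast hs
  have hK' : (2 : ℝ) ≤ K := by exact_mod_cast hK
  have hm' : (1 : ℝ) ≤ m := by exact_mod_cast hm
  have hn' : (1 : ℝ) ≤ n := by exact_mod_cast hn
  have hna' : (n : ℝ) ≤ a := by exact_mod_cast hna
  have hδi : 1 ≤ 1 / δ := by rw [le_div_iff₀ hδ0]; linarith
  have hHs : (1 : ℝ) ≤ H * s := one_le_mul_of_one_le_of_one_le hH' hs'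
  have e1 : (n : ℝ) / (δ / (4 * H * s * m)) = 4 * m * (n * (H * s) * (1 / δ)) := by
    field_simp
  have hq : 1 ≤ (n : ℝ) * (H * s) * (1 / δ) :=
    one_le_mul_of_one_le_of_one_le (one_le_mul_of_one_le_of_one_le hn' hHs) hδi
  have h3 : (3 : ℝ) ≤ n / (δ / (4 * H * s * m)) := by
    rw [e1]
    nlinarith
  refine ⟨?_, ?_, ?_⟩
  · rw [Real.le_log_iff_exp_le (by linarith)]
    linarith [Real.exp_one_lt_three]
  · refine Real.log_le_log (by positivity) ?_
    exact div_le_div_of_nonneg_right hn' (by positivity)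
  · set x : ℝ := H * K * a * s / δ with hx
    have ha' : (1 : ℝ) ≤ a := hn'.trans hna'
    have hxe : x = K * (a * (H * s) * (1 / δ)) := by
      rw [hx]
      field_simp
    have hq' : (n : ℝ) * (H * s) * (1 / δ) ≤ a * (H * s) * (1 / δ) := by gcongr
    have hKx : (K : ℝ) ≤ x := by
      rw [hxe]
      exact le_mul_of_one_le_right (by linarith) (hq.trans hq')
    have hqx : (n : ℝ) * (H * s) * (1 / δ) ≤ x := by
      rw [hxe]
      exact hq'.trans (le_mul_of_one_le_left (by linarith) (by linarith))
    have h4 : 4 * (m : ℝ) ≤ (K : ℝ) ^ 5 := by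
      have h5 : (8 : ℝ) ≤ (K : ℝ) ^ 3 := by
        calc (8 : ℝ) = 2 ^ 3 := by norm_num
          _ ≤ (K : ℝ) ^ 3 := by gcongr
      nlinarith [sq_nonneg (K : ℝ)]
    have h5 : (n : ℝ) / (δ / (4 * H * s * m)) ≤ x ^ 6 := by
      rw [e1]
      calc 4 * (m : ℝ) * (n * (H * s) * (1 / δ)) ≤ (K : ℝ) ^ 5 * x :=
            mul_le_mul h4 hqx (by positivity) (by positivity)
        _ ≤ x ^ 5 * x := by
            refine mul_le_mul_of_nonneg_right ?_ (by linarith)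
            exact pow_le_pow_left₀ (by linarith) hKx 5
        _ = x ^ 6 := by ring
    have h6 := Real.log_le_log (by linarith) h5
    rw [Real.log_pow] at h6
    exact_mod_cast h6

/-- The total failure probability of the tests, each of which fails with probability at most
`conf ^ 3`: `J` counts the epochs of all pairs, each with two tests for each of its `l + 1` blocks
and one for its gains, and one more test concerns the total reward. -/
theorem failure_numeric {p m l J : ℕ} {δ : ℝ} (hp : 1 ≤ p) (hm : 1 ≤ m) (hl : l ≤ m)
    (hJ : J ≤ p * (m + 1)) (hδ0 : 0 < δ) (hδ1 : δ < 1) :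
    ((J * ((l + 1) * 2) + (J + 1) : ℕ) : ℝ) * (δ / (4 * p * m)) ^ 3 ≤ δ := by
  have hp' : (1 : ℝ) ≤ p := by exact_mod_cast hp
  have hm' : (1 : ℝ) ≤ m := by exact_mod_cast hm
  have hcount : J * ((l + 1) * 2) + (J + 1) ≤ 11 * (p * m ^ 2) := by
    have h1 : J ≤ 2 * (p * m) := by nlinarith
    have h2 : (l + 1) * 2 ≤ 4 * m := by omega
    have h3 : J * ((l + 1) * 2) ≤ 2 * (p * m) * (4 * m) := Nat.mul_le_mul h1 h2
    have h4 : p * m ≤ p * m ^ 2 := Nat.mul_le_mul_left p (Nat.le_self_pow two_ne_zero m)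
    have h5 : 1 ≤ p * m := Nat.mul_pos hp hm
    nlinarith
  have h1 : ((J * ((l + 1) * 2) + (J + 1) : ℕ) : ℝ) ≤ 11 * (p * (m : ℝ) ^ 2) := by
    exact_mod_cast hcount
  refine (mul_le_mul_of_nonneg_right h1 (by positivity)).trans ?_
  have e1 : 11 * (p * (m : ℝ) ^ 2) * (δ / (4 * p * m)) ^ 3 =
      δ * (11 * δ ^ 2 / (64 * (p : ℝ) ^ 2 * m)) := by
    field_simp
    ring
  rw [e1]
  refine mul_le_of_le_one_right hδ0.le ?_
  rw [div_le_one (by positivity)]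
  have h2 : δ ^ 2 ≤ 1 := by nlinarith
  have h3 : 1 ≤ (p : ℝ) ^ 2 * m := one_le_mul_of_one_le_of_one_le (one_le_pow₀ hp') hm'
  linarith

/-! ### Regret of a run that passes the tests -/

section Final

variable {S A B : Type*} {H : ℕ}

/-- The sequence of episodes of a run, prolonged arbitrarily. -/
def extendRun {K : ℕ} (hK : 0 < K) (ω : Fin K → Episode S A B H) (k : ℕ) : Episode S A B H :=
  if hk : k < K then ω ⟨k, hk⟩ else ω ⟨0, hK⟩

theorem extendRun_coe {K : ℕ} (hK : 0 < K) (ω : Fin K → Episode S A B H) (k : Fin K) :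
    extendRun hK ω k = ω k := by
  simp [extendRun]

theorem before_eq_extendRun {K : ℕ} (hK : 0 < K) (ω : Fin K → Episode S A B H) (k : Fin K) :
    before ω k = fun i : Fin k => extendRun hK ω i := by
  funext i
  have : (i : ℕ) < K := i.isLt.trans k.isLt
  simp only [before, extendRun, dif_pos this]
  rfl

theorem sum_extendRun {K : ℕ} (hK : 0 < K) (ω : Fin K → Episode S A B H)
    (Y : ∀ k : ℕ, (Fin k → Episode S A B H) → Episode S A B H → ℝ) :
    ∑ k : Fin K, Y k (before ω k) (ω k) =
      ∑ k ∈ Finset.range K, Y k (fun i => extendRun hK ω i) (extendRun hK ω k) := by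
  rw [← Fin.sum_univ_eq_sum_range (fun k => Y k (fun i => extendRun hK ω i) (extendRun hK ω k))]
  refine Finset.sum_congr rfl fun k _ => ?_
  rw [before_eq_extendRun hK, extendRun_coe]

variable [Fintype S] [Fintype A] [Fintype B] {M : MarkovGame S A B H}

/-- A possible run that passes all tests is good. -/
theorem isGoodRun_of_tests {T : Tuning} {K : ℕ} {ν : ℕ → M.OppPolicy} {νs : ℕ → S → B → ℝ}
    {init : ∀ k : ℕ, (Fin k → Episode S A B H) → S} (hK : 0 < K) {ω : Fin K → Episode S A B H}
    (hω : ω ∈ (M.runLaw T ν init K).support) (hinit : ∀ k ω, init k ω ∈ M.states 0)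
    (hη : 0 < T.eta) (hlr : 0 < T.lrConst) (hix : 0 < T.ixConst) {Λ : ℝ} (hΛ0 : 0 < Λ)
    (hD : ∀ h : Fin H, 1 ≤ Real.log ((M.acts h).card / T.conf) ∧
      Λ ≤ 3 * Real.log ((M.acts h).card / T.conf))
    (hι1 : 4 * H * √Λ ≤ √T.iota)
    (hι2 : ∀ h : Fin H, 4 * (H * (blockConst T.lrConst T.ixConst *
      √((M.acts h).card * Real.log ((M.acts h).card / T.conf)))) ≤ √T.iota)
    {q : ∀ h : Fin H, S → Dist (M.acts h)}
    (hq : ∀ h : Fin H, ∀ s ∈ M.states h, ∀ k : Fin K, M.empNash K ν h s ≤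
        M.oneStep h (M.empNash K ν (h + 1)) s (q h s).1 (ν k h s).1)
    (h1 : ∀ h : Fin H, ∀ s ∈ M.states h, ∀ τ ≤ epochBound K T.eta, ∀ i ≤ Nat.log 2 K,
      ∑ k : Fin K, M.visitIncr T ν h s (M.ixExcess T h s τ i
        fun _ a => ixParam T (M.acts h).card i * (q h s).1 a) k (before ω k) (ω k) ≤ Λ ∧
      ∑ k : Fin K, M.visitIncr T ν h s (M.ixExcess T h s τ i
        (stabWeight (ixParam T (M.acts h).card i) (learningRate T i))) k (before ω k) (ω k) ≤ Λ)
    (h2 : ∀ h : Fin H, ∀ s ∈ M.states h, ∀ τ ≤ epochBound K T.eta,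
      ∑ k : Fin K, M.visitIncr T ν h s (M.gainExcess T K ν νs h s τ
        √(Λ / ((2 * H) ^ 2 * epochLen T.eta (τ + 1)))) k (before ω k) (ω k) ≤ Λ) :
    IsGoodRun M T K ν νs (extendRun hK ω) := by
  have hsupp : ∀ k < K, ∃ s₀ ∈ M.states 0, ∃ μ : M.Policy, ∃ ν' : M.OppPolicy,
      extendRun hK ω k ∈ (M.rollout μ ν' H 0 s₀).support := by
    intro k hk
    have := mem_support_rollout_of_mem_support_runLaw hω ⟨k, hk⟩
    rw [show extendRun hK ω k = ω ⟨k, hk⟩ from dif_pos hk]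
    exact ⟨_, hinit _ _, _, _, this⟩
  have hmem : ∀ k < K, ∀ h : Fin H, (extendRun hK ω k h).2.1 ∈ M.acts h ∧
      (extendRun hK ω k h).2.2.2 ∈ M.states (h + 1) := by
    intro k hk h
    obtain ⟨s₀, -, μ, ν', he⟩ := hsupp k hk
    have := mem_of_mem_support_rollout he h
    rwa [Nat.zero_add] at this
  have hchain : ∀ k < K, ∀ (h : ℕ) (hh : h + 1 < H), (extendRun hK ω k ⟨h + 1, hh⟩).1 =
      (extendRun hK ω k ⟨h, (Nat.lt_succ_self h).trans hh⟩).2.2.2 := by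
    intro k hk h hh
    obtain ⟨s₀, -, μ, ν', he⟩ := hsupp k hk
    exact fst_succ_of_mem_support_rollout he h hh
  refine ⟨?_, fun k hk h => (hmem k hk h).2, hchain, ?_, ?_⟩
  · rintro k hk ⟨h, hh⟩
    cases h with
    | zero =>
      obtain ⟨s₀, hs₀, μ, ν', he⟩ := hsupp k hk
      rw [fst_zero_of_mem_support_rollout he hh]
      exact hs₀
    | succ h =>
      rw [hchain k hk h hh]
      exact (hmem k hk ⟨h, (Nat.lt_succ_self h).trans hh⟩).2
  · intro h s hs
    refine ⟨q h s, fun k hk => hq h s hs ⟨k, hk⟩, fun τ hτ => ?_⟩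
    have h3 := (isCellRun_runMemory (M := M) T (extendRun hK ω) h s).sum_epochVisits_le_of_block
      hη hlr hK.ne' τ (C := H * (blockConst T.lrConst T.ixConst *
        √((M.acts h).card * Real.log ((M.acts h).card / T.conf))))
      (f := fun k => M.oneStep h (fun s' => (M.runMemory T (extendRun hK ω) k (h + 1) s').V) s
        (q h s).1 (ν k h s).1 - M.target T (extendRun hK ω) h s k) ?_ fun i hi => ?_
    · exact h3.trans (mul_le_mul_of_nonneg_right (hι2 h) (Real.sqrt_nonneg _))
    · have := blockConst_ge_three hlr hix
      positivity
    · have h4 := h1 h s hs τ hτ i hi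
      rw [sum_extendRun hK, sum_extendRun hK] at h4
      exact sum_block_regret_le hη hlr hix rfl (hD h).1 (hD h).2
        (fun j hj => (hmem j hj h).1) (q h s) h4.1 h4.2
  · intro h s hs τ hτ
    have h4 := h2 h s hs τ hτ
    rw [sum_extendRun hK] at h4
    exact (sum_gain_le hη hΛ0 rfl h4).trans
      (mul_le_mul_of_nonneg_right hι1 (Real.sqrt_nonneg _))

/-- Conclusion for a possible run that is good and whose total reward is close to its conditional
mean. -/
theorem IsGoodRun.regret_and_estRegret_le {T : Tuning} {K : ℕ} {ν : ℕ → M.OppPolicy}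
    {νs : ℕ → S → B → ℝ} {init : ∀ k : ℕ, (Fin k → Episode S A B H) → S} (hK : 2 ≤ K)
    {ω : Fin K → Episode S A B H} (hω : ω ∈ (M.runLaw T ν init K).support)
    (hinit : ∀ k ω, init k ω ∈ M.states 0) (hg : IsGoodRun M T K ν νs (extendRun (by omega) ω))
    (hH : 1 ≤ H) (hη : 0 < T.eta) (hηH : T.eta * H ≤ 1) (hsK : M.numStates ≤ K)
    (hνs : M.IsMinimax K ν νs) (hHι : (H : ℝ) ≤ √T.iota) {Λ : ℝ} (hΛ0 : 0 < Λ)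
    (hΛι : Λ ≤ T.iota)
    (h3 : ∑ k : Fin K, M.returnExcess T ν init √(Λ / ((H : ℝ) ^ 2 * K)) k (before ω k) (ω k) ≤
      Λ) :
    M.regret T ν init ω ≤ M.estRegret T ν init ω ∧
    M.estRegret T ν init ω ≤ 184 * (T.eta * (H : ℝ) ^ 3 * M.nonstationarity ν νs ω +
      H * √(T.iota * M.numStates * K * Real.log K / T.eta)) := by
  have hK0 : 0 < K := by omega
  have hH0 : (1 : ℝ) ≤ H := by exact_mod_cast hH
  have hι : 0 < T.iota := hΛ0.trans_le hΛι
  set e := extendRun hK0 ω with he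
  have hfst : ∀ k : Fin K, init k (before ω k) = (e k ⟨0, hH⟩).1 := by
    intro k
    rw [he, extendRun_coe]
    exact (fst_zero_of_mem_support_rollout
      (mem_support_rollout_of_mem_support_runLaw hω k) hH).symm
  have hmem : ∀ k : Fin K, M.memory T k (before ω k) = M.runMemory T e k := by
    intro k
    rw [before_eq_extendRun hK0]
    rfl
  constructor
  · refine Finset.sum_le_sum fun k _ => sub_le_sub_right ?_ _
    rw [hmem k]
    exact hg.optimism hη hι.le hK0 k k.isLt.le 0 (Nat.zero_le H) _ (hinit _ _)
  · have hns : ∑ h : Fin H, ∑ k ∈ Finset.range K, tvDist (ν k h (e k h).1).1 (νs h (e k h).1) =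
        M.nonstationarity ν νs ω := by
      unfold MarkovGame.nonstationarity
      refine Finset.sum_congr rfl fun h _ => ?_
      rw [← Fin.sum_univ_eq_sum_range fun k => tvDist (ν k h (e k h).1).1 (νs h (e k h).1)]
      exact Finset.sum_congr rfl fun k _ => by rw [he, extendRun_coe]
    have hest : M.estRegret T ν init ω =
        ∑ k ∈ Finset.range K, ((M.runMemory T e k 0 (e k ⟨0, hH⟩).1).V -
          ∑ h : Fin H, M.reward h (e k h).1 (e k h).2.1 (e k h).2.2.1) +
        ∑ k : Fin K, (∑ h : Fin H, M.reward h (ω k h).1 (ω k h).2.1 (ω k h).2.2.1 -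
          M.value (M.policyOf (M.memory T k (before ω k))) (ν k) 0 (init k (before ω k))) := by
      rw [← Fin.sum_univ_eq_sum_range fun k => ((M.runMemory T e k 0 (e k ⟨0, hH⟩).1).V -
          ∑ h : Fin H, M.reward h (e k h).1 (e k h).2.1 (e k h).2.2.1),
        ← Finset.sum_add_distrib]
      refine Finset.sum_congr rfl fun k _ => ?_
      rw [hmem k, hfst k, he, extendRun_coe]
      ring
    have hmain := hg.sum_estimate_sub_return_le hη hηH hH hHι hK0 hνs
    rw [hns] at hmain
    have hret : ∑ k : Fin K, (∑ h : Fin H, M.reward h (ω k h).1 (ω k h).2.1 (ω k h).2.2.1 -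
        M.value (M.policyOf (M.memory T k (before ω k))) (ν k) 0 (init k (before ω k))) ≤
        2 * √(Λ * ((H : ℝ) ^ 2 * K)) := by
      have hKr : (0 : ℝ) < K := by exact_mod_cast hK0
      refine le_two_sqrt_of_compensated hΛ0 (by positivity) le_rfl rfl ?_
      simp only [MarkovGame.returnExcess] at h3
      rw [Finset.sum_sub_distrib, ← Finset.mul_sum, Finset.sum_const, Finset.card_univ,
        Fintype.card_fin, nsmul_eq_mul] at h3
      linarith
    have hη1 : T.eta ≤ 1 := by nlinarith
    have hl := half_le_log hK
    have hMb := epochBound_add_one_le hK hη hη1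
    have hs1 : (1 : ℝ) ≤ M.numStates := by exact_mod_cast one_le_numStates M
    have hsK' : (M.numStates : ℝ) ≤ K := by exact_mod_cast hsK
    have hKr : (1 : ℝ) ≤ K := by exact_mod_cast hK0
    set s : ℝ := (M.numStates : ℝ) with hs
    set R := √(T.iota * s * K * Real.log K / T.eta) with hR
    have hlη : 1 / 2 ≤ Real.log K / T.eta := by
      rw [le_div_iff₀ hη]
      linarith
    have hB : √T.iota * √(s * ((epochBound K T.eta + 1) * (3 * K + 2 * s))) ≤ 6 * R := by
      rw [← Real.sqrt_mul hι.le]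
      have e1 : 6 * R = √(36 * (T.iota * s * K * Real.log K / T.eta)) := by
        rw [Real.sqrt_mul (by norm_num), show (36 : ℝ) = 6 ^ 2 by norm_num,
          Real.sqrt_sq (by norm_num)]
      rw [e1]
      refine Real.sqrt_le_sqrt ?_
      have e2 : (epochBound K T.eta + 1) * (3 * K + 2 * s) ≤
          6 * (Real.log K / T.eta) * (5 * K) :=
        mul_le_mul hMb (by linarith) (by positivity) (by positivity)
      have e3 := mul_le_mul_of_nonneg_left e2 (by positivity : 0 ≤ T.iota * s)
      have e4 : T.iota * s * (6 * (Real.log K / T.eta) * (5 * K)) =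
          30 * (T.iota * s * K * Real.log K / T.eta) := by ring
      have e5 : 0 ≤ T.iota * s * K * Real.log K / T.eta := by positivity
      linarith
    have hC : √(Λ * ((H : ℝ) ^ 2 * K)) ≤ 2 * (H * R) := by
      have e1 : 2 * (H * R) = √(4 * (H : ℝ) ^ 2 * (T.iota * s * K * Real.log K / T.eta)) := by
        rw [Real.sqrt_mul (by positivity), show 4 * (H : ℝ) ^ 2 = (2 * H) ^ 2 by ring,
          Real.sqrt_sq (by positivity)]
        ring
      rw [e1]
      refine Real.sqrt_le_sqrt ?_
      have e2 : 1 ≤ 2 * (s * (Real.log K / T.eta)) := by nlinarith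
      have e3 := mul_le_mul_of_nonneg_right hΛι (by positivity : 0 ≤ (H : ℝ) ^ 2 * K)
      have e4 := mul_le_mul_of_nonneg_left e2 (by positivity : 0 ≤ T.iota * ((H : ℝ) ^ 2 * K))
      have e5 : T.iota * ((H : ℝ) ^ 2 * K) * (2 * (s * (Real.log K / T.eta))) =
          2 * ((H : ℝ) ^ 2 * (T.iota * s * K * Real.log K / T.eta)) := by ring
      have e6 : 0 ≤ (H : ℝ) ^ 2 * (T.iota * s * K * Real.log K / T.eta) := by positivity
      linarith
    have hns0 : 0 ≤ M.nonstationarity ν νs ω :=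
      Finset.sum_nonneg fun h _ => Finset.sum_nonneg fun k _ => tvDist_nonneg _ _
    have hH3 : T.eta * (H : ℝ) ^ 2 * M.nonstationarity ν νs ω ≤
        T.eta * (H : ℝ) ^ 3 * M.nonstationarity ν νs ω := by
      refine mul_le_mul_of_nonneg_right (mul_le_mul_of_nonneg_left ?_ hη.le) hns0
      exact pow_le_pow_right₀ hH0 (by norm_num)
    have hHB := mul_le_mul_of_nonneg_left hB (by positivity : 0 ≤ (H : ℝ))
    have hX : 0 ≤ T.eta * (H : ℝ) ^ 3 * M.nonstationarity ν νs ω := by positivity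
    have hY : 0 ≤ H * R := by positivity
    rw [hest]
    linarith

end Final

/-! ### Probability of passing all tests -/

section Probability

variable {S A B : Type*} {H : ℕ} [Fintype S] [Fintype A] [Fintype B] {M : MarkovGame S A B H}

/-- Union bound over all tests: two for each block of each bandit instance, one for each epoch, and
one for the total reward. -/
theorem ofReal_le_runLaw_of_all_tests {T : Tuning} {K : ℕ} {ν : ℕ → M.OppPolicy}
    {νs : ℕ → S → B → ℝ} {init : ∀ k : ℕ, (Fin k → Episode S A B H) → S} (hK : 0 < K)
    (hνs : M.IsMinimax K ν νs) (hlr : 0 < T.lrConst)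
    (hix : ∀ (h : Fin H) (i : ℕ), 0 < ixParam T (M.acts h).card i) {Λ δ : ℝ} {m l J : ℕ}
    (hJ : J = ∑ h : Fin H, (M.states h).card * (m + 1))
    (hδ : ((J * ((l + 1) * 2) + (J + 1) : ℕ) : ℝ) * Real.exp (-Λ) ≤ δ)
    (q : ∀ h : Fin H, S → Dist (M.acts h)) {G : Set (Fin K → Episode S A B H)}
    (hG : ∀ ω ∈ (M.runLaw T ν init K).support,
      (∀ h : Fin H, ∀ s ∈ M.states h, ∀ τ ≤ m, ∀ i ≤ l,
        ∑ k : Fin K, M.visitIncr T ν h s (M.ixExcess T h s τ i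
          fun _ a => ixParam T (M.acts h).card i * (q h s).1 a) k (before ω k) (ω k) ≤ Λ ∧
        ∑ k : Fin K, M.visitIncr T ν h s (M.ixExcess T h s τ i
          (stabWeight (ixParam T (M.acts h).card i) (learningRate T i))) k (before ω k) (ω k) ≤
            Λ) →
      (∀ h : Fin H, ∀ s ∈ M.states h, ∀ τ ≤ m,
        ∑ k : Fin K, M.visitIncr T ν h s (M.gainExcess T K ν νs h s τ
          √(Λ / ((2 * H) ^ 2 * epochLen T.eta (τ + 1)))) k (before ω k) (ω k) ≤ Λ) →
      ∑ k : Fin K, M.returnExcess T ν init √(Λ / ((H : ℝ) ^ 2 * K)) k (before ω k) (ω k) ≤ Λ →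
      ω ∈ G) :
    ENNReal.ofReal (1 - δ) ≤ (M.runLaw T ν init K).toOuterMeasure G := by
  classical
  set E : Finset ((_ : Fin H) × S × ℕ) :=
    (Finset.univ : Finset (Fin H)).sigma fun h => M.states h ×ˢ Finset.range (m + 1) with hE
  have hEc : E.card = J := by
    rw [hJ, hE, Finset.card_sigma]
    exact Finset.sum_congr rfl fun h _ => by rw [Finset.card_product, Finset.card_range]
  have hmem : ∀ (h : Fin H) (s : S) (τ : ℕ),
      (⟨h, s, τ⟩ : (_ : Fin H) × S × ℕ) ∈ E ↔ s ∈ M.states h ∧ τ ≤ m := by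
    intro h s τ
    simp [hE]
  set I := (E ×ˢ (Finset.range (l + 1) ×ˢ (Finset.univ : Finset Bool))).disjSum
    (E.disjSum ({()} : Finset Unit)) with hI
  have hIc : I.card = J * ((l + 1) * 2) + (J + 1) := by
    simp [hI, Finset.card_disjSum, Finset.card_product, hEc]
  set Y : ((((_ : Fin H) × S × ℕ) × ℕ × Bool) ⊕ (((_ : Fin H) × S × ℕ) ⊕ Unit)) →
      ∀ k : ℕ, (Fin k → Episode S A B H) → Episode S A B H → ℝ :=
    Sum.elim (fun j => M.visitIncr T ν j.1.1 j.1.2.1 (M.ixExcess T j.1.1 j.1.2.1 j.1.2.2 j.2.1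
        (if j.2.2 then
          stabWeight (ixParam T (M.acts j.1.1).card j.2.1) (learningRate T j.2.1)
        else fun _ a => ixParam T (M.acts j.1.1).card j.2.1 * (q j.1.1 j.1.2.1).1 a)))
      (Sum.elim (fun j => M.visitIncr T ν j.1 j.2.1 (M.gainExcess T K ν νs j.1 j.2.1 j.2.2
          √(Λ / ((2 * H) ^ 2 * epochLen T.eta (j.2.2 + 1)))))
        (fun _ => M.returnExcess T ν init √(Λ / ((H : ℝ) ^ 2 * K)))) with hY
  refine ofReal_le_runLaw_of_tests I Y ?_ (Λ := Λ) (by rw [hIc]; exact hδ) ?_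
  · rintro (⟨⟨h, s, τ⟩, i, b⟩ | ⟨h, s, τ⟩ | ⟨⟩) hi k ω
    · refine expect_exp_visitIncr_le_one ?_ _
      cases b
      · exact expect_exp_ixExcess_le_one h.isLt (hix h i)
          (fun p a => mul_nonneg (hix h i).le ((q h s).2.1 a))
          (fun p a => mul_le_of_le_one_right (hix h i).le ((q h s).le_one a)) k ω _
      · have hl : 0 < learningRate T i := div_pos hlr (by positivity)
        exact expect_exp_ixExcess_le_one h.isLt (hix h i)
          (fun p a => (stabWeight_mem (hix h i) hl p a).1)
          (fun p a => (stabWeight_mem (hix h i) hl p a).2) k ω _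
    · rw [hI, Finset.inr_mem_disjSum, Finset.inl_mem_disjSum, hmem] at hi
      exact expect_exp_visitIncr_le_one (expect_exp_gainExcess_le_one hK hνs h.isLt hi.1 τ
        (Real.sqrt_nonneg _) _ _) _
    · exact expect_exp_returnExcess_le_one (Real.sqrt_nonneg _) k ω
  · intro ω hω ht
    refine hG ω hω ?_ ?_ ?_
    · intro h s hs τ hτ i hi
      have hin : ∀ b, Sum.inl (⟨h, s, τ⟩, i, b) ∈ I := by
        intro b
        rw [hI, Finset.inl_mem_disjSum]
        simp [hmem, hs, hτ, hi]
      exact ⟨ht _ (hin false), ht _ (hin true)⟩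
    · intro h s hs τ hτ
      refine ht (Sum.inr (Sum.inl ⟨h, s, τ⟩)) ?_
      rw [hI, Finset.inr_mem_disjSum, Finset.inl_mem_disjSum, hmem]
      exact ⟨hs, hτ⟩
    · refine ht (Sum.inr (Sum.inr ())) ?_
      simp [hI]

/-- The width factor `ι` dominates the fluctuations of the estimates and the bandit regrets. -/
theorem sqrt_iota_bounds {H A L ι Λ D C n : ℝ} (hH : 1 ≤ H) (hA : 1 ≤ A) (hC : 3 ≤ C)
    (hι : 96 * C ^ 2 * (H ^ 2 * A * L) ≤ ι) (hD : 1 ≤ D) (hDL : D ≤ 6 * L)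
    (hΛ : Λ ≤ 3 * D) (hn : n ≤ A) :
    H ≤ √ι ∧ Λ ≤ ι ∧ 4 * H * √Λ ≤ √ι ∧ 4 * (H * (C * √(n * D))) ≤ √ι := by
  have hL : 1 / 6 ≤ L := by linarith
  have hC2 : 9 ≤ C ^ 2 := by nlinarith
  have hH2 : 1 ≤ H ^ 2 := one_le_pow₀ hH
  have hAL : L ≤ A * L := le_mul_of_one_le_left (by linarith) hA
  have h1 : 864 * (H ^ 2 * (A * L)) ≤ ι := by
    have := mul_le_mul_of_nonneg_right hC2 (by positivity : 0 ≤ 96 * (H ^ 2 * (A * L)))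
    linarith
  have h2 : H ^ 2 * L ≤ H ^ 2 * (A * L) := mul_le_mul_of_nonneg_left hAL (by positivity)
  have h3 : H ^ 2 * (1 / 6) ≤ H ^ 2 * L := mul_le_mul_of_nonneg_left hL (by positivity)
  have h4 : L ≤ H ^ 2 * L := le_mul_of_one_le_left (by linarith) hH2
  refine ⟨Real.le_sqrt_of_sq_le (by linarith), by linarith, ?_, ?_⟩
  · rw [show 4 * H * √Λ = √((4 * H) ^ 2 * Λ) by
      rw [Real.sqrt_mul (by positivity), Real.sqrt_sq (by positivity)]]
    refine Real.sqrt_le_sqrt ?_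
    have : H ^ 2 * Λ ≤ H ^ 2 * (18 * L) := mul_le_mul_of_nonneg_left (by linarith) (by positivity)
    linarith
  · rw [show 4 * (H * (C * √(n * D))) = √((4 * (H * C)) ^ 2 * (n * D)) by
      rw [Real.sqrt_mul (sq_nonneg _), Real.sqrt_sq (by positivity)]
      ring]
    refine Real.sqrt_le_sqrt ?_
    have h5 : n * D ≤ A * (6 * L) := mul_le_mul hn hDL (by linarith) (by linarith)
    have h6 := mul_le_mul_of_nonneg_left h5 (by positivity : 0 ≤ (4 * (H * C)) ^ 2)
    linarith

end Probability

end EpochV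

end

theorem theorem1 (cη cγ : ℝ) (hcη : 0 < cη) (hcγ : 0 < cγ) :
    ∃ c₀ : ℝ, 0 < c₀ ∧ ∃ C₀ : ℝ, 0 < C₀ ∧
      ∀ (S A B : Type*) [Fintype S] [Fintype A] [Fintype B]
        (H : ℕ) (M : EpochV.MarkovGame S A B H) (K : ℕ) (δ η ι : ℝ)
        (ν : ℕ → M.OppPolicy)
        (init : ∀ k : ℕ, (Fin k → EpochV.Episode S A B H) → S)
        (νs : ℕ → S → B → ℝ),
        1 ≤ H → 2 ≤ K → H * M.numStates ≤ K →
        0 < δ → δ < 1 →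
        (M.numStates : ℝ) / K ≤ η → η ≤ 1 / (H : ℝ) →
        c₀ * ((H : ℝ) ^ 2 * M.numActs * Real.log (H * K * M.numActs * M.numStates / δ)) ≤ ι →
        (∀ k ω, init k ω ∈ M.states 0) →
        M.IsMinimax K ν νs →
        ENNReal.ofReal (1 - δ) ≤
          (M.runLaw (M.tuning K δ η ι cη cγ) ν init K).toOuterMeasure
            {ω | M.regret (M.tuning K δ η ι cη cγ) ν init ω ≤
                  M.estRegret (M.tuning K δ η ι cη cγ) ν init ω ∧
                M.estRegret (M.tuning K δ η ι cη cγ) ν init ω ≤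
                  C₀ * (η * (H : ℝ) ^ 3 * M.nonstationarity ν νs ω +
                    H * Real.sqrt (ι * M.numStates * K * Real.log K / η))} := by
  have hC := EpochV.blockConst_ge_three hcη hcγ
  -- `96 = 16 * 6`, where `6` relates `log (n / conf)` to the logarithm in `ι`; and `184` is
  -- `6 * 5 * 6` from the recursion over the steps plus `4` from the fluctuations of the rewards.
  refine ⟨96 * EpochV.blockConst cη cγ ^ 2, by positivity, 184, by norm_num, ?_⟩
  intro S A B _ _ _ H M K δ η ι ν init νs hH hK hHSK hδ0 hδ1 hη hηH hι hinit hνs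
  have hs := EpochV.one_le_numStates M
  have hsr : (1 : ℝ) ≤ M.numStates := by exact_mod_cast hs
  have hHr : (1 : ℝ) ≤ H := by exact_mod_cast hH
  have hKr : (2 : ℝ) ≤ K := by exact_mod_cast hK
  have hηK : 1 / (K : ℝ) ≤ η := (div_le_div_of_nonneg_right hsr (by positivity)).trans hη
  have hη0 : 0 < η := lt_of_lt_of_le (by positivity) hηK
  have hηH' : η * H ≤ 1 := by rwa [le_div_iff₀ (by positivity)] at hηH
  have hη1 : η ≤ 1 := by nlinarith
  have hsK : M.numStates ≤ K := (Nat.le_mul_of_pos_left _ hH).trans hHSK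
  have hm : 1 ≤ EpochV.epochBound K η := by
    have h1 := EpochV.two_mul_log_le_epochBound hK hη0 hη1
    have h2 := EpochV.half_le_log hK
    exact_mod_cast (by linarith : (1 : ℝ) ≤ EpochV.epochBound K η)
  have hmK := EpochV.epochBound_le hK hηK
  have hmr : (1 : ℝ) ≤ EpochV.epochBound K η := by exact_mod_cast hm
  set T := M.tuning K δ η ι cη cγ with hT
  have hconf : T.conf = δ / (4 * H * M.numStates * EpochV.epochBound K η) := rfl
  have hconf0 : 0 < T.conf := by
    rw [hconf]
    positivity
  have hbd : ∀ h : Fin H, 1 ≤ Real.log ((M.acts h).card / T.conf) ∧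
      Real.log (1 / T.conf) ≤ Real.log ((M.acts h).card / T.conf) ∧
      Real.log ((M.acts h).card / T.conf) ≤
        6 * Real.log (H * K * M.numActs * M.numStates / δ) := fun h =>
    EpochV.conf_bounds hH hs hK hm hmK (M.acts_nonempty h).card_pos (EpochV.card_acts_le M h)
      hδ0 hδ1
  -- The level of the tests: each fails with probability at most `conf ^ 3`.
  set Λ := 3 * Real.log (1 / T.conf) with hΛ
  have hconf1 : T.conf < 1 := by
    rw [hconf, div_lt_one (by positivity)]
    have : (1 : ℝ) ≤ H * M.numStates * EpochV.epochBound K η :=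
      one_le_mul_of_one_le_of_one_le (one_le_mul_of_one_le_of_one_le hHr hsr) hmr
    linarith
  have hΛ0 : 0 < Λ := by
    have := Real.log_pos ((one_lt_div hconf0).2 hconf1)
    positivity
  have hexp : Real.exp (-Λ) = T.conf ^ 3 := by
    rw [hΛ, one_div, Real.log_inv, show -(3 * -Real.log T.conf) = ((3 : ℕ) : ℝ) * Real.log T.conf by
      push_cast; ring, Real.exp_nat_mul, Real.exp_log hconf0]
  have hall : ∀ h : Fin H, (H : ℝ) ≤ √T.iota ∧ Λ ≤ T.iota ∧ 4 * H * √Λ ≤ √T.iota ∧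
      4 * (H * (EpochV.blockConst T.lrConst T.ixConst *
        √((M.acts h).card * Real.log ((M.acts h).card / T.conf)))) ≤ √T.iota := by
    intro h
    have hn : (1 : ℝ) ≤ (M.acts h).card := by exact_mod_cast (M.acts_nonempty h).card_pos
    have hna : ((M.acts h).card : ℝ) ≤ M.numActs := by exact_mod_cast EpochV.card_acts_le M h
    obtain ⟨h1, h2, h3⟩ := hbd h
    exact EpochV.sqrt_iota_bounds hHr (hn.trans hna) hC hι h1 h3 (by linarith) hna
  have hq : ∀ (h : Fin H) (s : S), ∃ q : EpochV.Dist (M.acts h), s ∈ M.states h →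
      ∀ k : Fin K, M.empNash K ν h s ≤
        M.oneStep h (M.empNash K ν (h + 1)) s q.1 (ν k h s).1 := by
    intro h s
    by_cases hsh : s ∈ M.states h
    · obtain ⟨q, h1, -⟩ := M.exists_minimax (by omega) hνs h.isLt hsh
      exact ⟨q, fun _ => h1⟩
    · exact ⟨EpochV.uniformOn _ (M.acts_nonempty h), fun h1 => absurd h1 hsh⟩
  choose q hq using hq
  have hix : ∀ (h : Fin H) (i : ℕ), 0 < EpochV.ixParam T (M.acts h).card i := by
    intro h i
    have h1 := (hbd h).1
    have h2 : 0 < (M.acts h).card := (M.acts_nonempty h).card_pos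
    exact mul_pos hcγ (Real.sqrt_pos.2 (div_pos (by linarith) (by positivity)))
  refine EpochV.ofReal_le_runLaw_of_all_tests (Λ := Λ) (m := EpochV.epochBound K η)
    (l := Nat.log 2 K) (by omega) hνs hcη hix rfl ?_ q fun ω hω h1 h2 h3 => ?_
  · rw [hexp, hconf]
    have hJ : ∑ h : Fin H, (M.states h).card * (EpochV.epochBound K η + 1) ≤
        H * M.numStates * (EpochV.epochBound K η + 1) := by
      rw [← Finset.sum_mul]
      refine Nat.mul_le_mul_right _ ?_
      simpa using Finset.sum_le_card_nsmul Finset.univ (fun h : Fin H => (M.states h).card) _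
        fun h _ => EpochV.card_states_le M h
    have := EpochV.failure_numeric (Nat.mul_pos hH hs) hm
      (EpochV.log_two_le_epochBound hK hη0 hη1) hJ hδ0 hδ1
    rw [Nat.cast_mul H M.numStates, ← mul_assoc (4 : ℝ)] at this
    exact this
  · obtain ⟨hHι, hΛι, hι1, -⟩ := hall ⟨0, hH⟩
    have hg := EpochV.isGoodRun_of_tests (by omega) hω hinit hη0 hcη hcγ hΛ0
      (fun h => ⟨(hbd h).1, by linarith [(hbd h).2.1]⟩) hι1 (fun h => (hall h).2.2.2)
      (q := q) hq h1 h2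
    exact hg.regret_and_estRegret_le hK hω hinit hH hη0 hηH' hsK hνs hHι hΛ0 hΛι h3
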